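/- Let $z=e^{2\pi i/3}$ and let $^*$ denote complex conjugation. **Data and potentials.** Let $N\ge 1$, let $\eta_1,\dots,\eta_N>0$ be distinct, put $k_j=iz\eta_j$ (so $k_j^*=-iz^2\eta_j$), and let $E(k_j),E(k_j^*)$ be nonzero complex constants. Let $$\Gamma(k)=\prod_{j=1}^N(k+k_j)(k+k_j^*),\qquad T_l(k)=\frac{\Gamma(k)}{\Gamma(-k)},$$ $$\gamma(k_j)=-\frac{\Gamma(k_j)E(k_j)}{\Gamma(-zk_j)},\qquad \gamma(k_j^*)=-\frac{\Gamma(k_j^*)E(k_j^*)}{\Gamma(-z^2k_j^*)},$$ and assume $\gamma(k_j^*)=\gamma(k_j)^*$ for all $j$. Write $\gamma(k_j)=r_j+is_j$ with $r_j,s_j$ real. Put $\chi(k_j)=\exp\big((z-1)k_jx+9(z^2-1)k_j^5t\big)$, $\chi(k_j^*)=\exp\big((z^2-1)k_j^*x+9(z-1)(k_j^*)^5t\big)$, $$m_l(k_j)=k_j^l+(zk_j)^l\gamma(k_j)\chi(k_j),\qquad m_l(k_j^*)=(k_j^*)^l+(z^2k_j^*)^l\gamma(k_j^*)\chi(k_j^*).$$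 Let $M(x,t)$ be the $2N\times 2N$ matrix whose rows are $(m_{2N-1}(\kappa),\dots,m_1(\kappa),m_0(\kappa))$ for $\kappa=k_1,k_1^*,\dots,k_N,k_N^*$, let $B$ be the column of the $m_{2N}(\kappa)$, and let $(A_{2N-1},\dots,A_0)^T=-M^{-1}B$. Where $\det M\ne0$, put $$Q=-3A_{2N-1}',\qquad P=3\big(A_{2N-1}A_{2N-1}'-A_{2N-1}''-A_{2N-2}'\big),$$ $$f(k,x,t)=e^{kx}\frac{k^{2N}+\sum_{l<2N}A_lk^l}{\Gamma(k)},\qquad g(k,x,t)=e^{kx}\frac{k^{2N}+\sum_{l<2N}A_lk^l}{\Gamma(-k)},$$ where a prime is $\partial/\partial x$. **General $N$.** The following hold. 1. $T_l(k)=\prod_j\frac{k+iz\eta_j}{k-iz\eta_j}\,\frac{k-iz^2\eta_j}{k+iz^2\eta_j}$. Wherever $\det M\neq0$, the potentials $Q,P$ are real, $f(k,\cdot)$ and $g(k,\cdot)$ solve $\psi'''+Q\psi'+P\psi=k^3\psi$, and $f(k_j,x)=E(k_j)e^{9(z^2-1)k_j^5t}g(zk_j,x)$, $f(k_j^*,x)=E(k_j^*)e^{9(z-1)(k_j^*)^5t}g(z^2k_j^*,x)$.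 For each $t$: if $\Gamma(k)\ne0$ then $e^{-kx}f\to1$ as $x\to+\infty$ and $e^{-kx}f\to T_l(k)^{-1}$ as $x\to-\infty$; if $\Gamma(-k)\ne0$ then $e^{-kx}g\to1$ as $x\to-\infty$. 2. For every $t$, $\det M(x,t)$ tends, as $x\to-\infty$, to a limit $L\ne0$ that does not depend on $t$. 3. $P\equiv0$ (wherever $\det M\ne0$) if and only if, for every $j$, $s_j\operatorname{Re}c_j=r_j\operatorname{Im}c_j$ with $c_j=z^{N+1}\prod_{l\ne j}(\eta_j^2-z^2\eta_l^2)$. Likewise $P\equiv Q_x$ if and only if the same relations hold with $c_j=z^{N-1}\prod_{l\neq j}(\eta_j^2-z^2\eta_l^2)$. (So $s_j$ is proportional to $r_j$, with a coefficient determined by the $\eta$'s.) 4. Assume $P\equiv0$ or $P\equiv Q_x$, take the corresponding $c_j$, and put $$w_j=\operatorname{Re}\Big(\frac{\gamma(k_j)}{c_j}\Big)\prod_{l\ne j}\frac{(\eta_j+\eta_l)(\eta_j^3-\eta_l^3)}{(\eta_j-\eta_l)^2},\qquad \chi_j=e^{\sqrt3\,\eta_j(x-9\eta_j^4t)}.$$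 Then every $w_j$ is nonzero, and $\det M/L=\Delta^2$ for all $x,t$, where $\Delta(N,x)$ is the tau function of Hirota's $N$-soliton, $$\Delta(N,x)=\sum_{S\subseteq\{1,\dots,N\}}\ \prod_{j\in S}w_j\chi_j\prod_{\substack{j<l\\ j,l\in S}}\frac{(\eta_j-\eta_l)^2(\eta_j^2-\eta_j\eta_l+\eta_l^2)}{(\eta_j+\eta_l)^2(\eta_j^2+\eta_j\eta_l+\eta_l^2)} .$$ At all points where $\Delta\ne0$, $Q=6(\Delta'/\Delta)'$ is real and smooth and solves the Sawada–Kotera equation $$Q_t+Q_{xxxxx}+5Q_xQ_{xx}+5QQ_{xxx}+5Q^2Q_x=0 .$$ If all $w_j>0$, then $\Delta>0$ on $\mathbb R^2$ and $\Delta=\sqrt{\det M/L}$, so that $Q$ has no singularities. **$N=1$.** $P\equiv0$ if and only if $s_1=\sqrt3\,r_1$. In that case $\Delta=1-2r_1\chi_1$ and $$Q=-\frac{36r_1\eta_1^2\chi_1}{(1-2r_1\chi_1)^2}$$ where $\Delta\neq0$, and there is no singularity if $r_1<0$. Also $P\equiv Q_x$ if and only if $s_1=0$. In that case $\Delta=1+r_1\chi_1$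 and $$Q=\frac{18r_1\eta_1^2\chi_1}{(1+r_1\chi_1)^2}$$ where $\Delta\ne0$, and there is no singularity if $r_1>0$. **$N=2$.** $P\equiv0$ if and only if $$s_1=\frac{\sqrt3\,\eta_2^2}{2\eta_1^2+\eta_2^2}\,r_1,\qquad s_2=\frac{\sqrt3\,\eta_1^2}{\eta_1^2+2\eta_2^2}\,r_2,$$ and then $\Delta=1+w_1\chi_1+w_2\chi_2+w_{12}\chi_1\chi_2$ with $$w_1=\frac{2r_1(\eta_1+\eta_2)(\eta_1^3-\eta_2^3)}{(\eta_1-\eta_2)^2(2\eta_1^2+\eta_2^2)},\qquad w_2=-\frac{2r_2(\eta_1+\eta_2)(\eta_1^3-\eta_2^3)}{(\eta_1-\eta_2)^2(\eta_1^2+2\eta_2^2)},$$ $$w_{12}=-\frac{4r_1r_2(\eta_1^6-\eta_2^6)}{(\eta_1^2-\eta_2^2)(2\eta_1^2+\eta_2^2)(\eta_1^2+2\eta_2^2)} .$$ Also $P\equiv Q_x$ if and only if $$s_1=-\frac{\sqrt3\,\eta_1^2}{\eta_1^2+2\eta_2^2}\,r_1,\qquad s_2=-\frac{\sqrt3\,\eta_2^2}{2\eta_1^2+\eta_2^2}\,r_2,$$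 and then $\Delta$ has the same form with $$w_1=-\frac{2r_1(\eta_1+\eta_2)(\eta_1^3-\eta_2^3)}{(\eta_1-\eta_2)^2(\eta_1^2+2\eta_2^2)},\qquad w_2=\frac{2r_2(\eta_1+\eta_2)(\eta_1^3-\eta_2^3)}{(\eta_1-\eta_2)^2(2\eta_1^2+\eta_2^2)}$$ and the same $w_{12}$. -/

import Mathlib

open Filter Topology

namespace SKSoliton

noncomputable section

/-- The cube root of unity `z = e^{2πi/3}`. -/
def z : ℂ := -1 / 2 + Complex.I * (Real.sqrt 3 / 2 : ℝ)

/-! ### The general `2N`-pole reflectionless data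

The data are points `k j`, the initial dependency constants `E j` at `k j`, and the initial
dependency constants `E' j` at the complex conjugate of `k j`. -/

section General

variable {N : ℕ}

/-- `Γ(κ) = ∏ (κ + k_j)(κ + k_j^*)`. -/
def bigGamma (k : Fin N → ℂ) (κ : ℂ) : ℂ :=
  ∏ j, (κ + k j) * (κ + starRingEnd ℂ (k j))

/-- The left transmission coefficient `T_l(κ) = Γ(κ) / Γ(-κ)`. -/
def transmission (k : Fin N → ℂ) (κ : ℂ) : ℂ :=
  bigGamma k κ / bigGamma k (-κ)

/-- The modified dependency constant `γ(k_j)`. -/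
def gam (k E : Fin N → ℂ) (j : Fin N) : ℂ :=
  -(bigGamma k (k j) * E j / bigGamma k (-(z * k j)))

/-- The modified dependency constant `γ(k_j^*)`. -/
def gamConj (k E' : Fin N → ℂ) (j : Fin N) : ℂ :=
  -(bigGamma k (starRingEnd ℂ (k j)) * E' j / bigGamma k (-(z ^ 2 * starRingEnd ℂ (k j))))

/-- `χ(k_j)`. -/
def chi (k : Fin N → ℂ) (j : Fin N) (x t : ℝ) : ℂ :=
  Complex.exp ((z - 1) * k j * x + 9 * (z ^ 2 - 1) * k j ^ 5 * t)

/-- `χ(k_j^*)`. -/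
def chiConj (k : Fin N → ℂ) (j : Fin N) (x t : ℝ) : ℂ :=
  Complex.exp ((z ^ 2 - 1) * starRingEnd ℂ (k j) * x
    + 9 * (z - 1) * starRingEnd ℂ (k j) ^ 5 * t)

/-- `m_l(k_j)` for `b = 0`, and `m_l(k_j^*)` for `b = 1`. -/
def entry (k E E' : Fin N → ℂ) (l : ℕ) (j : Fin N) (b : Fin 2) (x t : ℝ) : ℂ :=
  if b = 0 then k j ^ l + (z * k j) ^ l * gam k E j * chi k j x t
  else starRingEnd ℂ (k j) ^ l
    + (z ^ 2 * starRingEnd ℂ (k j)) ^ l * gamConj k E' j * chiConj k j x t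

/-- The `2N × 2N` matrix `M(x,t)`: the rows are those of `k_1, k_1^*, …, k_N, k_N^*`, in this
order, and the columns are those of the powers `2N-1, …, 1, 0`. -/
def bigM (k E E' : Fin N → ℂ) (x t : ℝ) : Matrix (Fin (N * 2)) (Fin (N * 2)) ℂ :=
  fun i c => entry k E E' (c.rev : ℕ) i.divNat i.modNat x t

/-- The column `B(x,t)`, with the entries `m_{2N}`. -/
def bigB (k E E' : Fin N → ℂ) (x t : ℝ) : Fin (N * 2) → ℂ :=
  fun i => entry k E E' (N * 2) i.divNat i.modNat x t

/-- The column `A = -M⁻¹ B`; its component with index `c` is `A_{2N-1-c}`. -/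
def bigA (k E E' : Fin N → ℂ) (x t : ℝ) : Fin (N * 2) → ℂ :=
  -((bigM k E E' x t)⁻¹.mulVec (bigB k E E' x t))

/-- The coefficient `A_l(x,t)`, for `0 ≤ l ≤ 2N-1`. -/
def coefA (k E E' : Fin N → ℂ) (l : ℕ) (x t : ℝ) : ℂ :=
  if h : l < N * 2 then bigA k E E' x t (Fin.rev ⟨l, h⟩) else 0

/-- The potential `Q = -3 A_{2N-1}'`. -/
def potQ (k E E' : Fin N → ℂ) (x t : ℝ) : ℂ :=
  -3 * deriv (fun y => coefA k E E' (2 * N - 1) y t) x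

/-- The potential `P = 3 (A_{2N-1} A_{2N-1}' - A_{2N-1}'' - A_{2N-2}')`. -/
def potP (k E E' : Fin N → ℂ) (x t : ℝ) : ℂ :=
  3 * (coefA k E E' (2 * N - 1) x t * deriv (fun y => coefA k E E' (2 * N - 1) y t) x
    - iteratedDeriv 2 (fun y => coefA k E E' (2 * N - 1) y t) x
    - deriv (fun y => coefA k E E' (2 * N - 2) y t) x)

/-- The monic polynomial `κ^{2N} + V(κ) A(x,t)`. -/
def monicPoly (k E E' : Fin N → ℂ) (κ : ℂ) (x t : ℝ) : ℂ :=
  κ ^ (2 * N) + ∑ l ∈ Finset.range (2 * N), coefA k E E' l x t * κ ^ l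

/-- The left Jost solution `f(κ,x,t)`. -/
def jostF (k E E' : Fin N → ℂ) (κ : ℂ) (x t : ℝ) : ℂ :=
  Complex.exp (κ * x) * monicPoly k E E' κ x t / bigGamma k κ

/-- The right Jost solution `g(κ,x,t)`. -/
def jostG (k E E' : Fin N → ℂ) (κ : ℂ) (x t : ℝ) : ℂ :=
  Complex.exp (κ * x) * monicPoly k E E' κ x t / bigGamma k (-κ)

/-- `ψ''' + Q ψ' + P ψ = κ³ ψ` at the point `x`. -/
def SolvesThirdOrder (Q P : ℝ → ℂ) (κ : ℂ) (ψ : ℝ → ℂ) (x : ℝ) : Prop :=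
  ContDiffAt ℝ 3 ψ x ∧
    iteratedDeriv 3 ψ x + Q x * deriv ψ x + P x * ψ x = κ ^ 3 * ψ x

end General

/-! ### The two reductions to the Sawada–Kotera equation -/

/-- `q` is smooth near `(x,t)` and solves the Sawada–Kotera equation
`q_t + q_xxxxx + 5 q_x q_xx + 5 q q_xxx + 5 q² q_x = 0` at `(x,t)`. -/
def SolvesSawadaKotera (q : ℝ → ℝ → ℝ) (x t : ℝ) : Prop :=
  ContDiffAt ℝ (⊤ : ℕ∞) (fun p : ℝ × ℝ => q p.1 p.2) (x, t) ∧
    deriv (fun s => q x s) t + iteratedDeriv 5 (fun y => q y t) x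
      + 5 * deriv (fun y => q y t) x * iteratedDeriv 2 (fun y => q y t) x
      + 5 * q x t * iteratedDeriv 3 (fun y => q y t) x
      + 5 * q x t ^ 2 * deriv (fun y => q y t) x = 0

/-- The two reductions: `P ≡ 0` and `P ≡ Q_x`. -/
inductive Reduction
  | zero
  | derivative

variable {N : ℕ}

/-- The reduction holds for the potentials of the given data (wherever `det M ≠ 0`, that is,
where these potentials are defined). -/
def Holds (c : Reduction) (k E E' : Fin N → ℂ) : Prop :=
  match c with
  | .zero => ∀ x t : ℝ, (bigM k E E' x t).det ≠ 0 → potP k E E' x t = 0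
  | .derivative => ∀ x t : ℝ, (bigM k E E' x t).det ≠ 0 →
      potP k E E' x t = deriv (fun y => potQ k E E' y t) x

/-- The points `k_j = i z η_j`. -/
def poles (η : Fin N → ℝ) (j : Fin N) : ℂ := Complex.I * z * η j

/-- The input data: distinct positive `η_j`, nonzero dependency constants at `k_j = i z η_j` and
at `k_j^*`, and `γ(k_j^*) = γ(k_j)^*`. -/
structure InputData (η : Fin N → ℝ) (E E' : Fin N → ℂ) : Prop where
  pos : ∀ j, 0 < η j
  distinct : Function.Injective η
  E_ne : ∀ j, E j ≠ 0
  E'_ne : ∀ j, E' j ≠ 0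
  conj : ∀ j, gamConj (poles η) E' j = starRingEnd ℂ (gam (poles η) E j)

/-- The complex number `z^{N+1} ∏_{l ≠ j} (η_j² - z² η_l²)` for `P ≡ 0`, and
`z^{N-1} ∏_{l ≠ j} (η_j² - z² η_l²)` for `P ≡ Q_x` (note `z^{N+2} = z^{N-1}`). -/
def direction (c : Reduction) (η : Fin N → ℝ) (j : Fin N) : ℂ :=
  (match c with
    | .zero => z ^ (N + 1)
    | .derivative => z ^ (N + 2)) *
    ∏ l ∈ Finset.univ.erase j, ((η j : ℂ) ^ 2 - z ^ 2 * (η l : ℂ) ^ 2)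

/-- The coefficient `w_j` of `χ_j`. -/
def weight (c : Reduction) (η : Fin N → ℝ) (E : Fin N → ℂ) (j : Fin N) : ℝ :=
  (gam (poles η) E j / direction c η j).re *
    ∏ l ∈ Finset.univ.erase j,
      (η j + η l) * (η j ^ 3 - η l ^ 3) / (η j - η l) ^ 2

/-- `χ_j = exp(√3 η_j (x - 9 η_j⁴ t))`, for `η_j = a`. -/
def wave (a x t : ℝ) : ℝ := Real.exp (Real.sqrt 3 * a * (x - 9 * a ^ 4 * t))

/-- Hirota's interaction coefficient for the Sawada–Kotera equation. -/
def interaction (a b : ℝ) : ℝ :=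
  (a - b) ^ 2 * (a ^ 2 - a * b + b ^ 2) / ((a + b) ^ 2 * (a ^ 2 + a * b + b ^ 2))

/-- Hirota's `N`-soliton tau function for the Sawada–Kotera equation. -/
def hirotaTau (η w : Fin N → ℝ) (x t : ℝ) : ℝ :=
  ∑ S : Finset (Fin N),
    (∏ j ∈ S, w j * wave (η j) x t) *
      ∏ j ∈ S, ∏ l ∈ S.filter (fun l => j < l), interaction (η j) (η l)

/-- `6 (τ' / τ)'`, the prime being the `x`-derivative. -/
def sixLogDeriv (τ : ℝ → ℝ → ℝ) (x t : ℝ) : ℝ :=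
  6 * deriv (fun y => deriv (fun u => τ u t) y / τ y t) x

end

end SKSoliton

open Filter Topology
namespace SKSoliton
noncomputable section
open scoped Polynomial
open Polynomial (X C)

/-! ### The cube root of unity and the poles -/

/-! Everything is read off from one polynomial Φ = `bigPhi` in the spectral parameter κ. Where `det
M ≠ 0`, it is the only monic polynomial of degree 2N with Φ(p) + γχ Φ(p') = 0 at each pole p = k_j,
k_j^* with partner p' = z k_j, z² k_j^* (`Kills`, `bigPhi_unique`), and a polynomial of degree below
2N obeying these relations is zero (`Kills.eq_zero`). Since p'³ = p³, (γχ)_x = (p' - p)γχ and (γχ)_t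
= 9(p'⁵ - p⁵)γχ, the relations survive multiplication by κ³ and the operators ∂_x + κ and ∂_t + 9κ⁵.
The potentials are exactly the functions for which ((∂_x + κ)³ + Q(∂_x + κ) + P - κ³)Φ has degree
below 2N, so this expression vanishes (`third_order`), which is the third order equation for
e^{κx}Φ. At x → -∞ the couplings γχ vanish and Φ tends to ∏(κ - p); at +∞ they dominate and Φ tends
to ∏(κ - p').

Sufficiency for P = 0. When the γ's point in the directions c_j, an explicit polynomial `tauPoly`, a
sum over subsets S of Hirota's terms times quadratic factors with the signs of the η_j, j ∈ S,
reversed, obeys the same relations (`tauPoly_relation`), so Φ = `tauPoly`/τ. Its constant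
coefficient is ∏η_j², whence P = 0 on setting κ = 0 in `third_order`; its next-to-leading
coefficient is ∑√3η_j - 2τ'/τ. Jacobi's formula gives (log det M)' = -A_{2N-1} - ∑p
(`hasDerivAt_det_bigM`), so det M / τ² is constant near -∞, and `det M = L τ²` everywhere by
analyticity (`InputData.det_eq`).

The reduction P = Q_x is carried to P = 0 by replacing γ(k_j) with z²γ(k_j): the new polynomial is
(∂_x + κ)Φ/κ (`InputData.exists_zero`, `InputData.coeff_bigPhi_derivative`), a Darboux
transformation that preserves A_{2N-1}, hence τ and Q.

Necessity. Lagrange interpolation of Φ(κ)Φ(-κ), a polynomial in κ², at the squares of the poles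
turns either reduction into the constancy near -∞ of a sum of terms Φ(p)Φ(-p)/weight
(`lagrange_bigPhi`). By the linear relations this is a sum of real multiples of the waves χ_j with
factors having nonzero limits. It tends to 0, and the waves decay at different rates, so every
multiple is zero; this is the alignment condition (`InputData.aligned_of_const`). For P = 0 the
constancy of A_0 comes from A_0''' + Q A_0' = 0 together with exponential decay.

Sawada–Kotera. With P = 0, the fifth order operator of the Lax pair, reduced modulo the third order
equation, is subtracted from ∂_t + 9κ⁵; the result obeys the relations and has degree below 2N, so
it vanishes, and its coefficient of κ^{2N-1} is the evolution of A_{2N-1}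
(`InputData.time_evolution`). -/

lemma sqrt_three_sq : ((Real.sqrt 3 : ℝ) : ℂ) ^ 2 = 3 := by
  rw [← Complex.ofReal_pow, Real.sq_sqrt (by norm_num)]; norm_num

lemma z_sq_add : z ^ 2 + z + 1 = 0 := by
  unfold z
  push_cast
  linear_combination (-1 / 4 : ℂ) * sqrt_three_sq
    + ((Real.sqrt 3 : ℝ) : ℂ) ^ 2 / 4 * Complex.I_sq

lemma z_sq : z ^ 2 = -z - 1 := by linear_combination z_sq_add

lemma z_cube : z ^ 3 = 1 := by linear_combination (z - 1) * z_sq_add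

lemma z_ne : z ≠ 0 := by
  intro h
  have := z_cube
  simp [h] at this

lemma conj_z : starRingEnd ℂ z = z ^ 2 := by
  rw [z_sq]
  unfold z
  simp only [map_add, map_mul, Complex.conj_I, Complex.conj_ofReal, map_div₀, map_neg, map_one]
  rw [show starRingEnd ℂ 2 = 2 from Complex.conj_ofNat 2]
  ring

lemma I_mul_z_sq_sub : Complex.I * (z ^ 2 - z) = (Real.sqrt 3 : ℝ) := by
  rw [z_sq]
  unfold z
  push_cast
  linear_combination (-(Real.sqrt 3 : ℝ) : ℂ) * Complex.I_sq

lemma z_re : z.re = -1 / 2 := by simp [z]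

lemma z_im : z.im = Real.sqrt 3 / 2 := by simp [z]

section Points

variable {N : ℕ} (η : Fin N → ℝ) (E E' : Fin N → ℂ)

/-- The points `k_j` and `k_j^*`. -/
def pt (i : Fin N × Fin 2) : ℂ :=
  if i.2 = 0 then Complex.I * z * η i.1 else -(Complex.I * z ^ 2 * η i.1)

/-- The points `z k_j = -k_j^*` and `z² k_j^* = -k_j`. -/
def partner (i : Fin N × Fin 2) : ℂ :=
  if i.2 = 0 then Complex.I * z ^ 2 * η i.1 else -(Complex.I * z * η i.1)

/-- The constants `γ(k_j)` and `γ(k_j^*)`. -/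
def gamma (i : Fin N × Fin 2) : ℂ :=
  if i.2 = 0 then gam (poles η) E i.1 else gamConj (poles η) E' i.1

/-- The coefficients `γ χ` of the linear relations. -/
def coupling (i : Fin N × Fin 2) (x t : ℝ) : ℂ :=
  gamma η E E' i * ((wave (η i.1) x t : ℝ) : ℂ)

lemma conj_poles (j : Fin N) : starRingEnd ℂ (poles η j) = -(Complex.I * z ^ 2 * η j) := by
  simp only [poles, map_mul, Complex.conj_I, conj_z, Complex.conj_ofReal]
  ring

lemma pt_zero (j : Fin N) : pt η (j, 0) = Complex.I * z * η j := by simp [pt]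
lemma pt_one (j : Fin N) : pt η (j, 1) = -(Complex.I * z ^ 2 * η j) := by simp [pt]
lemma partner_zero (j : Fin N) : partner η (j, 0) = Complex.I * z ^ 2 * η j := by simp [partner]
lemma partner_one (j : Fin N) : partner η (j, 1) = -(Complex.I * z * η j) := by simp [partner]

/-- The partner is the pole times a cube root of unity. This makes the linear relations stable under
multiplication by κ³. -/
lemma pt_cube (i : Fin N × Fin 2) : partner η i ^ 3 = pt η i ^ 3 := by
  unfold pt partner
  split_ifs <;> linear_combination
    (Complex.I ^ 3 * (η i.1 : ℂ) ^ 3) * (z ^ 3) * z_cube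

/-- Both exponents collapse because i(z² - z) = √3 and (iz)⁵ = iz²; this is where the real wave of
speed 9η⁴ appears. -/
lemma chi_eq (j : Fin N) (x t : ℝ) : chi (poles η) j x t = ((wave (η j) x t : ℝ) : ℂ) := by
  unfold chi wave poles
  rw [Complex.ofReal_exp]
  congr 1
  push_cast
  have h4 : Complex.I ^ 4 = 1 := Complex.I_pow_four
  have h := I_mul_z_sq_sub
  rw [← h]
  have h5 : (Complex.I * z * (η j : ℂ)) ^ 5 = Complex.I * z ^ 2 * (η j : ℂ) ^ 5 := by
    linear_combination (Complex.I * z ^ 5 * (η j : ℂ) ^ 5) * h4 + Complex.I * (η j : ℂ) ^ 5 * z ^ 2 * z_cube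
  rw [h5]
  linear_combination (9 * t * Complex.I * (η j : ℂ) ^ 5 * z) * z_cube

lemma chiConj_eq (j : Fin N) (x t : ℝ) :
    chiConj (poles η) j x t = ((wave (η j) x t : ℝ) : ℂ) := by
  have h : chiConj (poles η) j x t = starRingEnd ℂ (chi (poles η) j x t) := by
    unfold chiConj chi
    rw [← Complex.exp_conj]
    congr 1
    have h9 : starRingEnd ℂ 9 = 9 := Complex.conj_ofNat 9
    simp only [map_add, map_mul, map_sub, map_pow, map_one, conj_z, Complex.conj_ofReal, h9]
    linear_combination (- 9 * (starRingEnd ℂ (poles η j)) ^ 5 * t * z) * z_cube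
  rw [h, chi_eq, Complex.conj_ofReal]

/-- The entries are the functional Ψ ↦ Ψ(p) + γχ Ψ(p') applied to monomials, so the linear system
becomes a statement about polynomials. -/
lemma entry_eq (l : ℕ) (i : Fin N × Fin 2) (x t : ℝ) :
    entry (poles η) E E' l i.1 i.2 x t
      = pt η i ^ l + coupling η E E' i x t * partner η i ^ l := by
  unfold entry coupling gamma pt partner
  split_ifs with h
  · rw [chi_eq, show z * poles η i.1 = Complex.I * z ^ 2 * η i.1 by unfold poles; ring]
    simp only [poles]
    ring
  · rw [chiConj_eq, conj_poles, show z ^ 2 * -(Complex.I * z ^ 2 * (η i.1 : ℂ))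
      = -(Complex.I * z * η i.1) by linear_combination (-Complex.I * z * η i.1) * z_cube]
    ring

/-- The index of a row, as a pair. -/
def rowIdx (i : Fin (N * 2)) : Fin N × Fin 2 := (i.divNat, i.modNat)

lemma rowIdx_bijective : Function.Bijective (rowIdx : Fin (N * 2) → Fin N × Fin 2) :=
  (finProdFinEquiv (m := N) (n := 2)).symm.bijective

lemma bigM_apply (x t : ℝ) (i c : Fin (N * 2)) :
    bigM (poles η) E E' x t i c = pt η (rowIdx i) ^ (c.rev : ℕ)
      + coupling η E E' (rowIdx i) x t * partner η (rowIdx i) ^ (c.rev : ℕ) :=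
  entry_eq η E E' _ (rowIdx i) x t

lemma bigB_apply (x t : ℝ) (i : Fin (N * 2)) :
    bigB (poles η) E E' x t i = pt η (rowIdx i) ^ (N * 2)
      + coupling η E E' (rowIdx i) x t * partner η (rowIdx i) ^ (N * 2) :=
  entry_eq η E E' _ (rowIdx i) x t

variable {η}

lemma re_mul_z (a : ℝ) : (Complex.I * z * a).re = -(Real.sqrt 3 / 2 * a) := by
  simp [z]
lemma im_mul_z (a : ℝ) : (Complex.I * z * a).im = -(a / 2) := by
  simp [z]; ring

lemma re_mul_z_sq (a : ℝ) : (Complex.I * z ^ 2 * a).re = Real.sqrt 3 / 2 * a := by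
  rw [z_sq]; simp [z]
lemma im_mul_z_sq (a : ℝ) : (Complex.I * z ^ 2 * a).im = -(a / 2) := by
  rw [z_sq]; simp [z]; ring

lemma pt_re (i : Fin N × Fin 2) : (pt η i).re = -(Real.sqrt 3 / 2 * η i.1) := by
  unfold pt; split_ifs
  · rw [re_mul_z]
  · rw [Complex.neg_re, re_mul_z_sq]

lemma pt_im (i : Fin N × Fin 2) :
    (pt η i).im = if i.2 = 0 then -(η i.1 / 2) else η i.1 / 2 := by
  unfold pt; split_ifs
  · rw [im_mul_z]
  · rw [Complex.neg_im, im_mul_z_sq, neg_neg]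

lemma pt_injective (hp : ∀ j, 0 < η j) (hd : Function.Injective η) :
    Function.Injective (pt η) := by
  intro a b h
  have h1 := congrArg Complex.re h
  have h2 := congrArg Complex.im h
  rw [pt_re, pt_re] at h1
  rw [pt_im, pt_im] at h2
  have h3 : η a.1 = η b.1 := by
    have : (0 : ℝ) < Real.sqrt 3 := by positivity
    have h4 : Real.sqrt 3 / 2 * (η a.1 - η b.1) = 0 := by linarith
    rcases mul_eq_zero.1 h4 with h5 | h5 <;> linarith
  have h4 := hd h3
  refine Prod.ext h4 ?_
  have := hp a.1
  by_contra hne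
  rw [h3] at h2 this
  have ha : a.2 = 0 ∨ a.2 = 1 := by omega
  have hb : b.2 = 0 ∨ b.2 = 1 := by omega
  rcases ha with ha | ha <;> rcases hb with hb | hb <;> simp [ha, hb] at h2 hne <;> linarith

lemma pt_ne_zero (hp : ∀ j, 0 < η j) (i : Fin N × Fin 2) : pt η i ≠ 0 := by
  intro h0
  have h := congrArg Complex.re h0
  rw [pt_re, Complex.zero_re] at h
  have h3 := hp i.1
  have : 0 < Real.sqrt 3 / 2 * η i.1 := by positivity
  linarith

/-- The partner of one member of a conjugate pair is minus the other member. Both the conjugation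
symmetry and the pairing of terms in `InputData.node_pair` rest on this. -/
lemma partner_eq (i : Fin N × Fin 2) : partner η i = -pt η (i.1, i.2.rev) := by
  obtain ⟨j, b⟩ := i
  fin_cases b <;> simp [partner, pt]

lemma partner_injective (hp : ∀ j, 0 < η j) (hd : Function.Injective η) :
    Function.Injective (partner η) := by
  intro a b h
  rw [partner_eq, partner_eq, neg_inj] at h
  have := pt_injective hp hd h
  simp only [Prod.mk.injEq, Fin.rev_inj] at this
  exact Prod.ext this.1 this.2

lemma bigGamma_eq (κ : ℂ) : bigGamma (poles η) κ = ∏ i, (κ + pt η i) := by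
  rw [Fintype.prod_prod_type]
  refine Finset.prod_congr rfl fun j _ => ?_
  rw [Fin.prod_univ_two, pt_zero, pt_one, conj_poles, poles]

lemma bigGamma_neg_eq (κ : ℂ) : bigGamma (poles η) (-κ) = ∏ i, (κ - pt η i) := by
  unfold bigGamma
  rw [Fintype.prod_prod_type]
  refine Finset.prod_congr rfl fun j _ => ?_
  rw [Fin.prod_univ_two, pt_zero, pt_one, conj_poles, poles]
  ring

/-- All poles lie in the open left half plane, so no two of them sum to zero. -/
lemma bigGamma_pt_ne (hp : ∀ j, 0 < η j) (i : Fin N × Fin 2) :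
    bigGamma (poles η) (pt η i) ≠ 0 := by
  rw [bigGamma_eq]
  refine Finset.prod_ne_zero_iff.2 fun l _ h => ?_
  have h1 := congrArg Complex.re h
  rw [Complex.add_re, pt_re, pt_re, Complex.zero_re] at h1
  have : (0 : ℝ) < Real.sqrt 3 := by positivity
  nlinarith [hp i.1, hp l.1, mul_pos this (hp i.1), mul_pos this (hp l.1)]

lemma gam_eq (j : Fin N) : gam (poles η) E j =
    -(bigGamma (poles η) (pt η (j, 0)) * E j / bigGamma (poles η) (pt η (j, 1))) := by
  unfold gam
  rw [pt_zero, pt_one]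
  congr 3
  unfold poles; ring_nf

lemma gamConj_eq (j : Fin N) : gamConj (poles η) E' j =
    -(bigGamma (poles η) (pt η (j, 1)) * E' j / bigGamma (poles η) (pt η (j, 0))) := by
  unfold gamConj
  rw [pt_zero, pt_one, conj_poles]
  congr 3
  linear_combination (Complex.I * z * η j) * z_cube

variable {E E'}

lemma InputData.gam_ne (h : InputData η E E') (j : Fin N) : gam (poles η) E j ≠ 0 := by
  rw [gam_eq]
  exact neg_ne_zero.2 (div_ne_zero (mul_ne_zero (bigGamma_pt_ne h.pos _) (h.E_ne j))
    (bigGamma_pt_ne h.pos _))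

lemma gamma_zero (j : Fin N) : gamma η E E' (j, 0) = gam (poles η) E j := by simp [gamma]

lemma InputData.gamma_one (h : InputData η E E') (j : Fin N) :
    gamma η E E' (j, 1) = starRingEnd ℂ (gam (poles η) E j) := by
  simp [gamma, h.conj j]

lemma InputData.gamma_ne (h : InputData η E E') (i : Fin N × Fin 2) : gamma η E E' i ≠ 0 := by
  unfold gamma
  split_ifs
  · exact h.gam_ne _
  · rw [h.conj]; exact (map_ne_zero _).2 (h.gam_ne _)

/-- Dependency constants with prescribed modified constants. -/
lemma exists_inputData (hp : ∀ j, 0 < η j) (hd : Function.Injective η) (c : Fin N → ℂ)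
    (hc : ∀ j, c j ≠ 0) :
    ∃ E E' : Fin N → ℂ, InputData η E E' ∧ ∀ j, gam (poles η) E j = c j := by
  have h := bigGamma_pt_ne hp
  have key : ∀ j, gam (poles η) (fun j => -(c j * bigGamma (poles η) (pt η (j, 1))
      / bigGamma (poles η) (pt η (j, 0)))) j = c j := by
    intro j
    rw [gam_eq]
    have := h (j, 0)
    have := h (j, 1)
    field_simp
  refine ⟨_, fun j => -(starRingEnd ℂ (c j) * bigGamma (poles η) (pt η (j, 0))
      / bigGamma (poles η) (pt η (j, 1))), ⟨hp, hd, fun j => ?_, fun j => ?_, fun j => ?_⟩, key⟩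
  · exact neg_ne_zero.2 (div_ne_zero (mul_ne_zero (hc j) (h _)) (h _))
  · exact neg_ne_zero.2 (div_ne_zero (mul_ne_zero ((map_ne_zero _).2 (hc j)) (h _)) (h _))
  · rw [key, gamConj_eq]
    have := h (j, 0)
    have := h (j, 1)
    field_simp

end Points

/-! ### The linear system -/

section General

lemma contDiff_det {V m : Type*} [NormedAddCommGroup V] [NormedSpace ℝ V] [Fintype m]
    [DecidableEq m] {n : WithTop ℕ∞} {A : V → Matrix m m ℂ}
    (h : ∀ i j, ContDiff ℝ n fun v => A v i j) : ContDiff ℝ n fun v => (A v).det := by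
  simp only [Matrix.det_apply']
  exact ContDiff.sum fun σ _ => contDiff_const.mul (contDiff_prod fun i _ => h _ _)

lemma contDiff_adjugate {V m : Type*} [NormedAddCommGroup V] [NormedSpace ℝ V] [Fintype m]
    [DecidableEq m] {n : WithTop ℕ∞} {A : V → Matrix m m ℂ}
    (h : ∀ i j, ContDiff ℝ n fun v => A v i j) (i j : m) :
    ContDiff ℝ n fun v => (A v).adjugate i j := by
  simp only [Matrix.adjugate_apply]
  refine contDiff_det fun a b => ?_
  simp only [Matrix.updateRow_apply]
  split_ifs
  · exact contDiff_const
  · exact h a b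

end General

section System

variable {N : ℕ} {η : Fin N → ℝ} {E E' : Fin N → ℂ}

variable (η E E') in
/-- The linear relations between the values of a polynomial at the poles and their partners. -/
def Kills (x t : ℝ) (Ψ : ℂ[X]) : Prop :=
  ∀ i, Ψ.eval (pt η i) + coupling η E E' i x t * Ψ.eval (partner η i) = 0

variable (η E E') in
/-- The monic polynomial `κ^{2N} + ∑ A_l κ^l`, as a polynomial. -/
def bigPhi (x t : ℝ) : ℂ[X] :=
  X ^ (N * 2) + ∑ l ∈ Finset.range (N * 2), C (coefA (poles η) E E' l x t) * X ^ l

lemma Kills.add {x t : ℝ} {Ψ Θ : ℂ[X]} (h : Kills η E E' x t Ψ) (h' : Kills η E E' x t Θ) :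
    Kills η E E' x t (Ψ + Θ) := fun i => by
  simp only [Polynomial.eval_add]; linear_combination h i + h' i

lemma Kills.sub {x t : ℝ} {Ψ Θ : ℂ[X]} (h : Kills η E E' x t Ψ) (h' : Kills η E E' x t Θ) :
    Kills η E E' x t (Ψ - Θ) := fun i => by
  simp only [Polynomial.eval_sub]; linear_combination h i - h' i

lemma Kills.const_mul {x t : ℝ} {Ψ : ℂ[X]} (c : ℂ) (h : Kills η E E' x t Ψ) :
    Kills η E E' x t (C c * Ψ) := fun i => by
  simp only [Polynomial.eval_mul, Polynomial.eval_C]; linear_combination c * h i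

lemma Kills.cube_mul {x t : ℝ} {Ψ : ℂ[X]} (h : Kills η E E' x t Ψ) :
    Kills η E E' x t (X ^ 3 * Ψ) := fun i => by
  simp only [Polynomial.eval_mul, Polynomial.eval_X, Polynomial.eval_pow, pt_cube]
  linear_combination pt η i ^ 3 * h i

lemma eval_bigPhi (x t : ℝ) (κ : ℂ) :
    (bigPhi η E E' x t).eval κ = monicPoly (poles η) E E' κ x t := by
  simp [bigPhi, monicPoly, mul_comm N 2, Polynomial.eval_finsetSum]

lemma coeff_bigPhi_lt (x t : ℝ) {l : ℕ} (h : l < N * 2) :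
    (bigPhi η E E' x t).coeff l = coefA (poles η) E E' l x t := by
  simp [bigPhi, Polynomial.coeff_X_pow, h.ne, h]

lemma coeff_bigPhi_top (x t : ℝ) : (bigPhi η E E' x t).coeff (N * 2) = 1 := by
  simp [bigPhi]

lemma coeff_bigPhi_gt (x t : ℝ) {l : ℕ} (h : N * 2 < l) :
    (bigPhi η E E' x t).coeff l = 0 := by
  simp [bigPhi, Polynomial.coeff_X_pow, h.ne', h.le]

lemma eval_eq_sum_fin_rev {n : ℕ} {Ψ : ℂ[X]} (h : ∀ l, n ≤ l → Ψ.coeff l = 0) (κ : ℂ) :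
    Ψ.eval κ = ∑ c : Fin n, Ψ.coeff (c.rev : ℕ) * κ ^ (c.rev : ℕ) := by
  rcases Nat.eq_zero_or_pos n with rfl | hn
  · have : Ψ = 0 := by ext l; simpa using h l (Nat.zero_le _)
    simp [this]
  have hd : Ψ.natDegree < n := by
    by_contra hc
    have := h _ (not_lt.1 hc)
    rw [← Polynomial.leadingCoeff, Polynomial.leadingCoeff_eq_zero] at this
    rw [this, Polynomial.natDegree_zero] at hc
    exact hc hn
  rw [Polynomial.eval_eq_sum_range' hd, Finset.sum_range]
  exact (Equiv.sum_comp Fin.revPerm fun c : Fin n => Ψ.coeff (c : ℕ) * κ ^ (c : ℕ)).symm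

/-- Bridge between matrices and polynomials: `bigM` acts on the coefficient vector of Ψ by
evaluating the linear relations. -/
lemma bigM_mulVec {x t : ℝ} {Ψ : ℂ[X]} (h : ∀ l, N * 2 ≤ l → Ψ.coeff l = 0) (i : Fin (N * 2)) :
    (bigM (poles η) E E' x t).mulVec (fun c => Ψ.coeff (c.rev : ℕ)) i
      = Ψ.eval (pt η (rowIdx i)) + coupling η E E' (rowIdx i) x t
        * Ψ.eval (partner η (rowIdx i)) := by
  rw [eval_eq_sum_fin_rev h, eval_eq_sum_fin_rev h, Finset.mul_sum, ← Finset.sum_add_distrib]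
  unfold Matrix.mulVec dotProduct
  refine Finset.sum_congr rfl fun c _ => ?_
  have h1 := bigM_apply η E E' x t i c
  simp only [h1]; ring

/-- A polynomial of degree less than `2N` satisfying the linear relations vanishes. -/
lemma Kills.eq_zero {x t : ℝ} (hdet : (bigM (poles η) E E' x t).det ≠ 0) {Ψ : ℂ[X]}
    (hk : Kills η E E' x t Ψ) (h : ∀ l, N * 2 ≤ l → Ψ.coeff l = 0) : Ψ = 0 := by
  have h0 : (bigM (poles η) E E' x t).mulVec (fun c => Ψ.coeff (c.rev : ℕ)) = 0 := by
    funext i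
    rw [bigM_mulVec h, hk]; rfl
  have h1 := Matrix.eq_zero_of_mulVec_eq_zero hdet h0
  ext l
  rcases lt_or_ge l (N * 2) with hl | hl
  · have := congrFun h1 (Fin.rev ⟨l, hl⟩)
    rw [Fin.rev_rev] at this
    simpa using this
  · simpa using h l hl

lemma coefA_rev (x t : ℝ) (c : Fin (N * 2)) :
    coefA (poles η) E E' (c.rev : ℕ) x t = bigA (poles η) E E' x t c := by
  unfold coefA
  rw [dif_pos c.rev.isLt, Fin.eta, Fin.rev_rev]

lemma bigM_mulVec_bigA {x t : ℝ} (hdet : (bigM (poles η) E E' x t).det ≠ 0) :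
    (bigM (poles η) E E' x t).mulVec (bigA (poles η) E E' x t) = -bigB (poles η) E E' x t := by
  unfold bigA
  rw [Matrix.mulVec_neg, Matrix.mulVec_mulVec, Matrix.mul_nonsing_inv _ hdet.isUnit,
    Matrix.one_mulVec]

lemma kills_bigPhi {x t : ℝ} (hdet : (bigM (poles η) E E' x t).det ≠ 0) :
    Kills η E E' x t (bigPhi η E E' x t) := by
  intro p
  obtain ⟨i, rfl⟩ := rowIdx_bijective.2 p
  have h1 := congrFun (bigM_mulVec_bigA hdet) i
  have h2 := bigM_mulVec (η := η) (E := E) (E' := E') (x := x) (t := t)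
    (Ψ := bigPhi η E E' x t - X ^ (N * 2)) (fun l hl => by
      rcases hl.eq_or_lt with rfl | hl
      · simp [coeff_bigPhi_top]
      · simp [coeff_bigPhi_gt _ _ hl, Polynomial.coeff_X_pow, hl.ne']) i
  have h3 : (fun c : Fin (N * 2) => (bigPhi η E E' x t - X ^ (N * 2)).coeff (c.rev : ℕ))
      = bigA (poles η) E E' x t := by
    funext c
    rw [Polynomial.coeff_sub, coeff_bigPhi_lt _ _ c.rev.isLt, coefA_rev,
      Polynomial.coeff_X_pow, if_neg c.rev.isLt.ne, sub_zero]
  rw [h3, h1, Pi.neg_apply, bigB_apply] at h2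
  simp only [Polynomial.eval_sub, Polynomial.eval_pow, Polynomial.eval_X] at h2
  linear_combination -h2

/-- Uniqueness of the monic polynomial. -/
lemma bigPhi_unique {x t : ℝ} (hdet : (bigM (poles η) E E' x t).det ≠ 0) {Ψ : ℂ[X]}
    (hk : Kills η E E' x t Ψ) (h1 : Ψ.coeff (N * 2) = 1)
    (h : ∀ l, N * 2 < l → Ψ.coeff l = 0) : bigPhi η E E' x t = Ψ := by
  rw [← sub_eq_zero]
  refine ((kills_bigPhi hdet).sub hk).eq_zero hdet fun l hl => ?_
  rcases hl.eq_or_lt with rfl | hl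
  · simp [coeff_bigPhi_top, h1]
  · simp [coeff_bigPhi_gt _ _ hl, h l hl]

/-! ### Smoothness of the coefficients -/

lemma contDiff_wave {n : WithTop ℕ∞} (a : ℝ) :
    ContDiff ℝ n fun v : ℝ × ℝ => wave a v.1 v.2 := by
  unfold wave
  fun_prop

lemma contDiff_coupling {n : WithTop ℕ∞} (i : Fin N × Fin 2) :
    ContDiff ℝ n fun v : ℝ × ℝ => coupling η E E' i v.1 v.2 :=
  contDiff_const.mul (Complex.ofRealCLM.contDiff.comp (contDiff_wave _))

lemma contDiff_bigM {n : WithTop ℕ∞} (i c : Fin (N * 2)) :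
    ContDiff ℝ n fun v : ℝ × ℝ => bigM (poles η) E E' v.1 v.2 i c := by
  simp only [bigM_apply]
  exact contDiff_const.add ((contDiff_coupling _).mul contDiff_const)

lemma contDiff_bigB {n : WithTop ℕ∞} (i : Fin (N * 2)) :
    ContDiff ℝ n fun v : ℝ × ℝ => bigB (poles η) E E' v.1 v.2 i := by
  simp only [bigB_apply]
  exact contDiff_const.add ((contDiff_coupling _).mul contDiff_const)

lemma contDiff_det_bigM {n : WithTop ℕ∞} :
    ContDiff ℝ n fun v : ℝ × ℝ => (bigM (poles η) E E' v.1 v.2).det :=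
  contDiff_det contDiff_bigM

lemma bigA_apply (x t : ℝ) (c : Fin (N * 2)) : bigA (poles η) E E' x t c =
    -∑ i, ((bigM (poles η) E E' x t).det)⁻¹ * (bigM (poles η) E E' x t).adjugate c i
      * bigB (poles η) E E' x t i := by
  simp [bigA, Matrix.inv_def, Matrix.mulVec, dotProduct, Ring.inverse_eq_inv']

lemma contDiffAt_coefA {n : WithTop ℕ∞} (l : ℕ) {v : ℝ × ℝ}
    (hdet : (bigM (poles η) E E' v.1 v.2).det ≠ 0) :
    ContDiffAt ℝ n (fun v : ℝ × ℝ => coefA (poles η) E E' l v.1 v.2) v := by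
  unfold coefA
  split_ifs
  · simp only [bigA_apply]
    refine (ContDiffAt.sum fun i _ => ((contDiff_det_bigM.contDiffAt.inv hdet).mul
      (contDiff_adjugate contDiff_bigM _ _).contDiffAt).mul (contDiff_bigB _).contDiffAt).neg
  · exact contDiffAt_const

lemma contDiffAt_coeff_bigPhi {n : WithTop ℕ∞} (l : ℕ) {v : ℝ × ℝ}
    (hdet : (bigM (poles η) E E' v.1 v.2).det ≠ 0) :
    ContDiffAt ℝ n (fun v : ℝ × ℝ => (bigPhi η E E' v.1 v.2).coeff l) v := by
  rcases lt_trichotomy l (N * 2) with h | rfl | h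
  · simp only [coeff_bigPhi_lt _ _ h]; exact contDiffAt_coefA l hdet
  · simp only [coeff_bigPhi_top]; exact contDiffAt_const
  · simp only [coeff_bigPhi_gt _ _ h]; exact contDiffAt_const

lemma isOpen_det_ne_zero (t : ℝ) :
    IsOpen {x : ℝ | (bigM (poles η) E E' x t).det ≠ 0} := by
  have h : Continuous fun x : ℝ => (bigM (poles η) E E' x t).det :=
    Continuous.comp (g := fun v : ℝ × ℝ => (bigM (poles η) E E' v.1 v.2).det)
      (f := fun x : ℝ => (x, t)) (contDiff_det_bigM (n := 0)).continuous (by fun_prop)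
  exact isOpen_ne.preimage h

lemma isOpen_det_ne_zero_time (x : ℝ) :
    IsOpen {t : ℝ | (bigM (poles η) E E' x t).det ≠ 0} := by
  have h : Continuous fun t : ℝ => (bigM (poles η) E E' x t).det :=
    Continuous.comp (g := fun v : ℝ × ℝ => (bigM (poles η) E E' v.1 v.2).det)
      (f := fun t : ℝ => (x, t)) (contDiff_det_bigM (n := 0)).continuous (by fun_prop)
  exact isOpen_ne.preimage h

/-! ### Symmetry under complex conjugation -/

lemma conj_pt (i : Fin N × Fin 2) : starRingEnd ℂ (pt η i) = pt η (i.1, i.2.rev) := by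
  obtain ⟨j, b⟩ := i
  have h := conj_poles η j
  have h' : starRingEnd ℂ (-(Complex.I * z ^ 2 * (η j : ℂ))) = poles η j := by
    rw [← h, Complex.conj_conj]
  fin_cases b
  · simpa [pt, poles] using h
  · simpa [pt, poles] using h'

lemma conj_partner (i : Fin N × Fin 2) :
    starRingEnd ℂ (partner η i) = partner η (i.1, i.2.rev) := by
  rw [partner_eq, partner_eq, map_neg, conj_pt]

lemma InputData.conj_coupling (h : InputData η E E') (i : Fin N × Fin 2) (x t : ℝ) :
    starRingEnd ℂ (coupling η E E' i x t) = coupling η E E' (i.1, i.2.rev) x t := by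
  obtain ⟨j, b⟩ := i
  unfold coupling
  fin_cases b
  · simp [gamma_zero, h.gamma_one]
  · simp [gamma_zero, h.gamma_one]

/-- Conjugation permutes the poles, the partners and the couplings, so the conjugate polynomial
obeys the same relations and uniqueness applies. -/
lemma InputData.bigPhi_conj (h : InputData η E E') {x t : ℝ}
    (hdet : (bigM (poles η) E E' x t).det ≠ 0) :
    bigPhi η E E' x t = (bigPhi η E E' x t).map (starRingEnd ℂ) := by
  refine bigPhi_unique hdet (fun i => ?_) ?_ fun l hl => ?_
  · have h1 := congrArg (starRingEnd ℂ) (kills_bigPhi hdet (i.1, i.2.rev))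
    rw [map_add, map_mul, h.conj_coupling, ← Polynomial.eval_map_apply,
      ← Polynomial.eval_map_apply, conj_pt, conj_partner] at h1
    simpa using h1
  · simp [coeff_bigPhi_top]
  · simp [coeff_bigPhi_gt _ _ hl]

lemma InputData.conj_coefA (h : InputData η E E') (l : ℕ) (x t : ℝ) :
    starRingEnd ℂ (coefA (poles η) E E' l x t) = coefA (poles η) E E' l x t := by
  by_cases hl : l < N * 2
  · by_cases hdet : (bigM (poles η) E E' x t).det = 0
    -- Where `det M = 0` the inverse matrix is zero by convention, so the coefficients are real at
    -- every point and the derivatives may be conjugated without restriction.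
    · have : bigA (poles η) E E' x t = 0 := by
        funext c
        simp [bigA_apply, hdet]
      simp [coefA, this]
    · have h1 := congrArg (fun Ψ => Ψ.coeff l) (h.bigPhi_conj hdet)
      simp only [Polynomial.coeff_map, coeff_bigPhi_lt _ _ hl] at h1
      exact h1.symm
  · simp [coefA, hl]

lemma conj_deriv {f : ℝ → ℂ} (h : ∀ y, starRingEnd ℂ (f y) = f y) (x : ℝ) :
    starRingEnd ℂ (deriv f x) = deriv f x := by
  have h1 := deriv.star (f := f) (x := x)
  have h2 : (fun y => star (f y)) = f := funext h
  rw [h2] at h1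
  exact h1.symm

lemma InputData.potQ_im (h : InputData η E E') (x t : ℝ) : (potQ (poles η) E E' x t).im = 0 := by
  rw [← Complex.conj_eq_iff_im]
  unfold potQ
  rw [map_mul, conj_deriv fun y => h.conj_coefA _ y t, map_neg, Complex.conj_ofNat]

lemma InputData.potP_im (h : InputData η E E') (x t : ℝ) : (potP (poles η) E E' x t).im = 0 := by
  rw [← Complex.conj_eq_iff_im]
  unfold potP
  rw [iteratedDeriv_succ, iteratedDeriv_one, map_mul, map_sub, map_sub, map_mul,
    conj_deriv fun y => h.conj_coefA _ y t, conj_deriv fun y => h.conj_coefA _ y t,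
    conj_deriv fun y => conj_deriv (fun y => h.conj_coefA _ y t) y, h.conj_coefA,
    Complex.conj_ofNat]

end System

/-! ### The `x`-derivatives and the third order equation -/

section ThirdOrder

variable {N : ℕ} {η : Fin N → ℝ} {E E' : Fin N → ℂ}

lemma hasDerivAt_iteratedDeriv {f : ℝ → ℂ} {x : ℝ} (h : ∀ n : ℕ, ContDiffAt ℝ n f x) (m : ℕ) :
    HasDerivAt (iteratedDeriv m f) (iteratedDeriv (m + 1) f x) x := by
  rw [iteratedDeriv_succ]
  refine DifferentiableAt.hasDerivAt ?_
  have h1 := (h (m + 1)).differentiableAt_iteratedFDeriv (m := m) (by exact_mod_cast Nat.lt_succ_self m)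
  rw [iteratedDeriv_eq_equiv_comp]
  exact (LinearIsometryEquiv.differentiable _).differentiableAt.comp x h1

variable (η E E') in
/-- The `m`-th `x`-derivative of the coefficient of `κ^l`. -/
def jet (m l : ℕ) (x t : ℝ) : ℂ := iteratedDeriv m (fun y => (bigPhi η E E' y t).coeff l) x

variable (η E E') in
/-- The `m`-th `x`-derivative of the monic polynomial. -/
def phiJet (m : ℕ) (x t : ℝ) : ℂ[X] :=
  ∑ l ∈ Finset.range (N * 2 + 1), C (jet η E E' m l x t) * X ^ l

lemma jet_gt {m l : ℕ} (hl : N * 2 < l) (x t : ℝ) : jet η E E' m l x t = 0 := by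
  unfold jet
  simp only [coeff_bigPhi_gt _ _ hl]
  rw [iteratedDeriv_const]
  split_ifs <;> rfl

lemma jet_top (m : ℕ) (x t : ℝ) : jet η E E' (m + 1) (N * 2) x t = 0 := by
  unfold jet
  simp only [coeff_bigPhi_top]
  rw [iteratedDeriv_const, if_neg (Nat.succ_ne_zero m)]

lemma jet_zero_top (x t : ℝ) : jet η E E' 0 (N * 2) x t = 1 := by
  simp [jet, coeff_bigPhi_top]

lemma coeff_phiJet (m l : ℕ) (x t : ℝ) :
    (phiJet η E E' m x t).coeff l = jet η E E' m l x t := by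
  rcases lt_or_ge (N * 2) l with hl | hl
  · rw [jet_gt hl]
    simp [phiJet]
    omega
  · simp [phiJet]
    omega

lemma phiJet_zero (x t : ℝ) : phiJet η E E' 0 x t = bigPhi η E E' x t := by
  ext l
  rw [coeff_phiJet]; simp [jet]

lemma contDiffAt_coeff_slice {n : WithTop ℕ∞} {x t : ℝ}
    (hdet : (bigM (poles η) E E' x t).det ≠ 0) (l : ℕ) :
    ContDiffAt ℝ n (fun y => (bigPhi η E E' y t).coeff l) x :=
  ContDiffAt.comp (g := fun v : ℝ × ℝ => (bigPhi η E E' v.1 v.2).coeff l)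
    (f := fun y : ℝ => (y, t)) x (contDiffAt_coeff_bigPhi l hdet)
    (contDiff_id.prodMk contDiff_const).contDiffAt

lemma hasDerivAt_jet {x t : ℝ} (hdet : (bigM (poles η) E E' x t).det ≠ 0) (m l : ℕ) :
    HasDerivAt (fun y => jet η E E' m l y t) (jet η E E' (m + 1) l x t) x :=
  hasDerivAt_iteratedDeriv (fun _ => contDiffAt_coeff_slice hdet l) m

lemma eval_phiJet (m : ℕ) (x t : ℝ) (κ : ℂ) : (phiJet η E E' m x t).eval κ
    = ∑ l ∈ Finset.range (N * 2 + 1), jet η E E' m l x t * κ ^ l := by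
  simp [phiJet, Polynomial.eval_finsetSum]

lemma hasDerivAt_eval_phiJet {x t : ℝ} (hdet : (bigM (poles η) E E' x t).det ≠ 0) (m : ℕ)
    (κ : ℂ) : HasDerivAt (fun y => (phiJet η E E' m y t).eval κ)
      ((phiJet η E E' (m + 1) x t).eval κ) x := by
  simp only [eval_phiJet]
  exact HasDerivAt.fun_sum fun l _ => (hasDerivAt_jet hdet m l).mul_const _

lemma eventually_det_ne_zero {x t : ℝ} (hdet : (bigM (poles η) E E' x t).det ≠ 0) :
    ∀ᶠ y in 𝓝 x, (bigM (poles η) E E' y t).det ≠ 0 :=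
  (isOpen_det_ne_zero t).mem_nhds hdet

lemma eventually_det_ne_zero_time {x t : ℝ} (hdet : (bigM (poles η) E E' x t).det ≠ 0) :
    ∀ᶠ s in 𝓝 t, (bigM (poles η) E E' x s).det ≠ 0 :=
  (isOpen_det_ne_zero_time x).mem_nhds hdet

lemma hasDerivAt_wave (a x t : ℝ) :
    HasDerivAt (fun y => wave a y t) (Real.sqrt 3 * a * wave a x t) x := by
  have h : HasDerivAt (fun y : ℝ => Real.sqrt 3 * a * (y - 9 * a ^ 4 * t))
      (Real.sqrt 3 * a * 1) x := ((hasDerivAt_id x).sub_const _).const_mul _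
  unfold wave
  convert h.exp using 1
  ring

lemma hasDerivAt_wave_time (a x t : ℝ) :
    HasDerivAt (fun s => wave a x s) (-(9 * Real.sqrt 3 * a ^ 5) * wave a x t) t := by
  have h : HasDerivAt (fun s : ℝ => Real.sqrt 3 * a * (x - 9 * a ^ 4 * s))
      (Real.sqrt 3 * a * -(9 * a ^ 4 * 1)) t :=
    (((hasDerivAt_id t).const_mul _).const_sub _).const_mul _
  unfold wave
  convert h.exp using 1
  ring

lemma partner_sub_pt (i : Fin N × Fin 2) :
    partner η i - pt η i = (Real.sqrt 3 : ℝ) * η i.1 := by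
  rw [← I_mul_z_sq_sub]
  unfold partner pt
  split_ifs <;> ring

lemma partner_sub_pt_five (i : Fin N × Fin 2) :
    partner η i ^ 5 - pt η i ^ 5 = -((Real.sqrt 3 : ℝ) * (η i.1 : ℂ) ^ 5) := by
  rw [← I_mul_z_sq_sub]
  have h4 : Complex.I ^ 4 = 1 := Complex.I_pow_four
  have h5 : Complex.I ^ 5 = Complex.I := by rw [pow_succ, h4, one_mul]
  have h6 : z ^ 5 = z ^ 2 := by linear_combination z ^ 2 * z_cube
  have h7 : z ^ 10 = z := by linear_combination (z ^ 7 + z ^ 4 + z) * z_cube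
  unfold partner pt
  split_ifs
  · simp only [mul_pow, ← pow_mul, h5]
    norm_num
    rw [h6, h7]; ring
  · simp only [neg_pow (Complex.I * _ * _), mul_pow, ← pow_mul, h5]
    norm_num
    rw [h6, h7]; ring

lemma hasDerivAt_coupling (i : Fin N × Fin 2) (x t : ℝ) :
    HasDerivAt (fun y => coupling η E E' i y t)
      ((partner η i - pt η i) * coupling η E E' i x t) x := by
  have h := ((hasDerivAt_wave (η i.1) x t).ofReal_comp).const_mul (gamma η E E' i)
  unfold coupling
  refine h.congr_deriv ?_
  rw [partner_sub_pt]; push_cast; ring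

lemma hasDerivAt_coupling_time (i : Fin N × Fin 2) (x t : ℝ) :
    HasDerivAt (fun s => coupling η E E' i x s)
      (9 * (partner η i ^ 5 - pt η i ^ 5) * coupling η E E' i x t) t := by
  have h := ((hasDerivAt_wave_time (η i.1) x t).ofReal_comp).const_mul (gamma η E E' i)
  unfold coupling
  refine h.congr_deriv ?_
  rw [partner_sub_pt_five]; push_cast; ring

/-- The linear relations are preserved by `∂_x + κ`. -/
lemma Kills.hasDerivAt {x t : ℝ} {Ψ : ℝ → ℂ[X]} {Ψ' : ℂ[X]}
    (h : ∀ κ, HasDerivAt (fun y => (Ψ y).eval κ) (Ψ'.eval κ) x)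
    (hk : ∀ᶠ y in 𝓝 x, Kills η E E' y t (Ψ y)) : Kills η E E' x t (Ψ' + X * Ψ x) := by
  intro i
  have h1 := (h (pt η i)).add ((hasDerivAt_coupling (η := η) (E := E) (E' := E') i x t).mul
    (h (partner η i)))
  have h2 : (fun y => (Ψ y).eval (pt η i)) + (fun y => coupling η E E' i y t) *
      (fun y => (Ψ y).eval (partner η i)) =ᶠ[𝓝 x] fun _ => 0 := by
    filter_upwards [hk] with y hy using hy i
  have h3 := h1.unique ((hasDerivAt_const x (0 : ℂ)).congr_of_eventuallyEq h2)
  have h4 := hk.self_of_nhds i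
  simp only [Polynomial.eval_add, Polynomial.eval_mul, Polynomial.eval_X]
  linear_combination h3 + pt η i * h4

/-- The linear relations are preserved by `∂_t + 9 κ⁵`. -/
lemma Kills.hasDerivAt_time {x t : ℝ} {Ψ : ℝ → ℂ[X]} {Ψ' : ℂ[X]}
    (h : ∀ κ, HasDerivAt (fun s => (Ψ s).eval κ) (Ψ'.eval κ) t)
    (hk : ∀ᶠ s in 𝓝 t, Kills η E E' x s (Ψ s)) :
    Kills η E E' x t (Ψ' + C 9 * X ^ 5 * Ψ t) := by
  intro i
  have h1 := (h (pt η i)).add ((hasDerivAt_coupling_time (η := η) (E := E) (E' := E') i x t).mul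
    (h (partner η i)))
  have h2 : (fun s => (Ψ s).eval (pt η i)) + (fun s => coupling η E E' i x s) *
      (fun s => (Ψ s).eval (partner η i)) =ᶠ[𝓝 t] fun _ => 0 := by
    filter_upwards [hk] with y hy using hy i
  have h3 := h1.unique ((hasDerivAt_const t (0 : ℂ)).congr_of_eventuallyEq h2)
  have h4 := hk.self_of_nhds i
  simp only [Polynomial.eval_add, Polynomial.eval_mul, Polynomial.eval_X, Polynomial.eval_C,
    Polynomial.eval_pow]
  linear_combination h3 + 9 * pt η i ^ 5 * h4

variable (η E E') in
/-- `(∂_x + κ)` applied to the monic polynomial. -/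
def covOne (x t : ℝ) : ℂ[X] := phiJet η E E' 1 x t + X * phiJet η E E' 0 x t

variable (η E E') in
/-- `(∂_x + κ)²` applied to the monic polynomial. -/
def covTwo (x t : ℝ) : ℂ[X] :=
  phiJet η E E' 2 x t + X * phiJet η E E' 1 x t + X * covOne η E E' x t

variable (η E E') in
/-- `(∂_x + κ)³` applied to the monic polynomial. -/
def covThree (x t : ℝ) : ℂ[X] :=
  phiJet η E E' 3 x t + X * phiJet η E E' 2 x t
    + X * (phiJet η E E' 2 x t + X * phiJet η E E' 1 x t) + X * covTwo η E E' x t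

lemma hasDerivAt_eval_covOne {x t : ℝ} (hdet : (bigM (poles η) E E' x t).det ≠ 0) (κ : ℂ) :
    HasDerivAt (fun y => (covOne η E E' y t).eval κ)
      ((phiJet η E E' 2 x t + X * phiJet η E E' 1 x t).eval κ) x := by
  simp only [covOne, Polynomial.eval_add, Polynomial.eval_mul, Polynomial.eval_X]
  exact (hasDerivAt_eval_phiJet hdet 1 κ).add ((hasDerivAt_eval_phiJet hdet 0 κ).const_mul κ)

lemma hasDerivAt_eval_covTwo {x t : ℝ} (hdet : (bigM (poles η) E E' x t).det ≠ 0) (κ : ℂ) :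
    HasDerivAt (fun y => (covTwo η E E' y t).eval κ)
      ((phiJet η E E' 3 x t + X * phiJet η E E' 2 x t
        + X * (phiJet η E E' 2 x t + X * phiJet η E E' 1 x t)).eval κ) x := by
  have h := hasDerivAt_eval_covOne hdet κ
  simp only [covTwo, Polynomial.eval_add, Polynomial.eval_mul, Polynomial.eval_X] at h ⊢
  exact ((hasDerivAt_eval_phiJet hdet 2 κ).add
    ((hasDerivAt_eval_phiJet hdet 1 κ).const_mul κ)).add (h.const_mul κ)

lemma kills_phiJet_zero {x t : ℝ} (hdet : (bigM (poles η) E E' x t).det ≠ 0) :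
    Kills η E E' x t (phiJet η E E' 0 x t) := by
  rw [phiJet_zero]; exact kills_bigPhi hdet

lemma kills_covOne {x t : ℝ} (hdet : (bigM (poles η) E E' x t).det ≠ 0) :
    Kills η E E' x t (covOne η E E' x t) :=
  Kills.hasDerivAt (Ψ := fun y => phiJet η E E' 0 y t) (hasDerivAt_eval_phiJet hdet 0)
    ((eventually_det_ne_zero hdet).mono fun _ h => kills_phiJet_zero h)

lemma kills_covTwo {x t : ℝ} (hdet : (bigM (poles η) E E' x t).det ≠ 0) :
    Kills η E E' x t (covTwo η E E' x t) :=
  Kills.hasDerivAt (Ψ := fun y => covOne η E E' y t) (hasDerivAt_eval_covOne hdet)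
    ((eventually_det_ne_zero hdet).mono fun _ h => kills_covOne h)

lemma kills_covThree {x t : ℝ} (hdet : (bigM (poles η) E E' x t).det ≠ 0) :
    Kills η E E' x t (covThree η E E' x t) :=
  Kills.hasDerivAt (Ψ := fun y => covTwo η E E' y t) (hasDerivAt_eval_covTwo hdet)
    ((eventually_det_ne_zero hdet).mono fun _ h => kills_covTwo h)

lemma jet_eq_of_lt {l : ℕ} (hl : l < N * 2) (m : ℕ) (x t : ℝ) : jet η E E' m l x t
    = iteratedDeriv m (fun y => coefA (poles η) E E' l y t) x := by
  unfold jet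
  simp only [coeff_bigPhi_lt _ _ hl]

lemma potQ_eq (hN : 1 ≤ N) (x t : ℝ) :
    potQ (poles η) E E' x t = -3 * jet η E E' 1 (N * 2 - 1) x t := by
  rw [jet_eq_of_lt (by omega), iteratedDeriv_one, mul_comm N 2]; rfl

lemma potP_eq (hN : 1 ≤ N) (x t : ℝ) : potP (poles η) E E' x t
    = 3 * (jet η E E' 0 (N * 2 - 1) x t * jet η E E' 1 (N * 2 - 1) x t
      - jet η E E' 2 (N * 2 - 1) x t - jet η E E' 1 (N * 2 - 2) x t) := by
  rw [mul_comm N 2]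
  simp only [jet_eq_of_lt (show 2 * N - 1 < N * 2 by omega),
    jet_eq_of_lt (show 2 * N - 2 < N * 2 by omega), iteratedDeriv_one, iteratedDeriv_zero]
  rfl

/-- This is ((∂_x + κ)³ + Q(∂_x + κ) + P - κ³)Φ. It obeys the linear relations, and the definitions
of `potQ` and `potP` cancel its coefficients in degrees 2N + 1 and 2N, so `Kills.eq_zero` applies.
-/
lemma third_order (hN : 1 ≤ N) {x t : ℝ} (hdet : (bigM (poles η) E E' x t).det ≠ 0) :
    C 3 * X ^ 2 * phiJet η E E' 1 x t + C 3 * X * phiJet η E E' 2 x t + phiJet η E E' 3 x t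
      + C (potQ (poles η) E E' x t) * (phiJet η E E' 1 x t + X * phiJet η E E' 0 x t)
      + C (potP (poles η) E E' x t) * phiJet η E E' 0 x t = 0 := by
  have hk : Kills η E E' x t (covThree η E E' x t
      + C (potQ (poles η) E E' x t) * covOne η E E' x t
      + C (potP (poles η) E E' x t) * phiJet η E E' 0 x t - X ^ 3 * phiJet η E E' 0 x t) :=
    (((kills_covThree hdet).add ((kills_covOne hdet).const_mul _)).add
      ((kills_phiJet_zero hdet).const_mul _)).sub (kills_phiJet_zero hdet).cube_mul
  have he : covThree η E E' x t + C (potQ (poles η) E E' x t) * covOne η E E' x t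
      + C (potP (poles η) E E' x t) * phiJet η E E' 0 x t - X ^ 3 * phiJet η E E' 0 x t
      = C 3 * X ^ 2 * phiJet η E E' 1 x t + C 3 * X * phiJet η E E' 2 x t + phiJet η E E' 3 x t
      + C (potQ (poles η) E E' x t) * (phiJet η E E' 1 x t + X * phiJet η E E' 0 x t)
      + C (potP (poles η) E E' x t) * phiJet η E E' 0 x t := by
    rw [show (C 3 : ℂ[X]) = 3 from map_ofNat C 3]
    unfold covThree covTwo covOne
    ring
  rw [he] at hk
  refine hk.eq_zero hdet fun l hl => ?_
  obtain ⟨n, rfl⟩ : ∃ n, N = n + 1 := ⟨N - 1, by omega⟩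
  obtain ⟨d, rfl⟩ : ∃ d, l = d + (n * 2 + 2) := ⟨l - (n * 2 + 2), by omega⟩
  have e : (n + 1) * 2 = n * 2 + 2 := by ring
  simp only [Polynomial.coeff_add, mul_assoc, Polynomial.coeff_C_mul, mul_add,
    show d + (n * 2 + 2) = (d + (n * 2 + 1)) + 1 from rfl, Polynomial.coeff_X_mul,
    show d + (n * 2 + 1) + 1 = (d + n * 2) + 2 from rfl, Polynomial.coeff_X_pow_mul]
  simp only [coeff_phiJet, potQ_eq hN, potP_eq hN]
  rcases Nat.lt_or_ge 2 d with hd | hd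
  · simp [jet_gt (show (n + 1) * 2 < d + n * 2 by omega),
      jet_gt (show (n + 1) * 2 < d + n * 2 + 1 by omega),
      jet_gt (show (n + 1) * 2 < d + n * 2 + 2 by omega)]
  · have t0 := jet_zero_top (η := η) (E := E) (E' := E') x t
    have t1 := fun m => jet_top (η := η) (E := E) (E' := E') m x t
    have g := fun m => jet_gt (η := η) (E := E) (E' := E') (m := m)
      (show (n + 1) * 2 < n * 2 + 3 by omega) x t
    rw [e] at t0 t1
    have e1 : (n + 1) * 2 - 1 = n * 2 + 1 := by omega
    have e2 : (n + 1) * 2 - 2 = n * 2 := by omega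
    rw [e1, e2]
    -- Here `d` is the excess of the degree over 2N: `d = 0` is the definition of P, `d = 1` that of
    -- Q, and `d = 2` holds because the leading coefficient is constant.
    interval_cases d
    · simp only [Nat.zero_add, t0, t1 0, t1 2]
      ring
    · simp only [show 1 + n * 2 = n * 2 + 1 by ring, t0, t1 1, g]
      ring
    · have g' := fun m => jet_gt (η := η) (E := E) (E' := E') (m := m)
        (show (n + 1) * 2 < n * 2 + 4 by omega) x t
      simp only [show 2 + n * 2 = n * 2 + 2 by ring, t1 0, g, g']
      ring

/-! ### The Jost solutions -/

lemma eval_third_order (hN : 1 ≤ N) {x t : ℝ} (hdet : (bigM (poles η) E E' x t).det ≠ 0)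
    (κ : ℂ) : (covThree η E E' x t).eval κ
      + potQ (poles η) E E' x t * (covOne η E E' x t).eval κ
      + potP (poles η) E E' x t * (phiJet η E E' 0 x t).eval κ
      = κ ^ 3 * (phiJet η E E' 0 x t).eval κ := by
  have h := congrArg (fun Ψ => Ψ.eval κ) (third_order hN hdet)
  simp only [Polynomial.eval_add, Polynomial.eval_mul, Polynomial.eval_X, Polynomial.eval_C,
    Polynomial.eval_pow, Polynomial.eval_zero] at h
  simp only [covThree, covTwo, covOne, Polynomial.eval_add, Polynomial.eval_mul,
    Polynomial.eval_X]
  linear_combination h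

lemma hasDerivAt_exp_mul_eval {x : ℝ} {Ψ : ℝ → ℂ[X]} {Ψ' : ℂ[X]} {κ : ℂ}
    (h : HasDerivAt (fun y => (Ψ y).eval κ) (Ψ'.eval κ) x) :
    HasDerivAt (fun y : ℝ => Complex.exp (κ * y) * (Ψ y).eval κ)
      (Complex.exp (κ * x) * (Ψ' + X * Ψ x).eval κ) x := by
  have h1 : HasDerivAt (fun y : ℝ => Complex.exp (κ * y)) (Complex.exp (κ * x) * (κ * 1)) x :=
    ((Complex.ofRealCLM.hasDerivAt (x := x)).const_mul κ).cexp
  refine (h1.mul h).congr_deriv ?_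
  simp only [Polynomial.eval_add, Polynomial.eval_mul, Polynomial.eval_X]
  ring

/-- The factor e^{κx} turns ∂_x + κ into ∂_x. The constant `G` stands for either normalisation, so f
and g are treated at once. -/
lemma solvesThirdOrder_exp (hN : 1 ≤ N) {x t : ℝ} (hdet : (bigM (poles η) E E' x t).det ≠ 0)
    (κ G : ℂ) : SolvesThirdOrder (fun y => potQ (poles η) E E' y t)
      (fun y => potP (poles η) E E' y t) κ
      (fun y => Complex.exp (κ * y) * monicPoly (poles η) E E' κ y t / G) x := by
  have h0 : (fun y : ℝ => Complex.exp (κ * y) * monicPoly (poles η) E E' κ y t / G)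
      = fun y : ℝ => Complex.exp (κ * y) * (phiJet η E E' 0 y t).eval κ / G := by
    funext y
    rw [phiJet_zero, eval_bigPhi]
  rw [h0]
  have hev := eventually_det_ne_zero hdet
  have d1 : deriv (fun y : ℝ => Complex.exp (κ * y) * (phiJet η E E' 0 y t).eval κ / G)
      =ᶠ[𝓝 x] fun y => Complex.exp (κ * y) * (covOne η E E' y t).eval κ / G := by
    filter_upwards [hev] with y hy
    exact ((hasDerivAt_exp_mul_eval (hasDerivAt_eval_phiJet hy 0 κ)).div_const G).deriv
  have d2 : deriv (deriv fun y : ℝ => Complex.exp (κ * y) * (phiJet η E E' 0 y t).eval κ / G)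
      =ᶠ[𝓝 x] fun y => Complex.exp (κ * y) * (covTwo η E E' y t).eval κ / G := by
    filter_upwards [hev, d1.deriv] with y hy hd
    rw [hd]
    exact ((hasDerivAt_exp_mul_eval (hasDerivAt_eval_covOne hy κ)).div_const G).deriv
  have d3 : deriv (deriv (deriv fun y : ℝ =>
      Complex.exp (κ * y) * (phiJet η E E' 0 y t).eval κ / G)) x
      = Complex.exp (κ * x) * (covThree η E E' x t).eval κ / G := by
    rw [d2.deriv_eq]
    exact ((hasDerivAt_exp_mul_eval (hasDerivAt_eval_covTwo hdet κ)).div_const G).deriv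
  refine ⟨?_, ?_⟩
  · have : ContDiffAt ℝ 3 (fun y => (phiJet η E E' 0 y t).eval κ) x := by
      simp only [eval_phiJet]
      refine ContDiffAt.sum fun l _ => ContDiffAt.mul ?_ contDiffAt_const
      simpa [jet] using contDiffAt_coeff_slice hdet l
    refine (ContDiffAt.mul ?_ this).div_const _
    exact (((contDiff_const.mul Complex.ofRealCLM.contDiff).cexp)).contDiffAt
  · rw [iteratedDeriv_succ, iteratedDeriv_succ, iteratedDeriv_one, d3, d1.self_of_nhds]
    linear_combination Complex.exp (κ * x) / G * eval_third_order hN hdet κ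

lemma kills_zero {x t : ℝ} {Ψ : ℂ[X]} (h : Kills η E E' x t Ψ) (j : Fin N) :
    Ψ.eval (Complex.I * z * η j) + gam (poles η) E j * ((wave (η j) x t : ℝ) : ℂ)
      * Ψ.eval (Complex.I * z ^ 2 * η j) = 0 := by
  have := h (j, 0)
  rwa [pt_zero, partner_zero, coupling, gamma_zero] at this

lemma kills_one {x t : ℝ} {Ψ : ℂ[X]} (h : Kills η E E' x t Ψ) (j : Fin N) :
    Ψ.eval (-(Complex.I * z ^ 2 * η j)) + gamConj (poles η) E' j * ((wave (η j) x t : ℝ) : ℂ)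
      * Ψ.eval (-(Complex.I * z * η j)) = 0 := by
  have := h (j, 1)
  rwa [pt_one, partner_one, coupling, show gamma η E E' (j, 1) = gamConj (poles η) E' j by
    simp [gamma]] at this

lemma transfer_identity {e₁ e₂ e₃ G₁ G₂ c χ m : ℂ} (hG : G₁ ≠ 0) (h : e₁ * χ = e₂ * e₃) :
    e₁ * (G₁ * c / G₂ * χ * m) / G₁ = c * e₂ * (e₃ * m / G₂) := by
  field_simp
  linear_combination c * m / G₂ * h

lemma jost_relation (hp : ∀ j, 0 < η j) {x t : ℝ}
    (hdet : (bigM (poles η) E E' x t).det ≠ 0) (j : Fin N) :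
    jostF (poles η) E E' (poles η j) x t
      = E j * Complex.exp (9 * (z ^ 2 - 1) * poles η j ^ 5 * t)
        * jostG (poles η) E E' (z * poles η j) x t := by
  have h := kills_zero (kills_bigPhi hdet) j
  rw [eval_bigPhi, eval_bigPhi, ← chi_eq] at h
  have e1 : Complex.I * z * η j = poles η j := rfl
  have e2 : Complex.I * z ^ 2 * η j = z * poles η j := by unfold poles; ring
  rw [e1, e2] at h
  have g1 := bigGamma_pt_ne hp (j, 0)
  have g2 := bigGamma_pt_ne hp (j, 1)
  rw [pt_zero, e1] at g1
  rw [pt_one, e2] at g2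
  unfold jostF jostG
  have h' : monicPoly (poles η) E E' (poles η j) x t = bigGamma (poles η) (poles η j) * E j
      / bigGamma (poles η) (-(z * poles η j)) * chi (poles η) j x t
      * monicPoly (poles η) E E' (z * poles η j) x t := by
    rw [gam] at h; linear_combination h
  have hx : Complex.exp (poles η j * x) * chi (poles η) j x t
      = Complex.exp (9 * (z ^ 2 - 1) * poles η j ^ 5 * t) * Complex.exp (z * poles η j * x) := by
    unfold chi
    rw [← Complex.exp_add, ← Complex.exp_add]
    congr 1; ring
  rw [h']
  exact transfer_identity g1 hx

lemma jost_relation_conj (hp : ∀ j, 0 < η j) {x t : ℝ}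
    (hdet : (bigM (poles η) E E' x t).det ≠ 0) (j : Fin N) :
    jostF (poles η) E E' (starRingEnd ℂ (poles η j)) x t
      = E' j * Complex.exp (9 * (z - 1) * starRingEnd ℂ (poles η j) ^ 5 * t)
        * jostG (poles η) E E' (z ^ 2 * starRingEnd ℂ (poles η j)) x t := by
  have h := kills_one (kills_bigPhi hdet) j
  rw [eval_bigPhi, eval_bigPhi, ← chiConj_eq] at h
  have e2 : -(Complex.I * z * η j) = z ^ 2 * starRingEnd ℂ (poles η j) := by
    rw [conj_poles]; linear_combination (Complex.I * z * η j) * z_cube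
  rw [← conj_poles, e2] at h
  have g1 := bigGamma_pt_ne hp (j, 1)
  have g2 := bigGamma_pt_ne hp (j, 0)
  rw [pt_one, ← conj_poles] at g1
  rw [pt_zero, ← neg_neg (Complex.I * z * (η j : ℂ)), e2] at g2
  unfold jostF jostG
  have h' : monicPoly (poles η) E E' (starRingEnd ℂ (poles η j)) x t
      = bigGamma (poles η) (starRingEnd ℂ (poles η j)) * E' j
      / bigGamma (poles η) (-(z ^ 2 * starRingEnd ℂ (poles η j))) * chiConj (poles η) j x t
      * monicPoly (poles η) E E' (z ^ 2 * starRingEnd ℂ (poles η j)) x t := by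
    rw [gamConj] at h; linear_combination h
  have hx : Complex.exp (starRingEnd ℂ (poles η j) * x) * chiConj (poles η) j x t
      = Complex.exp (9 * (z - 1) * starRingEnd ℂ (poles η j) ^ 5 * t)
        * Complex.exp (z ^ 2 * starRingEnd ℂ (poles η j) * x) := by
    unfold chiConj
    rw [← Complex.exp_add, ← Complex.exp_add]
    congr 1; ring
  rw [h']
  exact transfer_identity g1 hx

end ThirdOrder

/-! ### Limits at infinity -/

section Limits

/-- The Vandermonde matrix with decreasing powers. -/
def revVandermonde {n : ℕ} (v : Fin n → ℂ) : Matrix (Fin n) (Fin n) ℂ :=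
  fun i c => v i ^ (c.rev : ℕ)

lemma det_revVandermonde_ne_zero {n : ℕ} {v : Fin n → ℂ} (hv : Function.Injective v) :
    (revVandermonde v).det ≠ 0 := by
  have h : revVandermonde v = (Matrix.vandermonde v).submatrix id (Fin.revPerm : Equiv.Perm (Fin n)) := by
    ext i c
    simp [revVandermonde, Matrix.vandermonde_apply]
  rw [h, Matrix.det_permute']
  refine mul_ne_zero ?_ (Matrix.det_vandermonde_ne_zero_iff.2 hv)
  exact_mod_cast (Equiv.Perm.sign (Fin.revPerm : Equiv.Perm (Fin n))).ne_zero

lemma coeff_prod_X_sub_C_gt {n : ℕ} (v : Fin n → ℂ) {l : ℕ} (h : n < l) :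
    (∏ i, (X - C (v i))).coeff l = 0 := by
  refine Polynomial.coeff_eq_zero_of_natDegree_lt ?_
  rw [Polynomial.natDegree_prod_of_monic _ _ fun i _ => Polynomial.monic_X_sub_C _]
  simpa using h

lemma coeff_prod_X_sub_C_top {n : ℕ} (v : Fin n → ℂ) : (∏ i, (X - C (v i))).coeff n = 1 := by
  have h := Polynomial.monic_prod_of_monic Finset.univ (fun i => X - C (v i))
    fun i _ => Polynomial.monic_X_sub_C _
  have hd : (∏ i, (X - C (v i))).natDegree = n := by
    rw [Polynomial.natDegree_prod_of_monic _ _ fun i _ => Polynomial.monic_X_sub_C _]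
    simp
  have h1 := h.coeff_natDegree
  rwa [hd] at h1

/-- The coefficients of ∏(X - v_i) solve the limiting Vandermonde system, because that polynomial
vanishes at every node. -/
lemma revVandermonde_mulVec {n : ℕ} (v : Fin n → ℂ) :
    (revVandermonde v).mulVec (fun c => (∏ i, (X - C (v i))).coeff (c.rev : ℕ))
      = -fun i => v i ^ n := by
  funext i
  have h := eval_eq_sum_fin_rev (n := n) (Ψ := (∏ i, (X - C (v i))) - X ^ n)
    (fun l hl => by
      rcases hl.eq_or_lt with rfl | hl
      · simp [coeff_prod_X_sub_C_top]
      · simp [coeff_prod_X_sub_C_gt v hl, Polynomial.coeff_X_pow, hl.ne']) (v i)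
  have h0 : (∏ i, (X - C (v i))).eval (v i) = 0 := by
    rw [Polynomial.eval_prod]
    exact Finset.prod_eq_zero (Finset.mem_univ i) (by simp)
  rw [Polynomial.eval_sub, h0, Polynomial.eval_pow, Polynomial.eval_X, zero_sub] at h
  rw [Pi.neg_apply, h]
  unfold Matrix.mulVec dotProduct
  refine Finset.sum_congr rfl fun c _ => ?_
  rw [Polynomial.coeff_sub, Polynomial.coeff_X_pow, if_neg c.rev.isLt.ne, sub_zero, mul_comm]
  rfl

lemma tendsto_inv_apply {m : Type*} [Fintype m] [DecidableEq m] {l : Filter ℝ}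
    {A : ℝ → Matrix m m ℂ} {A₀ : Matrix m m ℂ} (hA : Tendsto A l (𝓝 A₀)) (h0 : A₀.det ≠ 0) :
    Tendsto (fun x => (A x)⁻¹) l (𝓝 A₀⁻¹) := by
  simp only [Matrix.inv_def, Ring.inverse_eq_inv']
  have h1 : Tendsto (fun x => (A x).det) l (𝓝 A₀.det) :=
    ((continuous_id.matrix_det).tendsto A₀).comp hA
  have h2 : Tendsto (fun x => (A x).adjugate) l (𝓝 A₀.adjugate) :=
    ((continuous_id.matrix_adjugate).tendsto A₀).comp hA
  exact (h1.inv₀ h0).smul h2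

/-- Serves both ends of the line: the nodes `v` are the poles at -∞ and the partners at +∞. -/
lemma tendsto_neg_inv_mulVec {n : ℕ} {l : Filter ℝ} {A : ℝ → Matrix (Fin n) (Fin n) ℂ}
    {b : ℝ → Fin n → ℂ} {v : Fin n → ℂ} (hv : Function.Injective v)
    (hA : ∀ i c, Tendsto (fun x => A x i c) l (𝓝 (v i ^ (c.rev : ℕ))))
    (hb : ∀ i, Tendsto (fun x => b x i) l (𝓝 (v i ^ n))) :
    Tendsto (fun x => -((A x)⁻¹.mulVec (b x))) l
      (𝓝 fun c => (∏ i, (X - C (v i))).coeff (c.rev : ℕ)) := by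
  have hA' : Tendsto A l (𝓝 (revVandermonde v)) :=
    tendsto_pi_nhds.2 fun i => tendsto_pi_nhds.2 fun c => hA i c
  have hb' : Tendsto b l (𝓝 fun i => v i ^ n) := tendsto_pi_nhds.2 hb
  have hd := det_revVandermonde_ne_zero hv
  have h1 := tendsto_inv_apply hA' hd
  have h2 : (fun c : Fin n => (∏ i, (X - C (v i))).coeff (c.rev : ℕ))
      = -((revVandermonde v)⁻¹.mulVec fun i => v i ^ n) := by
    rw [← Matrix.mulVec_neg, ← revVandermonde_mulVec, Matrix.mulVec_mulVec,
      Matrix.nonsing_inv_mul _ hd.isUnit, Matrix.one_mulVec]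
  rw [h2]
  have h3 : Continuous fun p : Matrix (Fin n) (Fin n) ℂ × (Fin n → ℂ) => p.1.mulVec p.2 :=
    continuous_fst.matrix_mulVec continuous_snd
  exact ((h3.tendsto ((revVandermonde v)⁻¹, fun i => v i ^ n)).comp (h1.prodMk_nhds hb')).neg

variable {N : ℕ} {η : Fin N → ℝ} {E E' : Fin N → ℂ}

lemma tendsto_wave_atBot {a : ℝ} (ha : 0 < a) (t : ℝ) :
    Tendsto (fun x => wave a x t) atBot (𝓝 0) := by
  unfold wave
  refine Real.tendsto_exp_atBot.comp ?_
  exact (tendsto_atBot_add_const_right _ _ tendsto_id).const_mul_atBot (by positivity)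

lemma tendsto_wave_atTop {a : ℝ} (ha : 0 < a) (t : ℝ) :
    Tendsto (fun x => wave a x t) atTop atTop := by
  unfold wave
  refine Real.tendsto_exp_atTop.comp ?_
  exact (tendsto_atTop_add_const_right _ _ tendsto_id).const_mul_atTop (by positivity)

lemma tendsto_coupling_atBot (hp : ∀ j, 0 < η j) (i : Fin N × Fin 2) (t : ℝ) :
    Tendsto (fun x => coupling η E E' i x t) atBot (𝓝 0) := by
  have h := ((Complex.continuous_ofReal.tendsto 0).comp
    (tendsto_wave_atBot (hp i.1) t)).const_mul (gamma η E E' i)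
  simpa [coupling] using h

lemma InputData.tendsto_coupling_inv_atTop (h : InputData η E E') (i : Fin N × Fin 2) (t : ℝ) :
    Tendsto (fun x => (coupling η E E' i x t)⁻¹) atTop (𝓝 0) := by
  have h1 := ((Complex.continuous_ofReal.tendsto 0).comp
    (tendsto_wave_atTop (h.pos i.1) t).inv_tendsto_atTop).const_mul (gamma η E E' i)⁻¹
  simpa [coupling, mul_inv, mul_comm] using h1

lemma InputData.coupling_ne (h : InputData η E E') (i : Fin N × Fin 2) (x t : ℝ) :
    coupling η E E' i x t ≠ 0 :=
  mul_ne_zero (h.gamma_ne i) (by exact_mod_cast (Real.exp_pos _).ne')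

variable (η) in
/-- The limit of `det M` as `x → -∞`. -/
def detLimit : ℂ := (revVandermonde fun i : Fin (N * 2) => pt η (rowIdx i)).det

lemma detLimit_ne_zero (hp : ∀ j, 0 < η j) (hd : Function.Injective η) : detLimit η ≠ 0 :=
  det_revVandermonde_ne_zero ((pt_injective hp hd).comp rowIdx_bijective.1)

lemma tendsto_bigM_atBot (hp : ∀ j, 0 < η j) (t : ℝ) :
    Tendsto (fun x => bigM (poles η) E E' x t) atBot
      (𝓝 (revVandermonde fun i : Fin (N * 2) => pt η (rowIdx i))) := by
  refine tendsto_pi_nhds.2 fun i => tendsto_pi_nhds.2 fun c => ?_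
  have h := ((tendsto_coupling_atBot (E := E) (E' := E') hp (rowIdx i) t).mul_const
    (partner η (rowIdx i) ^ (c.rev : ℕ))).const_add (pt η (rowIdx i) ^ (c.rev : ℕ))
  rw [zero_mul, add_zero] at h
  exact h.congr fun x => (bigM_apply η E E' x t i c).symm

lemma tendsto_det_atBot (hp : ∀ j, 0 < η j) (t : ℝ) :
    Tendsto (fun x => (bigM (poles η) E E' x t).det) atBot (𝓝 (detLimit η)) :=
  ((continuous_id.matrix_det).tendsto _).comp (tendsto_bigM_atBot hp t)

lemma eventually_det_atBot (hp : ∀ j, 0 < η j) (hd : Function.Injective η) (t : ℝ) :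
    ∀ᶠ x in atBot, (bigM (poles η) E E' x t).det ≠ 0 :=
  (tendsto_det_atBot hp t).eventually_ne (detLimit_ne_zero hp hd)

lemma tendsto_monicPoly {l : Filter ℝ} {t : ℝ} {v : Fin (N * 2) → ℂ}
    (h : Tendsto (fun x => bigA (poles η) E E' x t) l
      (𝓝 fun c => (∏ i, (X - C (v i))).coeff (c.rev : ℕ))) (κ : ℂ) :
    Tendsto (fun x => monicPoly (poles η) E E' κ x t) l (𝓝 (∏ i, (κ - v i))) := by
  have h1 : ∏ i, (κ - v i) = κ ^ (N * 2) + ∑ c : Fin (N * 2),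
      (∏ i, (X - C (v i))).coeff (c.rev : ℕ) * κ ^ (c.rev : ℕ) := by
    have h := eval_eq_sum_fin_rev (n := N * 2) (Ψ := (∏ i, (X - C (v i))) - X ^ (N * 2))
      (fun l hl => by
        rcases hl.eq_or_lt with rfl | hl
        · simp [coeff_prod_X_sub_C_top]
        · simp [coeff_prod_X_sub_C_gt v hl, Polynomial.coeff_X_pow, hl.ne']) κ
    simp only [Polynomial.coeff_sub, Polynomial.coeff_X_pow] at h
    rw [Finset.sum_congr rfl fun (c : Fin (N * 2)) _ => by
      rw [if_neg c.rev.isLt.ne, sub_zero]] at h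
    rw [← h]
    simp [Polynomial.eval_prod]
  have h2 : (fun x => monicPoly (poles η) E E' κ x t) = fun x => κ ^ (N * 2)
      + ∑ c : Fin (N * 2), bigA (poles η) E E' x t c * κ ^ (c.rev : ℕ) := by
    funext x
    unfold monicPoly
    rw [mul_comm 2 N, Finset.sum_range, ← Equiv.sum_comp Fin.revPerm]
    congr 1
    refine Finset.sum_congr rfl fun c _ => ?_
    rw [Fin.revPerm_apply, coefA_rev]
  rw [h1, h2]
  refine tendsto_const_nhds.add (tendsto_finsetSum _ fun c _ => ?_)
  exact (tendsto_pi_nhds.1 h c).mul_const _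

lemma prod_rowIdx (f : Fin N × Fin 2 → ℂ) : ∏ i : Fin (N * 2), f (rowIdx i) = ∏ i, f i :=
  rowIdx_bijective.prod_comp f

lemma tendsto_bigA_atBot (hp : ∀ j, 0 < η j) (hd : Function.Injective η) (t : ℝ) :
    Tendsto (fun x => bigA (poles η) E E' x t) atBot
      (𝓝 fun c => (∏ i : Fin (N * 2), (X - C (pt η (rowIdx i)))).coeff (c.rev : ℕ)) := by
  refine tendsto_neg_inv_mulVec ((pt_injective hp hd).comp rowIdx_bijective.1)
    (fun i c => ?_) fun i => ?_
  · exact tendsto_pi_nhds.1 (tendsto_pi_nhds.1 (tendsto_bigM_atBot hp t) i) c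
  · have h := ((tendsto_coupling_atBot (E := E) (E' := E') hp (rowIdx i) t).mul_const
      (partner η (rowIdx i) ^ (N * 2))).const_add (pt η (rowIdx i) ^ (N * 2))
    rw [zero_mul, add_zero] at h
    exact h.congr fun x => (bigB_apply η E E' x t i).symm

lemma tendsto_monicPoly_atBot (hp : ∀ j, 0 < η j) (hd : Function.Injective η) (t : ℝ) (κ : ℂ) :
    Tendsto (fun x => monicPoly (poles η) E E' κ x t) atBot
      (𝓝 (bigGamma (poles η) (-κ))) := by
  rw [bigGamma_neg_eq, ← prod_rowIdx]
  exact tendsto_monicPoly (tendsto_bigA_atBot hp hd t) κ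

lemma prod_sub_partner (κ : ℂ) : ∏ i, (κ - partner η i) = bigGamma (poles η) κ := by
  unfold bigGamma
  rw [Fintype.prod_prod_type]
  refine Finset.prod_congr rfl fun j _ => ?_
  rw [Fin.prod_univ_two, partner_zero, partner_one, conj_poles, poles]
  ring

/-- At +∞ the couplings blow up. Dividing each row of M and of B by its coupling leaves M⁻¹B
unchanged, and the rescaled system converges to the Vandermonde system of the partners. -/
lemma InputData.tendsto_monicPoly_atTop (h : InputData η E E') (t : ℝ) (κ : ℂ) :
    Tendsto (fun x => monicPoly (poles η) E E' κ x t) atTop (𝓝 (bigGamma (poles η) κ)) := by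
  rw [← prod_sub_partner, ← prod_rowIdx]
  refine tendsto_monicPoly ?_ κ
  set D : ℝ → Matrix (Fin (N * 2)) (Fin (N * 2)) ℂ := fun x =>
    Matrix.diagonal fun i => (coupling η E E' (rowIdx i) x t)⁻¹
  have hD : ∀ x, IsUnit (D x).det := fun x => by
    rw [Matrix.det_diagonal]
    exact (Finset.prod_ne_zero_iff.2 fun i _ => inv_ne_zero (h.coupling_ne _ _ _)).isUnit
  have h1 : (fun x => bigA (poles η) E E' x t) = fun x =>
      -((D x * bigM (poles η) E E' x t)⁻¹.mulVec ((D x).mulVec (bigB (poles η) E E' x t))) := by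
    funext x
    rw [Matrix.mul_inv_rev, Matrix.mulVec_mulVec, Matrix.mul_assoc,
      Matrix.nonsing_inv_mul _ (hD x), Matrix.mul_one]
    rfl
  have h2 : ∀ (i : Fin (N * 2)) (n : ℕ), Tendsto (fun x => (coupling η E E' (rowIdx i) x t)⁻¹
      * (pt η (rowIdx i) ^ n + coupling η E E' (rowIdx i) x t * partner η (rowIdx i) ^ n)) atTop
      (𝓝 (partner η (rowIdx i) ^ n)) := by
    intro i n
    have h3 := ((h.tendsto_coupling_inv_atTop (rowIdx i) t).mul_const
      (pt η (rowIdx i) ^ n)).add_const (partner η (rowIdx i) ^ n)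
    rw [zero_mul, zero_add] at h3
    refine h3.congr fun x => ?_
    have := h.coupling_ne (rowIdx i) x t
    field_simp
  rw [h1]
  refine tendsto_neg_inv_mulVec ((partner_injective h.pos h.distinct).comp rowIdx_bijective.1)
    (fun i c => ?_) fun i => ?_
  · refine (h2 i (c.rev : ℕ)).congr fun x => ?_
    rw [Matrix.diagonal_mul, bigM_apply]
  · refine (h2 i (N * 2)).congr fun x => ?_
    rw [Matrix.mulVec_diagonal, bigB_apply]

lemma exp_mul_jost (κ : ℂ) (x : ℝ) (m G : ℂ) :
    Complex.exp (-(κ * x)) * (Complex.exp (κ * x) * m / G) = m / G := by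
  rw [mul_div_assoc, ← mul_assoc, ← Complex.exp_add, neg_add_cancel, Complex.exp_zero, one_mul]

lemma InputData.jost_limits (h : InputData η E E') (t : ℝ) (κ : ℂ) :
    (bigGamma (poles η) κ ≠ 0 →
      Tendsto (fun x : ℝ => Complex.exp (-(κ * x)) * jostF (poles η) E E' κ x t) atTop (𝓝 1) ∧
      Tendsto (fun x : ℝ => Complex.exp (-(κ * x)) * jostF (poles η) E E' κ x t)
        atBot (𝓝 (transmission (poles η) κ)⁻¹)) ∧
    (bigGamma (poles η) (-κ) ≠ 0 →
      Tendsto (fun x : ℝ => Complex.exp (-(κ * x)) * jostG (poles η) E E' κ x t)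
        atBot (𝓝 1)) := by
  unfold jostF jostG
  simp only [exp_mul_jost]
  refine ⟨fun hG => ⟨?_, ?_⟩, fun hG => ?_⟩
  · simpa [div_self hG] using (h.tendsto_monicPoly_atTop t κ).div_const (bigGamma (poles η) κ)
  · rw [transmission, inv_div]
    exact (tendsto_monicPoly_atBot h.pos h.distinct t κ).div_const _
  · simpa [div_self hG] using
      (tendsto_monicPoly_atBot h.pos h.distinct t κ).div_const (bigGamma (poles η) (-κ))

lemma transmission_eq (κ : ℂ) : transmission (poles η) κ = ∏ j,
    ((κ + Complex.I * z * η j) / (κ - Complex.I * z * η j)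
      * ((κ - Complex.I * z ^ 2 * η j) / (κ + Complex.I * z ^ 2 * η j))) := by
  unfold transmission
  have h1 : bigGamma (poles η) κ
      = ∏ j, (κ + Complex.I * z * η j) * (κ - Complex.I * z ^ 2 * η j) := by
    unfold bigGamma
    refine Finset.prod_congr rfl fun j _ => ?_
    rw [conj_poles, poles]; ring
  have h2 : bigGamma (poles η) (-κ)
      = ∏ j, (κ - Complex.I * z * η j) * (κ + Complex.I * z ^ 2 * η j) := by
    unfold bigGamma
    refine Finset.prod_congr rfl fun j _ => ?_
    rw [conj_poles, poles]; ring
  rw [h1, h2, ← Finset.prod_div_distrib]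
  exact Finset.prod_congr rfl fun j _ => (div_mul_div_comm _ _ _ _).symm

end Limits

/-! ### The derivative of the determinant -/

section Jacobi

/-- Jacobi's formula: the product rule differentiates one column at a time, and Cramer's rule
recognises each resulting determinant as a diagonal entry of the adjugate product. -/
lemma hasDerivAt_det {m : Type*} [Fintype m] [DecidableEq m] {A : ℝ → Matrix m m ℂ}
    {A' : Matrix m m ℂ} {x : ℝ} (h : ∀ i j, HasDerivAt (fun y => A y i j) (A' i j) x) :
    HasDerivAt (fun y => (A y).det) (Matrix.trace ((A x).adjugate * A')) x := by
  simp only [Matrix.det_apply']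
  have h1 := HasDerivAt.fun_sum (u := Finset.univ) fun (σ : Equiv.Perm m) _ =>
    (HasDerivAt.fun_finsetProd (u := Finset.univ) fun i _ => h (σ i) i).const_mul
      ((Equiv.Perm.sign σ : ℤ) : ℂ)
  refine h1.congr_deriv ?_
  have h2 : Matrix.trace ((A x).adjugate * A')
      = ∑ c, ((A x).updateCol c fun i => A' i c).det := by
    refine Finset.sum_congr rfl fun c _ => ?_
    rw [← Matrix.cramer_apply, Matrix.cramer_eq_adjugate_mulVec]
    rfl
  rw [h2]
  simp only [Matrix.det_apply', Finset.mul_sum]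
  rw [Finset.sum_comm]
  refine Finset.sum_congr rfl fun c _ => Finset.sum_congr rfl fun σ _ => ?_
  rw [← Finset.mul_prod_erase Finset.univ _ (Finset.mem_univ c), Matrix.updateCol_self,
    smul_eq_mul, mul_comm (A' _ _)]
  congr 2
  refine Finset.prod_congr rfl fun i hi => ?_
  rw [Matrix.updateCol_ne (Finset.ne_of_mem_erase hi)]

variable {N : ℕ} {η : Fin N → ℝ} {E E' : Fin N → ℂ}

variable (η E E') in
/-- The matrix of multiplication by `κ` modulo the linear relations. -/
def companion (x t : ℝ) : Matrix (Fin (N * 2)) (Fin (N * 2)) ℂ := fun c' c =>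
  if (c : ℕ) = 0 then -bigA (poles η) E E' x t c' else if (c' : ℕ) + 1 = c then 1 else 0

/-- Right multiplication by the companion matrix raises the exponent of every column by one; the
column of highest power uses MA = -B. -/
lemma bigM_mul_companion {x t : ℝ} (hdet : (bigM (poles η) E E' x t).det ≠ 0)
    (i c : Fin (N * 2)) : (bigM (poles η) E E' x t * companion η E E' x t) i c
      = pt η (rowIdx i) ^ ((c.rev : ℕ) + 1)
        + coupling η E E' (rowIdx i) x t * partner η (rowIdx i) ^ ((c.rev : ℕ) + 1) := by
  rw [Matrix.mul_apply]
  by_cases hc : (c : ℕ) = 0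
  · have h1 : (c.rev : ℕ) + 1 = N * 2 := by rw [Fin.val_rev]; omega
    rw [h1, ← bigB_apply]
    have h2 := congrFun (bigM_mulVec_bigA hdet) i
    rw [Pi.neg_apply, Matrix.mulVec, dotProduct] at h2
    simp only [companion, if_pos hc, mul_neg, Finset.sum_neg_distrib, h2, neg_neg]
  · obtain ⟨c', hc'⟩ : ∃ c' : Fin (N * 2), (c' : ℕ) + 1 = c := ⟨⟨c - 1, by omega⟩, by simp; omega⟩
    rw [Finset.sum_eq_single c']
    · have h1 : (c.rev : ℕ) + 1 = c'.rev := by rw [Fin.val_rev, Fin.val_rev]; omega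
      rw [h1, ← bigM_apply, companion, if_neg hc, if_pos hc', mul_one]
    · intro b _ hb
      have : (b : ℕ) + 1 ≠ c := fun h => hb (Fin.ext (by omega))
      rw [companion, if_neg hc, if_neg this, mul_zero]
    · simp

lemma trace_companion (hN : 1 ≤ N) (x t : ℝ) : Matrix.trace (companion η E E' x t)
    = -coefA (poles η) E E' (N * 2 - 1) x t := by
  have h0 : 0 < N * 2 := by omega
  rw [Matrix.trace, Finset.sum_eq_single (⟨0, h0⟩ : Fin (N * 2))]
  · rw [Matrix.diag_apply, companion, if_pos rfl, ← coefA_rev]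
    simp
  · intro b _ hb
    have : (b : ℕ) ≠ 0 := fun h => hb (Fin.ext h)
    rw [Matrix.diag_apply, companion, if_neg this, if_neg (by omega)]
  · simp

lemma sum_rowIdx (f : Fin N × Fin 2 → ℂ) : ∑ i : Fin (N * 2), f (rowIdx i) = ∑ i, f i :=
  rowIdx_bijective.sum_comp f

/-- From (γχ)' = (p' - p)γχ one gets M' = MC - DM, where C is the companion matrix and D the
diagonal matrix of the poles. The trace of adj(M)M' is then det M · (tr C - tr D). -/
lemma hasDerivAt_det_bigM (hN : 1 ≤ N) {x t : ℝ}
    (hdet : (bigM (poles η) E E' x t).det ≠ 0) :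
    HasDerivAt (fun y => (bigM (poles η) E E' y t).det)
      (-(coefA (poles η) E E' (N * 2 - 1) x t + ∑ i, pt η i)
        * (bigM (poles η) E E' x t).det) x := by
  set M := bigM (poles η) E E' x t with hM
  have h1 : ∀ i c, HasDerivAt (fun y => bigM (poles η) E E' y t i c)
      ((M * companion η E E' x t - Matrix.diagonal (fun i => pt η (rowIdx i)) * M) i c) x := by
    intro i c
    have h2 : (fun y => bigM (poles η) E E' y t i c) = fun y => pt η (rowIdx i) ^ (c.rev : ℕ)
        + coupling η E E' (rowIdx i) y t * partner η (rowIdx i) ^ (c.rev : ℕ) :=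
      funext fun y => bigM_apply η E E' y t i c
    rw [h2]
    refine (((hasDerivAt_coupling (rowIdx i) x t).mul_const _).const_add _).congr_deriv ?_
    rw [Matrix.sub_apply, bigM_mul_companion hdet, Matrix.diagonal_mul, hM, bigM_apply]
    ring
  refine (hasDerivAt_det h1).congr_deriv ?_
  rw [← hM, Matrix.mul_sub, Matrix.trace_sub, ← Matrix.mul_assoc, Matrix.adjugate_mul,
    Matrix.smul_mul, Matrix.one_mul, Matrix.trace_smul, trace_companion hN, Matrix.trace_mul_comm,
    Matrix.mul_assoc, Matrix.mul_adjugate, Matrix.mul_smul, Matrix.mul_one, Matrix.trace_smul,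
    Matrix.trace_diagonal, sum_rowIdx (pt η)]
  simp only [smul_eq_mul]
  ring

end Jacobi

/-! ### Hirota's tau function -/

section Tau

/-- Symmetry of `f` makes the product over increasing pairs a product over unordered pairs, so the
new element may sit anywhere in the order. -/
lemma prod_pairs_insert {ι R : Type*} [LinearOrder ι] [CommMonoid R] {f : ι → ι → R}
    (hf : ∀ a b, f a b = f b a) {m : ι} {S : Finset ι} (hm : m ∉ S) :
    ∏ j ∈ insert m S, ∏ l ∈ (insert m S).filter (fun l => j < l), f j l
      = (∏ l ∈ S, f m l) * ∏ j ∈ S, ∏ l ∈ S.filter (fun l => j < l), f j l := by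
  rw [Finset.prod_insert hm, Finset.filter_insert, if_neg (lt_irrefl m)]
  have h1 : ∀ j ∈ S, ∏ l ∈ (insert m S).filter (fun l => j < l), f j l
      = (if j < m then f j m else 1) * ∏ l ∈ S.filter (fun l => j < l), f j l := by
    intro j _
    rw [Finset.filter_insert]
    split_ifs with h
    · rw [Finset.prod_insert]
      simp [hm]
    · rw [one_mul]
  rw [Finset.prod_congr rfl h1, Finset.prod_mul_distrib, ← mul_assoc, Finset.prod_filter,
    ← Finset.prod_mul_distrib]
  congr 1
  refine Finset.prod_congr rfl fun l hl => ?_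
  rcases lt_trichotomy m l with h | h | h
  · rw [if_pos h, if_neg h.not_gt, mul_one]
  · exact absurd (h ▸ hl) hm
  · rw [if_neg h.not_gt, if_pos h, one_mul, hf]

/-- Pairs each subset avoiding `j` with the one obtained by adding `j`; the relation at k_j holds
pair by pair. -/
lemma sum_finset_eq_sum_insert {ι R : Type*} [Fintype ι] [DecidableEq ι] [AddCommMonoid R]
    (F : Finset ι → R) (j : ι) : ∑ S : Finset ι, F S
      = ∑ S ∈ (Finset.univ.erase j).powerset, (F S + F (insert j S)) := by
  rw [Finset.sum_add_distrib, ← Finset.sum_powerset_insert (Finset.notMem_erase j _),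
    Finset.insert_erase (Finset.mem_univ j), Finset.powerset_univ]

lemma interaction_comm (a b : ℝ) : interaction a b = interaction b a := by
  unfold interaction
  congr 1 <;> ring

variable {N : ℕ} (η w : Fin N → ℝ)

/-- The summands of Hirota's tau function. -/
def hirotaTerm (S : Finset (Fin N)) (x t : ℝ) : ℝ :=
  (∏ j ∈ S, w j * wave (η j) x t) *
    ∏ j ∈ S, ∏ l ∈ S.filter (fun l => j < l), interaction (η j) (η l)

/-- The wave number of a summand. -/
def waveNumber (S : Finset (Fin N)) : ℝ := ∑ j ∈ S, Real.sqrt 3 * η j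

/-- The `m`-th `x`-derivative of Hirota's tau function. -/
def tauJet (m : ℕ) (x t : ℝ) : ℝ := ∑ S, waveNumber η S ^ m * hirotaTerm η w S x t

lemma tauJet_zero (x t : ℝ) : tauJet η w 0 x t = hirotaTau η w x t := by
  simp [tauJet, hirotaTerm, hirotaTau]

lemma hirotaTerm_insert {S : Finset (Fin N)} {j : Fin N} (h : j ∉ S) (x t : ℝ) :
    hirotaTerm η w (insert j S) x t = w j * wave (η j) x t
      * (∏ l ∈ S, interaction (η j) (η l)) * hirotaTerm η w S x t := by
  unfold hirotaTerm
  rw [Finset.prod_insert h,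
    prod_pairs_insert (f := fun a b => interaction (η a) (η b))
      (fun a b => interaction_comm _ _) h]
  ring

lemma prod_wave (S : Finset (Fin N)) (x t : ℝ) : ∏ j ∈ S, w j * wave (η j) x t
    = (∏ j ∈ S, w j) * Real.exp (waveNumber η S * x
      - (∑ j ∈ S, Real.sqrt 3 * η j * (9 * η j ^ 4)) * t) := by
  rw [Finset.prod_mul_distrib]
  unfold wave waveNumber
  rw [← Real.exp_sum, Finset.sum_mul, Finset.sum_mul, ← Finset.sum_sub_distrib]
  congr 2
  exact Finset.sum_congr rfl fun j _ => by ring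

lemma hasDerivAt_hirotaTerm (S : Finset (Fin N)) (x t : ℝ) :
    HasDerivAt (fun y => hirotaTerm η w S y t) (waveNumber η S * hirotaTerm η w S x t) x := by
  unfold hirotaTerm
  simp only [prod_wave]
  have h : HasDerivAt (fun y => waveNumber η S * y
      - (∑ j ∈ S, Real.sqrt 3 * η j * (9 * η j ^ 4)) * t) (waveNumber η S * 1) x :=
    ((hasDerivAt_id x).const_mul _).sub_const _
  refine ((h.exp.const_mul _).mul_const _).congr_deriv ?_
  ring

lemma hasDerivAt_tauJet (m : ℕ) (x t : ℝ) :
    HasDerivAt (fun y => tauJet η w m y t) (tauJet η w (m + 1) x t) x := by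
  unfold tauJet
  refine (HasDerivAt.fun_sum fun S _ =>
    (hasDerivAt_hirotaTerm η w S x t).const_mul (waveNumber η S ^ m)).congr_deriv ?_
  exact Finset.sum_congr rfl fun S _ => by ring

lemma hasDerivAt_hirotaTau (x t : ℝ) :
    HasDerivAt (fun y => hirotaTau η w y t) (tauJet η w 1 x t) x := by
  have h := hasDerivAt_tauJet η w 0 x t
  simpa only [tauJet_zero] using h

lemma contDiff_tauJet {n : WithTop ℕ∞} (m : ℕ) :
    ContDiff ℝ n fun v : ℝ × ℝ => tauJet η w m v.1 v.2 := by
  unfold tauJet hirotaTerm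
  exact ContDiff.sum fun S _ => contDiff_const.mul ((contDiff_prod fun j _ =>
    contDiff_const.mul (contDiff_wave _)).mul contDiff_const)

lemma contDiff_hirotaTau {n : WithTop ℕ∞} :
    ContDiff ℝ n fun v : ℝ × ℝ => hirotaTau η w v.1 v.2 := by
  simpa only [tauJet_zero] using contDiff_tauJet η w (n := n) 0

variable {η} in
lemma tendsto_hirotaTau_atBot (hp : ∀ j, 0 < η j) (t : ℝ) :
    Tendsto (fun x => hirotaTau η w x t) atBot (𝓝 1) := by
  unfold hirotaTau
  have h : ∀ S : Finset (Fin N), Tendsto (fun x => (∏ j ∈ S, w j * wave (η j) x t) *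
      ∏ j ∈ S, ∏ l ∈ S.filter (fun l => j < l), interaction (η j) (η l)) atBot
      (𝓝 (if S = ∅ then 1 else 0)) := by
    intro S
    have h1 := (tendsto_finsetProd S fun j _ =>
      (tendsto_wave_atBot (hp j) t).const_mul (w j)).mul_const
      (∏ j ∈ S, ∏ l ∈ S.filter (fun l => j < l), interaction (η j) (η l))
    convert h1 using 2
    split_ifs with hS
    · simp [hS]
    -- Any nonempty subset carries a decaying wave, so only the term of the empty set survives.
    · obtain ⟨j, hj⟩ := Finset.nonempty_iff_ne_empty.2 hS
      rw [Finset.prod_eq_zero hj (mul_zero _), zero_mul]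
  simpa using tendsto_finsetSum Finset.univ fun S _ => h S

lemma hirotaTau_pos (hd : Function.Injective η) (hp : ∀ j, 0 < η j) (hw : ∀ j, 0 < w j)
    (x t : ℝ) : 0 < hirotaTau η w x t := by
  unfold hirotaTau
  refine Finset.sum_pos (fun S _ => mul_pos (Finset.prod_pos fun j _ =>
    mul_pos (hw j) (Real.exp_pos _)) (Finset.prod_pos fun j _ => Finset.prod_pos fun l hl => ?_))
    Finset.univ_nonempty
  have hne : η j - η l ≠ 0 := sub_ne_zero.2 (hd.ne (Finset.mem_filter.1 hl).2.ne)
  have h1 : 0 < (η j - η l) ^ 2 := by positivity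
  have h2 := mul_pos (hp j) (hp l)
  have h3 := hp j
  have h4 := hp l
  unfold interaction
  have h5 : 0 < η j ^ 2 - η j * η l + η l ^ 2 := by nlinarith
  positivity

/-- The real quadratic polynomial with roots `i z a` and its complex conjugate. -/
def quadPoly (a : ℝ) : ℂ[X] := X ^ 2 + C ((Real.sqrt 3 * a : ℝ) : ℂ) * X + C ((a ^ 2 : ℝ) : ℂ)

lemma eval_quadPoly (a : ℝ) (κ : ℂ) :
    (quadPoly a).eval κ = (κ - Complex.I * z * a) * (κ + Complex.I * z ^ 2 * a) := by
  simp only [quadPoly, Polynomial.eval_add, Polynomial.eval_mul, Polynomial.eval_pow,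
    Polynomial.eval_X, Polynomial.eval_C]
  push_cast
  rw [← I_mul_z_sq_sub]
  linear_combination (-(a : ℂ) ^ 2) * z_cube + (-(a : ℂ) ^ 2 * z ^ 3 * -1) * Complex.I_sq

lemma monic_quadPoly (a : ℝ) : (quadPoly a).Monic := by
  unfold quadPoly; monicity!

lemma natDegree_quadPoly (a : ℝ) : (quadPoly a).natDegree = 2 := by
  unfold quadPoly; compute_degree!

lemma nextCoeff_quadPoly (a : ℝ) : (quadPoly a).nextCoeff = ((Real.sqrt 3 * a : ℝ) : ℂ) := by
  rw [Polynomial.nextCoeff_of_natDegree_pos (by rw [natDegree_quadPoly]; norm_num),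
    natDegree_quadPoly]
  simp [quadPoly, Polynomial.coeff_C, -Complex.ofReal_pow]

lemma conj_eval_quadPoly (a : ℝ) (κ : ℂ) :
    starRingEnd ℂ ((quadPoly a).eval κ) = (quadPoly a).eval (starRingEnd ℂ κ) := by
  simp [quadPoly]

/-- The sign of a soliton in a summand. -/
def signed (S : Finset (Fin N)) (j : Fin N) : ℝ := if j ∈ S then -η j else η j

/-- Hirota's tau function with shifted phases, as a polynomial in the spectral parameter. -/
def tauPoly (x t : ℝ) : ℂ[X] :=
  ∑ S, C ((hirotaTerm η w S x t : ℝ) : ℂ) * ∏ j, quadPoly (signed η S j)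

lemma eval_tauPoly (x t : ℝ) (κ : ℂ) : (tauPoly η w x t).eval κ
    = ∑ S, ((hirotaTerm η w S x t : ℝ) : ℂ) * ∏ j, (quadPoly (signed η S j)).eval κ := by
  simp [tauPoly, Polynomial.eval_finsetSum, Polynomial.eval_prod]

lemma conj_eval_tauPoly (x t : ℝ) (κ : ℂ) : starRingEnd ℂ ((tauPoly η w x t).eval κ)
    = (tauPoly η w x t).eval (starRingEnd ℂ κ) := by
  simp only [eval_tauPoly, map_sum, map_mul, map_prod, conj_eval_quadPoly, Complex.conj_ofReal]

lemma monic_prod_quadPoly (a : Fin N → ℝ) : (∏ j, quadPoly (a j)).Monic :=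
  Polynomial.monic_prod_of_monic _ _ fun j _ => monic_quadPoly (a j)

lemma natDegree_prod_quadPoly (a : Fin N → ℝ) : (∏ j, quadPoly (a j)).natDegree = N * 2 := by
  rw [Polynomial.natDegree_prod_of_monic _ _ fun j _ => monic_quadPoly (a j)]
  simp [natDegree_quadPoly]

lemma sum_hirotaTerm (x t : ℝ) :
    ∑ S, ((hirotaTerm η w S x t : ℝ) : ℂ) = ((hirotaTau η w x t : ℝ) : ℂ) := by
  rw [← Complex.ofReal_sum]; rfl

lemma coeff_tauPoly (l : ℕ) (x t : ℝ) : (tauPoly η w x t).coeff l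
    = ∑ S, ((hirotaTerm η w S x t : ℝ) : ℂ) * (∏ j, quadPoly (signed η S j)).coeff l := by
  simp [tauPoly]

lemma coeff_tauPoly_gt {l : ℕ} (hl : N * 2 < l) (x t : ℝ) : (tauPoly η w x t).coeff l = 0 := by
  rw [coeff_tauPoly]
  refine Finset.sum_eq_zero fun S _ => ?_
  rw [Polynomial.coeff_eq_zero_of_natDegree_lt (by rwa [natDegree_prod_quadPoly]), mul_zero]

lemma coeff_tauPoly_top (x t : ℝ) :
    (tauPoly η w x t).coeff (N * 2) = ((hirotaTau η w x t : ℝ) : ℂ) := by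
  rw [coeff_tauPoly, ← sum_hirotaTerm]
  refine Finset.sum_congr rfl fun S _ => ?_
  have h := (monic_prod_quadPoly (signed η S)).coeff_natDegree
  rw [natDegree_prod_quadPoly] at h
  rw [h, mul_one]

/-- Changing the sign of a leaves the constant term a² of `quadPoly a` unchanged, so every summand
has the same factor. This is the source of P = 0. -/
lemma coeff_tauPoly_zero (x t : ℝ) : (tauPoly η w x t).coeff 0
    = (∏ j, (η j : ℂ) ^ 2) * ((hirotaTau η w x t : ℝ) : ℂ) := by
  rw [coeff_tauPoly, ← sum_hirotaTerm, Finset.mul_sum]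
  refine Finset.sum_congr rfl fun S _ => ?_
  rw [Polynomial.coeff_zero_prod, mul_comm]
  congr 1
  refine Finset.prod_congr rfl fun j _ => ?_
  have : signed η S j ^ 2 = η j ^ 2 := by unfold signed; split_ifs <;> ring
  simp only [quadPoly, Polynomial.coeff_add, Polynomial.coeff_C_zero, this]
  simp

/-- Changing a sign turns √3η_j into -√3η_j, so the summand of S has next coefficient ∑√3η_j minus
twice its wave number; the wave number acts on the summand as ∂_x. -/
lemma coeff_tauPoly_next (hN : 1 ≤ N) (x t : ℝ) : (tauPoly η w x t).coeff (N * 2 - 1)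
    = (∑ j, ((Real.sqrt 3 * η j : ℝ) : ℂ)) * ((hirotaTau η w x t : ℝ) : ℂ)
      - 2 * ((tauJet η w 1 x t : ℝ) : ℂ) := by
  have h1 : ∀ S, (∏ j, quadPoly (signed η S j)).coeff (N * 2 - 1)
      = (∑ j, ((Real.sqrt 3 * η j : ℝ) : ℂ)) - 2 * ((waveNumber η S : ℝ) : ℂ) := by
    intro S
    have h2 := Polynomial.Monic.nextCoeff_prod Finset.univ (fun j => quadPoly (signed η S j))
      fun j _ => monic_quadPoly _
    rw [Polynomial.nextCoeff_of_natDegree_pos (by rw [natDegree_prod_quadPoly]; omega),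
      natDegree_prod_quadPoly] at h2
    rw [h2]
    simp only [nextCoeff_quadPoly, waveNumber]
    have h3 : ∑ j ∈ S, Real.sqrt 3 * η j = ∑ j, if j ∈ S then Real.sqrt 3 * η j else 0 := by
      simp [Finset.sum_ite_mem]
    rw [h3, ← Complex.ofReal_sum, ← Complex.ofReal_sum]
    norm_cast
    rw [Finset.mul_sum, ← Finset.sum_sub_distrib]
    refine Finset.sum_congr rfl fun j _ => ?_
    unfold signed
    split_ifs <;> ring
  rw [coeff_tauPoly, ← sum_hirotaTerm]
  simp only [h1, tauJet, mul_sub, Finset.sum_sub_distrib, pow_one]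
  push_cast
  rw [Finset.mul_sum, Finset.mul_sum]
  congr 1
  · exact Finset.sum_congr rfl fun S _ => mul_comm _ _
  · exact Finset.sum_congr rfl fun S _ => by ring

end Tau

/-! ### The tau function solves the linear relations -/

section TauKills

variable {N : ℕ} {η : Fin N → ℝ} {E E' : Fin N → ℂ}

/-- Alignment of the dependency constants with the directions of a reduction. -/
def Aligned (c : Reduction) (η : Fin N → ℝ) (E : Fin N → ℂ) : Prop :=
  ∀ j, (gam (poles η) E j).im * (direction c η j).re
    = (gam (poles η) E j).re * (direction c η j).im

lemma direction_ne_zero (hp : ∀ j, 0 < η j) (c : Reduction) (j : Fin N) :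
    direction c η j ≠ 0 := by
  unfold direction
  refine mul_ne_zero (by cases c <;> exact pow_ne_zero _ z_ne)
    (Finset.prod_ne_zero_iff.2 fun l _ h => ?_)
  have h1 := congrArg Complex.im h
  rw [z_sq, ← Complex.ofReal_pow, ← Complex.ofReal_pow] at h1
  simp [z, -Complex.ofReal_pow] at h1
  exact absurd h1 (hp l).ne'

lemma aligned_iff_im_div (hp : ∀ j, 0 < η j) (c : Reduction) : Aligned c η E ↔
    ∀ j, (gam (poles η) E j / direction c η j).im = 0 := by
  refine forall_congr' fun j => ?_
  have h := direction_ne_zero hp c j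
  have h2 : Complex.normSq (direction c η j) ≠ 0 := Complex.normSq_eq_zero.not.2 h
  rw [Complex.div_im, ← sub_div, div_eq_zero_iff, or_iff_left h2, sub_eq_zero]

lemma Aligned.gam_eq (hp : ∀ j, 0 < η j) {c : Reduction} (ha : Aligned c η E) (j : Fin N) :
    gam (poles η) E j
      = ((gam (poles η) E j / direction c η j).re : ℂ) * direction c η j := by
  have h1 : gam (poles η) E j / direction c η j
      = ((gam (poles η) E j / direction c η j).re : ℂ) := by
    apply Complex.ext
    · simp
    · rw [(aligned_iff_im_div hp c).1 ha j, Complex.ofReal_im]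
  rw [← h1, div_mul_cancel₀ _ (direction_ne_zero hp c j)]

lemma Aligned.weight_ne_zero (h : InputData η E E') {c : Reduction} (ha : Aligned c η E)
    (j : Fin N) : weight c η E j ≠ 0 := by
  unfold weight
  refine mul_ne_zero (fun h0 => ?_) (Finset.prod_ne_zero_iff.2 fun l hl => ?_)
  · have h1 := ha.gam_eq h.pos j
    rw [h0, Complex.ofReal_zero, zero_mul] at h1
    exact h.gam_ne j h1
  · have hne : η j ≠ η l := fun he => Finset.ne_of_mem_erase hl (h.distinct he).symm
    have h1 := h.pos j
    have h2 := h.pos l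
    have h3 : η j - η l ≠ 0 := sub_ne_zero.2 hne
    have h4 : η j ^ 3 - η l ^ 3 ≠ 0 := by
      have : η j ^ 3 - η l ^ 3 = (η j - η l) * (η j ^ 2 + η j * η l + η l ^ 2) := by ring
      rw [this]
      exact mul_ne_zero h3 (by positivity)
    have h5 : η j + η l ≠ 0 := by positivity
    exact div_ne_zero (mul_ne_zero h5 h4) (pow_ne_zero _ h3)

lemma eval_quadPoly_pole (a b : ℝ) : (quadPoly b).eval (Complex.I * z * a)
    = -(z ^ 2 * (a - b) * (a + z * b)) := by
  rw [eval_quadPoly]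
  linear_combination (z ^ 2 * (a - b) * (a + z * b) : ℂ) * Complex.I_sq

lemma eval_quadPoly_partner (a b : ℝ) : (quadPoly b).eval (Complex.I * z ^ 2 * a)
    = -((z * a - b) * (a + b)) := by
  rw [eval_quadPoly]
  linear_combination (z ^ 3 * (z * a - b) * (a + b) : ℂ) * Complex.I_sq
    - ((z * a - b) * (a + b) : ℂ) * z_cube

lemma add_z_mul_ne_zero {a b : ℝ} (hb : b ≠ 0) : (a : ℂ) + z * b ≠ 0 := by
  intro h
  have h1 := congrArg Complex.im h
  simp [z] at h1
  exact hb h1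

lemma eval_quadPoly_pole_ne_zero {a b : ℝ} (hab : a ≠ b) (hb : b ≠ 0) :
    (quadPoly b).eval (Complex.I * z * a) ≠ 0 := by
  rw [eval_quadPoly_pole]
  have : (a : ℂ) - b ≠ 0 := sub_ne_zero.2 (by exact_mod_cast hab)
  exact neg_ne_zero.2 (mul_ne_zero (mul_ne_zero (pow_ne_zero _ z_ne) this) (add_z_mul_ne_zero hb))

/-- Each factor of `weight` compensates the quotient of the values of a quadratic at the partner and
at the pole, leaving one factor of `direction` and one power of z. -/
lemma weight_factor_identity {a b : ℝ} (hab : a ≠ b) :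
    (((a + b) * (a ^ 3 - b ^ 3) / (a - b) ^ 2 : ℝ) : ℂ) * (quadPoly b).eval (Complex.I * z * a)
      = z * ((a : ℂ) ^ 2 - z ^ 2 * (b : ℂ) ^ 2) * (quadPoly b).eval (Complex.I * z ^ 2 * a) := by
  rw [eval_quadPoly_pole, eval_quadPoly_partner]
  have h : (a + b) * (a ^ 3 - b ^ 3) / (a - b) ^ 2
      = (a + b) * (a ^ 2 + a * b + b ^ 2) / (a - b) := by
    have : a - b ≠ 0 := sub_ne_zero.2 hab
    field_simp
    ring
  have h' : (a : ℂ) - b ≠ 0 := sub_ne_zero.2 (by exact_mod_cast hab)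
  rw [h]
  push_cast
  field_simp
  linear_combination ((a + b) * z * (a + z * b) * (a * b) : ℂ) * (-z_sq_add)

/-- Hirota's coefficient is a cross ratio: the quotient of the values of `quadPoly b` and `quadPoly
(-b)` at the pole, divided by the same quotient at the partner. Hence the sign of soliton l can be
flipped at the cost of one interaction factor. -/
lemma interaction_identity {a b : ℝ} (ha : 0 < a) (hb : 0 < b) :
    ((interaction a b : ℝ) : ℂ) * (quadPoly (-b)).eval (Complex.I * z * a)
        * (quadPoly b).eval (Complex.I * z ^ 2 * a)
      = (quadPoly b).eval (Complex.I * z * a)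
        * (quadPoly (-b)).eval (Complex.I * z ^ 2 * a) := by
  rw [eval_quadPoly_pole, eval_quadPoly_partner, eval_quadPoly_pole, eval_quadPoly_partner]
  have h1 : (a : ℂ) + b ≠ 0 := by exact_mod_cast (add_pos ha hb).ne'
  have h2 : (a : ℂ) ^ 2 + a * b + b ^ 2 ≠ 0 := by
    exact_mod_cast (by positivity : (0 : ℝ) < a ^ 2 + a * b + b ^ 2).ne'
  have h3 : ((a : ℂ) - z * b) * (z * a - b) = z * (a ^ 2 + a * b + b ^ 2) := by
    linear_combination (-(a * b) : ℂ) * z_sq_add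
  have h4 : ((a : ℂ) + z * b) * (z * a + b) = z * (a ^ 2 - a * b + b ^ 2) := by
    linear_combination ((a * b) : ℂ) * z_sq_add
  unfold interaction
  push_cast
  rw [div_mul_eq_mul_div, div_mul_eq_mul_div, div_eq_iff (mul_ne_zero (pow_ne_zero _ h1) h2)]
  linear_combination ((a - b) ^ 2 * (a ^ 2 - a * b + b ^ 2) * z ^ 2 * (a + b) ^ 2 : ℂ) * h3
    - ((a - b) ^ 2 * z ^ 2 * (a + b) ^ 2 * (a ^ 2 + a * b + b ^ 2) : ℂ) * h4

lemma signed_insert_ne (S : Finset (Fin N)) {j l : Fin N} (h : l ≠ j) :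
    signed η (insert j S) l = signed η S l := by
  simp [signed, Finset.mem_insert, h]

lemma prod_quadPoly_split (S : Finset (Fin N)) {j : Fin N} (hj : j ∉ S) (κ : ℂ) :
    ∏ l, (quadPoly (signed η S l)).eval κ = (quadPoly (η j)).eval κ
      * ∏ l ∈ Finset.univ.erase j, (quadPoly (signed η S l)).eval κ := by
  rw [← Finset.mul_prod_erase Finset.univ _ (Finset.mem_univ j)]
  simp [signed, hj]

lemma prod_quadPoly_insert_split (S : Finset (Fin N)) (j : Fin N) (κ : ℂ) :
    ∏ l, (quadPoly (signed η (insert j S) l)).eval κ = (quadPoly (-η j)).eval κ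
      * ∏ l ∈ Finset.univ.erase j, (quadPoly (signed η S l)).eval κ := by
  rw [← Finset.mul_prod_erase Finset.univ _ (Finset.mem_univ j)]
  congr 1
  · simp [signed]
  · refine Finset.prod_congr rfl fun l hl => ?_
    rw [signed_insert_ne S (Finset.ne_of_mem_erase hl)]

lemma prod_interaction_identity (hp : ∀ j, 0 < η j) {S : Finset (Fin N)} {j : Fin N}
    (hS : S ⊆ Finset.univ.erase j) :
    (∏ l ∈ S, ((interaction (η j) (η l) : ℝ) : ℂ))
        * (∏ l ∈ Finset.univ.erase j, (quadPoly (signed η S l)).eval (Complex.I * z * η j))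
        * ∏ l ∈ Finset.univ.erase j, (quadPoly (η l)).eval (Complex.I * z ^ 2 * η j)
      = (∏ l ∈ Finset.univ.erase j, (quadPoly (η l)).eval (Complex.I * z * η j))
        * ∏ l ∈ Finset.univ.erase j,
          (quadPoly (signed η S l)).eval (Complex.I * z ^ 2 * η j) := by
  have h1 : ∏ l ∈ S, ((interaction (η j) (η l) : ℝ) : ℂ) = ∏ l ∈ Finset.univ.erase j,
      if l ∈ S then ((interaction (η j) (η l) : ℝ) : ℂ) else 1 := by
    rw [Finset.prod_ite_mem, Finset.inter_eq_right.2 hS]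
  rw [h1, ← Finset.prod_mul_distrib, ← Finset.prod_mul_distrib, ← Finset.prod_mul_distrib]
  refine Finset.prod_congr rfl fun l _ => ?_
  unfold signed
  split_ifs
  · exact interaction_identity (hp j) (hp l)
  · ring

lemma prod_weight_identity (hd : Function.Injective η) (j : Fin N) :
    ((∏ l ∈ Finset.univ.erase j, (η j + η l) * (η j ^ 3 - η l ^ 3) / (η j - η l) ^ 2 : ℝ) : ℂ)
        * ∏ l ∈ Finset.univ.erase j, (quadPoly (η l)).eval (Complex.I * z * η j)
      = z ^ (N - 1) * (∏ l ∈ Finset.univ.erase j, ((η j : ℂ) ^ 2 - z ^ 2 * (η l : ℂ) ^ 2))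
        * ∏ l ∈ Finset.univ.erase j, (quadPoly (η l)).eval (Complex.I * z ^ 2 * η j) := by
  have h1 : z ^ (N - 1) = ∏ l ∈ Finset.univ.erase j, z := by
    rw [Finset.prod_const, Finset.card_erase_of_mem (Finset.mem_univ j), Finset.card_univ,
      Fintype.card_fin]
  rw [h1, Complex.ofReal_prod, ← Finset.prod_mul_distrib, ← Finset.prod_mul_distrib,
    ← Finset.prod_mul_distrib]
  refine Finset.prod_congr rfl fun l hl => ?_
  exact weight_factor_identity fun he => Finset.ne_of_mem_erase hl (hd he).symm

/-- The factor of soliton j itself; it fixes the power z^{N+1} in the direction for P = 0. -/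
lemma quadPoly_self_identity (hN : 1 ≤ N) (a : ℝ) :
    z ^ (N - 1) * (quadPoly (-a)).eval (Complex.I * z * a)
      + z ^ (N + 1) * (quadPoly a).eval (Complex.I * z ^ 2 * a) = 0 := by
  obtain ⟨n, rfl⟩ : ∃ n, N = n + 1 := ⟨N - 1, by omega⟩
  rw [eval_quadPoly_pole, eval_quadPoly_partner, Nat.add_sub_cancel]
  push_cast
  ring

/-- The tau function satisfies the linear relation at `k_j`. -/
lemma tauPoly_relation (hp : ∀ j, 0 < η j) (hd : Function.Injective η)
    (ha : Aligned .zero η E) (j : Fin N) (x t : ℝ) :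
    (tauPoly η (weight .zero η E) x t).eval (Complex.I * z * η j)
      + gam (poles η) E j * ((wave (η j) x t : ℝ) : ℂ)
        * (tauPoly η (weight .zero η E) x t).eval (Complex.I * z ^ 2 * η j) = 0 := by
  have hN : 1 ≤ N := by have := j.isLt; omega
  set w := weight .zero η E with hw
  rw [eval_tauPoly, eval_tauPoly, sum_finset_eq_sum_insert _ j, sum_finset_eq_sum_insert _ j,
    Finset.mul_sum, ← Finset.sum_add_distrib]
  refine Finset.sum_eq_zero fun S hS => ?_
  rw [Finset.mem_powerset] at hS
  have hj : j ∉ S := fun h => Finset.notMem_erase j _ (hS h)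
  rw [prod_quadPoly_insert_split, prod_quadPoly_insert_split, prod_quadPoly_split S hj,
    prod_quadPoly_split S hj, hirotaTerm_insert η w hj]
  have hB : ∏ l ∈ Finset.univ.erase j, (quadPoly (η l)).eval (Complex.I * z * η j) ≠ 0 :=
    Finset.prod_ne_zero_iff.2 fun l hl => eval_quadPoly_pole_ne_zero
      (fun he => Finset.ne_of_mem_erase hl (hd he).symm) (hp l).ne'
  have h1 := prod_interaction_identity hp hS
  have h2 := prod_weight_identity hd j
  have h3 := quadPoly_self_identity hN (η j)
  -- The quadratic factor of soliton j kills the term of S at the pole and the term of S ∪ {j} at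
  -- the partner. The two remaining terms both carry χ_j exactly once and must cancel.
  have h4 : (quadPoly (η j)).eval (Complex.I * z * η j) = 0 := by
    rw [eval_quadPoly_pole]; ring
  have h5 : (quadPoly (-η j)).eval (Complex.I * z ^ 2 * η j) = 0 := by
    rw [eval_quadPoly_partner]; push_cast; ring
  have h6 : (w j : ℂ) = ((gam (poles η) E j / direction .zero η j).re : ℂ)
      * ((∏ l ∈ Finset.univ.erase j,
        (η j + η l) * (η j ^ 3 - η l ^ 3) / (η j - η l) ^ 2 : ℝ) : ℂ) := by
    rw [hw, weight, Complex.ofReal_mul]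
  have h7 := ha.gam_eq hp j
  simp only [direction] at h7
  rw [h4, h5, h7]
  simp only [direction] at h6
  push_cast at h6 h2 ⊢
  rw [h6]
  generalize ((gam (poles η) E j / (z ^ (N + 1) * ∏ l ∈ Finset.univ.erase j,
    ((η j : ℂ) ^ 2 - z ^ 2 * (η l : ℂ) ^ 2))).re : ℂ) = r
  -- Multiplication by the nonzero product B brings the equation to the denominator-free form of
  -- `h1` and `h2`.
  apply mul_left_cancel₀ hB
  generalize ((hirotaTerm η w S x t : ℝ) : ℂ) = T at *
  generalize ((wave (η j) x t : ℝ) : ℂ) = χ at *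
  generalize ∏ l ∈ S, ((interaction (η j) (η l) : ℝ) : ℂ) = I₀ at *
  generalize ∏ l ∈ Finset.univ.erase j, (quadPoly (signed η S l)).eval (Complex.I * z * η j)
    = A at *
  generalize ∏ l ∈ Finset.univ.erase j, (quadPoly (signed η S l)).eval (Complex.I * z ^ 2 * η j)
    = A' at *
  generalize ∏ l ∈ Finset.univ.erase j, (quadPoly (η l)).eval (Complex.I * z * η j) = B at *
  generalize ∏ l ∈ Finset.univ.erase j, (quadPoly (η l)).eval (Complex.I * z ^ 2 * η j)
    = B' at *
  generalize ∏ l ∈ Finset.univ.erase j, ((η j : ℂ) ^ 2 - z ^ 2 * (η l : ℂ) ^ 2) = D at *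
  generalize (∏ l ∈ Finset.univ.erase j, ((η j : ℂ) + (η l : ℂ)) * ((η j : ℂ) ^ 3 - (η l : ℂ) ^ 3)
    / ((η j : ℂ) - (η l : ℂ)) ^ 2) = W at *
  generalize (quadPoly (-η j)).eval (Complex.I * z * η j) = q₁ at *
  generalize (quadPoly (η j)).eval (Complex.I * z ^ 2 * η j) = q₂ at *
  linear_combination (r * χ * I₀ * T * q₁ * A) * h2 - (r * z ^ (N + 1) * D * χ * T * q₂) * h1
    + (r * χ * I₀ * T * A * D * B') * h3

/-- `tauPoly` has real coefficients, so the relation at k_j^* is the conjugate of the one at k_j. -/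
lemma InputData.kills_tauPoly (h : InputData η E E') (ha : Aligned .zero η E) (x t : ℝ) :
    Kills η E E' x t (tauPoly η (weight .zero η E) x t) := by
  rintro ⟨j, b⟩
  have h1 := tauPoly_relation h.pos h.distinct ha j x t
  fin_cases b
  · simpa [coupling, gamma_zero, pt_zero, partner_zero] using h1
  · have h2 := congrArg (starRingEnd ℂ) h1
    have e1 : starRingEnd ℂ (Complex.I * z * η j) = pt η (j, 1) := by
      rw [← pt_zero, conj_pt]; rfl
    have e2 : starRingEnd ℂ (Complex.I * z ^ 2 * η j) = partner η (j, 1) := by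
      rw [← partner_zero, conj_partner]; rfl
    rw [map_add, map_mul, map_mul, conj_eval_tauPoly, conj_eval_tauPoly, Complex.conj_ofReal,
      e1, e2, ← h.gamma_one, map_zero] at h2
    exact h2

lemma InputData.bigPhi_eq_tauPoly (h : InputData η E E') (ha : Aligned .zero η E) {x t : ℝ}
    (hdet : (bigM (poles η) E E' x t).det ≠ 0) (hτ : hirotaTau η (weight .zero η E) x t ≠ 0) :
    bigPhi η E E' x t = C (((hirotaTau η (weight .zero η E) x t : ℝ) : ℂ)⁻¹)
      * tauPoly η (weight .zero η E) x t := by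
  have hτ' : ((hirotaTau η (weight .zero η E) x t : ℝ) : ℂ) ≠ 0 := by exact_mod_cast hτ
  refine bigPhi_unique hdet ((h.kills_tauPoly ha x t).const_mul _) ?_ fun l hl => ?_
  · rw [Polynomial.coeff_C_mul, coeff_tauPoly_top, inv_mul_cancel₀ hτ']
  · rw [Polynomial.coeff_C_mul, coeff_tauPoly_gt η _ hl, mul_zero]

end TauKills

/-! ### The determinant as a square -/

section DetSquare

variable {N : ℕ} {η : Fin N → ℝ} {E E' : Fin N → ℂ}

variable (E E') in
/-- The next-to-leading coefficient is the logarithmic derivative of a tau function. -/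
def LogDerivCoeff (η w : Fin N → ℝ) : Prop :=
  ∀ x t : ℝ, (bigM (poles η) E E' x t).det ≠ 0 → hirotaTau η w x t ≠ 0 →
    coefA (poles η) E E' (N * 2 - 1) x t
      = ((∑ j, Real.sqrt 3 * η j - 2 * (tauJet η w 1 x t / hirotaTau η w x t) : ℝ) : ℂ)

lemma sum_pt : ∑ i, pt η i = -((∑ j, Real.sqrt 3 * η j : ℝ) : ℂ) := by
  rw [Fintype.sum_prod_type, Complex.ofReal_sum, ← Finset.sum_neg_distrib]
  refine Finset.sum_congr rfl fun j _ => ?_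
  rw [Fin.sum_univ_two, pt_zero, pt_one]
  push_cast
  rw [← I_mul_z_sq_sub]
  ring

lemma InputData.logDerivCoeff_zero (hN : 1 ≤ N) (h : InputData η E E')
    (ha : Aligned .zero η E) : LogDerivCoeff E E' η (weight .zero η E) := by
  intro x t hdet hτ
  have hτ' : ((hirotaTau η (weight .zero η E) x t : ℝ) : ℂ) ≠ 0 := by exact_mod_cast hτ
  rw [← coeff_bigPhi_lt _ _ (by omega), h.bigPhi_eq_tauPoly ha hdet hτ, Polynomial.coeff_C_mul,
    coeff_tauPoly_next η _ hN]
  push_cast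
  field_simp

/-- The exponent `⊤` lies in `WithTop ℕ∞` and means real analyticity, which is what allows
`InputData.det_eq` to continue an identity across zeros. -/
lemma analyticOnNhd_det (t : ℝ) :
    AnalyticOnNhd ℝ (fun y : ℝ => (bigM (poles η) E E' y t).det) Set.univ := by
  have hline : ContDiff ℝ ⊤ fun y : ℝ => (y, t) := contDiff_id.prodMk contDiff_const
  have h1 : ContDiff ℝ ⊤ fun y : ℝ => (bigM (poles η) E E' y t).det :=
    ContDiff.comp (g := fun v : ℝ × ℝ => (bigM (poles η) E E' v.1 v.2).det)
      (f := fun y : ℝ => (y, t)) contDiff_det_bigM hline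
  exact contDiff_omega_iff_analyticOnNhd.1 h1

lemma analyticOnNhd_const_mul_hirotaTau_sq (w : Fin N → ℝ) (L : ℂ) (t : ℝ) :
    AnalyticOnNhd ℝ (fun y : ℝ => L * ((hirotaTau η w y t : ℝ) : ℂ) ^ 2) Set.univ := by
  have hline : ContDiff ℝ ⊤ fun y : ℝ => (y, t) := contDiff_id.prodMk contDiff_const
  have h1 : ContDiff ℝ ⊤ fun y : ℝ => hirotaTau η w y t :=
    ContDiff.comp (g := fun v : ℝ × ℝ => hirotaTau η w v.1 v.2) (f := fun y : ℝ => (y, t))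
      (contDiff_hirotaTau η w) hline
  have h2 : ContDiff ℝ ⊤ fun y : ℝ => ((hirotaTau η w y t : ℝ) : ℂ) :=
    Complex.ofRealCLM.contDiff.comp h1
  have h3 : ContDiff ℝ ⊤ fun y : ℝ => L * ((hirotaTau η w y t : ℝ) : ℂ) ^ 2 :=
    contDiff_const.mul (h2.pow 2)
  exact contDiff_omega_iff_analyticOnNhd.1 h3

/-- Near -∞ neither side vanishes and their logarithmic derivatives agree: the sum over the poles
cancels ∑√3η_j, leaving 2τ'/τ. The constant ratio is the limit L because τ → 1. The identity theorem
then reaches all x, including zeros of det M and τ. -/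
lemma InputData.det_eq (hN : 1 ≤ N) (h : InputData η E E') {w : Fin N → ℝ}
    (hw : LogDerivCoeff E E' η w) (x t : ℝ) :
    (bigM (poles η) E E' x t).det = detLimit η * ((hirotaTau η w x t : ℝ) : ℂ) ^ 2 := by
  obtain ⟨x₀, hx₀⟩ := eventually_atBot.1 ((eventually_det_atBot (E := E) (E' := E') h.pos
    h.distinct t).and ((tendsto_hirotaTau_atBot w h.pos t).eventually_ne one_ne_zero))
  have hder : ∀ y ∈ Set.Iio x₀, HasDerivAt (fun y => (bigM (poles η) E E' y t).det
      / ((hirotaTau η w y t : ℝ) : ℂ) ^ 2) 0 y := by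
    intro y hy
    obtain ⟨h1, h2⟩ := hx₀ y (le_of_lt hy)
    have h2' : ((hirotaTau η w y t : ℝ) : ℂ) ≠ 0 := by exact_mod_cast h2
    refine ((hasDerivAt_det_bigM hN h1).div
      ((hasDerivAt_hirotaTau η w y t).ofReal_comp.pow 2) (pow_ne_zero 2 h2')).congr_deriv ?_
    rw [hw y t h1 h2, sum_pt]
    simp only [Pi.pow_apply]
    push_cast
    field_simp
    ring
  obtain ⟨c, hc⟩ := IsOpen.exists_is_const_of_deriv_eq_zero isOpen_Iio isPreconnected_Iio
    (fun y hy => (hder y hy).differentiableAt.differentiableWithinAt)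
    (fun y hy => (hder y hy).deriv)
  have hlim : Tendsto (fun y => (bigM (poles η) E E' y t).det
      / ((hirotaTau η w y t : ℝ) : ℂ) ^ 2) atBot (𝓝 (detLimit η / (1 : ℂ) ^ 2)) := by
    refine (tendsto_det_atBot h.pos t).div (Tendsto.pow ?_ 2) (by norm_num)
    exact ((Complex.continuous_ofReal.tendsto 1).comp (tendsto_hirotaTau_atBot w h.pos t)).trans
      (by rw [Complex.ofReal_one])
  have hcL : c = detLimit η := by
    have h1 : Tendsto (fun y => (bigM (poles η) E E' y t).det
        / ((hirotaTau η w y t : ℝ) : ℂ) ^ 2) atBot (𝓝 c) :=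
      tendsto_const_nhds.congr' ((eventually_lt_atBot x₀).mono fun y hy => (hc y hy).symm)
    simpa using tendsto_nhds_unique h1 hlim
  have hev : (fun y : ℝ => (bigM (poles η) E E' y t).det) =ᶠ[𝓝 (x₀ - 1)]
      fun y : ℝ => detLimit η * ((hirotaTau η w y t : ℝ) : ℂ) ^ 2 := by
    filter_upwards [isOpen_Iio.mem_nhds (show x₀ - 1 ∈ Set.Iio x₀ by simp)] with y hy
    have h1 := hc y hy
    have h2' : ((hirotaTau η w y t : ℝ) : ℂ) ≠ 0 := by exact_mod_cast (hx₀ y (le_of_lt hy)).2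
    rw [hcL] at h1
    rw [← h1]
    field_simp
  exact congrFun ((analyticOnNhd_det t).eq_of_eventuallyEq (analyticOnNhd_const_mul_hirotaTau_sq
    w (detLimit η) t) hev) x

lemma InputData.det_ne_zero_iff (hN : 1 ≤ N) (h : InputData η E E') {w : Fin N → ℝ}
    (hw : LogDerivCoeff E E' η w) (x t : ℝ) :
    (bigM (poles η) E E' x t).det ≠ 0 ↔ hirotaTau η w x t ≠ 0 := by
  rw [h.det_eq hN hw, mul_ne_zero_iff, and_iff_right (detLimit_ne_zero h.pos h.distinct),
    pow_ne_zero_iff two_ne_zero, Complex.ofReal_ne_zero]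

lemma deriv_ofReal (f : ℝ → ℝ) (x : ℝ) :
    deriv (fun y => ((f y : ℝ) : ℂ)) x = ((deriv f x : ℝ) : ℂ) := by
  by_cases hf : DifferentiableAt ℝ f x
  · exact hf.hasDerivAt.ofReal_comp.deriv
  · have h : ¬DifferentiableAt ℝ (fun y => ((f y : ℝ) : ℂ)) x := fun h =>
      hf (Complex.reCLM.differentiableAt.comp x h)
    rw [deriv_zero_of_not_differentiableAt hf, deriv_zero_of_not_differentiableAt h,
      Complex.ofReal_zero]

lemma InputData.potQ_eq_sixLogDeriv (hN : 1 ≤ N) (h : InputData η E E') {w : Fin N → ℝ}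
    (hw : LogDerivCoeff E E' η w) {x t : ℝ} (hτ : hirotaTau η w x t ≠ 0) :
    potQ (poles η) E E' x t = ((sixLogDeriv (hirotaTau η w) x t : ℝ) : ℂ) := by
  have hev : (fun y => coefA (poles η) E E' (2 * N - 1) y t) =ᶠ[𝓝 x] fun y =>
      ((∑ j, Real.sqrt 3 * η j
        - 2 * (deriv (fun u => hirotaTau η w u t) y / hirotaTau η w y t) : ℝ) : ℂ) := by
    filter_upwards [eventually_det_ne_zero ((h.det_ne_zero_iff hN hw x t).2 hτ)] with y hy
    rw [mul_comm 2 N, hw y t hy ((h.det_ne_zero_iff hN hw y t).1 hy),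
      (hasDerivAt_hirotaTau η w y t).deriv]
  unfold potQ sixLogDeriv
  rw [hev.deriv_eq, deriv_ofReal, deriv_const_sub, deriv_const_mul_field]
  push_cast
  ring

/-! ### Sufficiency of the alignment -/

lemma jet_congr {E₁ E₁' : Fin N → ℂ} {m l : ℕ} {x t : ℝ} {f : ℝ → ℂ}
    (h : (fun y => (bigPhi η E₁ E₁' y t).coeff l) =ᶠ[𝓝 x] f) :
    jet η E₁ E₁' m l x t = iteratedDeriv m f x :=
  h.iteratedDeriv_eq m

/-- Alignment makes A_0 the constant ∏η_j², so all its x-derivatives vanish. -/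
lemma InputData.jet_constant_coeff (hN : 1 ≤ N) (h : InputData η E E')
    (ha : Aligned .zero η E) (m : ℕ) {x t : ℝ} (hdet : (bigM (poles η) E E' x t).det ≠ 0) :
    jet η E E' m 0 x t = if m = 0 then ∏ j, (η j : ℂ) ^ 2 else 0 := by
  have hw := h.logDerivCoeff_zero hN ha
  rw [jet_congr (f := fun _ => ∏ j, (η j : ℂ) ^ 2), iteratedDeriv_const]
  filter_upwards [eventually_det_ne_zero hdet] with y hy
  have hτ := (h.det_ne_zero_iff hN hw y t).1 hy
  have hτ' : ((hirotaTau η (weight .zero η E) y t : ℝ) : ℂ) ≠ 0 := by exact_mod_cast hτ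
  rw [h.bigPhi_eq_tauPoly ha hy hτ, Polynomial.coeff_C_mul, coeff_tauPoly_zero]
  field_simp

/-- At κ = 0 the polynomial identity `third_order` reduces to A_0''' + Q A_0' + P A_0 = 0, and A_0
is a nonzero constant. -/
lemma InputData.potP_eq_zero (hN : 1 ≤ N) (h : InputData η E E')
    (ha : Aligned .zero η E) {x t : ℝ} (hdet : (bigM (poles η) E E' x t).det ≠ 0) :
    potP (poles η) E E' x t = 0 := by
  have h1 := congrArg (fun Ψ => Ψ.eval 0) (third_order hN hdet)
  have h2 : ∀ m, (phiJet η E E' m x t).eval 0 = jet η E E' m 0 x t := fun m => by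
    rw [← Polynomial.coeff_zero_eq_eval_zero, coeff_phiJet]
  simp only [Polynomial.eval_add, Polynomial.eval_mul, Polynomial.eval_X, Polynomial.eval_C,
    Polynomial.eval_pow, Polynomial.eval_zero, h2, h.jet_constant_coeff hN ha _ hdet] at h1
  have h3 : ∏ j, (η j : ℂ) ^ 2 ≠ 0 := Finset.prod_ne_zero_iff.2 fun j _ =>
    pow_ne_zero 2 (by exact_mod_cast (h.pos j).ne')
  simpa [h3] using h1

lemma direction_derivative (j : Fin N) :
    direction .derivative η j = z * direction .zero η j := by
  simp only [direction]; ring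

/-- The data of the reduction `P = Q_x` come from data of the reduction `P = 0`. -/
lemma InputData.exists_zero (h : InputData η E E') :
    ∃ F F' : Fin N → ℂ, InputData η F F' ∧ weight .zero η F = weight .derivative η E ∧
      (Aligned .zero η F ↔ Aligned .derivative η E) ∧
      ∀ i x t, coupling η F F' i x t * partner η i = pt η i * coupling η E E' i x t := by
  -- The partner of k_j is z k_j, so γ must be divided by z, that is, multiplied by z². The same
  -- factor carries the direction for P = Q_x to the one for P = 0.
  obtain ⟨F, F', hF, hg⟩ := exists_inputData h.pos h.distinct (fun j => z ^ 2 * gam (poles η) E j)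
    fun j => mul_ne_zero (pow_ne_zero 2 z_ne) (h.gam_ne j)
  have hq : ∀ j, gam (poles η) F j / direction .zero η j
      = gam (poles η) E j / direction .derivative η j := by
    intro j
    have := direction_ne_zero h.pos .zero j
    have := z_ne
    rw [hg, direction_derivative, div_eq_div_iff (by assumption) (by simp [*])]
    linear_combination gam (poles η) E j * direction .zero η j * z_cube
  refine ⟨F, F', hF, ?_, ?_, ?_⟩
  · funext j
    simp only [weight, hq]
  · rw [aligned_iff_im_div h.pos, aligned_iff_im_div h.pos]
    simp only [hq]
  · rintro ⟨j, b⟩ x t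
    unfold coupling
    fin_cases b
    · simp only [Fin.zero_eta, gamma_zero, hg, pt_zero, partner_zero]
      linear_combination (gam (poles η) E j * wave (η j) x t * Complex.I * z * η j) * z_cube
    · simp only [Fin.mk_one, h.gamma_one, hF.gamma_one, hg, pt_one, partner_one, map_mul, map_pow,
        conj_z]
      linear_combination
        (-starRingEnd ℂ (gam (poles η) E j) * wave (η j) x t * Complex.I * z ^ 2 * η j) * z_cube

/-- The relation for κΨ at the new couplings is the pole times the relation for Ψ at the old ones,
and the pole is nonzero. -/
lemma Kills.of_X_mul (hp : ∀ j, 0 < η j) {F F' : Fin N → ℂ}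
    (hc : ∀ i x t, coupling η F F' i x t * partner η i = pt η i * coupling η E E' i x t)
    {x t : ℝ} {Ψ : ℂ[X]} (hk : Kills η F F' x t (X * Ψ)) : Kills η E E' x t Ψ := by
  intro i
  have h1 := hk i
  simp only [Polynomial.eval_mul, Polynomial.eval_X] at h1
  apply mul_left_cancel₀ (pt_ne_zero hp i)
  linear_combination h1 - (Ψ.eval (partner η i)) * hc i x t

/-! ### The Darboux transformation from `P = 0` to `P = Q_x`. -/

section Derivative

variable {F F' : Fin N → ℂ}

/-- If ∂³ + Q∂ annihilates ψ up to κ³ψ, then ψ' is an eigenfunction of ∂(∂² + Q) = ∂³ + Q∂ + Q_x. In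
polynomial form: (∂_x + κ)Φ has zero constant term since A_0 is constant, and its quotient by κ is
monic of degree 2N and obeys the other relations. -/
lemma InputData.coeff_bigPhi_derivative (hN : 1 ≤ N) (hp : ∀ j, 0 < η j) (hF : InputData η F F')
    (ha : Aligned .zero η F)
    (hc : ∀ i x t, coupling η F F' i x t * partner η i = pt η i * coupling η E E' i x t)
    {x t : ℝ} (hdet : (bigM (poles η) E E' x t).det ≠ 0)
    (hdet' : (bigM (poles η) F F' x t).det ≠ 0) (l : ℕ) :
    (bigPhi η E E' x t).coeff l = jet η F F' 1 (l + 1) x t + jet η F F' 0 l x t := by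
  have h0 : (covOne η F F' x t).coeff 0 = 0 := by
    simp [covOne, coeff_phiJet, hF.jet_constant_coeff hN ha 1 hdet']
  have h1 : X * (covOne η F F' x t).divX = covOne η F F' x t := by
    have := Polynomial.X_mul_divX_add (covOne η F F' x t)
    rwa [h0, map_zero, add_zero] at this
  have h2 : ∀ l, (covOne η F F' x t).divX.coeff l
      = jet η F F' 1 (l + 1) x t + jet η F F' 0 l x t := by
    intro l
    rw [Polynomial.coeff_divX, covOne, Polynomial.coeff_add, Polynomial.coeff_X_mul,
      coeff_phiJet, coeff_phiJet]
  rw [bigPhi_unique hdet (Ψ := (covOne η F F' x t).divX), h2]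
  · refine Kills.of_X_mul hp hc ?_
    rw [h1]
    exact kills_covOne hdet'
  · rw [h2, jet_zero_top, jet_gt (by omega), zero_add]
  · intro l hl
    rw [h2, jet_gt (by omega), jet_gt hl, zero_add]

lemma InputData.logDerivCoeff_derivative (hN : 1 ≤ N) (hp : ∀ j, 0 < η j)
    (hF : InputData η F F') (ha : Aligned .zero η F)
    (hc : ∀ i x t, coupling η F F' i x t * partner η i = pt η i * coupling η E E' i x t) :
    LogDerivCoeff E E' η (weight .zero η F) := by
  intro x t hdet hτ
  have hw := hF.logDerivCoeff_zero hN ha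
  have hdet' := (hF.det_ne_zero_iff hN hw x t).2 hτ
  rw [← coeff_bigPhi_lt _ _ (by omega), hF.coeff_bigPhi_derivative hN hp ha hc hdet hdet',
    show N * 2 - 1 + 1 = N * 2 by omega, jet_top, zero_add, jet_eq_of_lt (by omega),
    iteratedDeriv_zero]
  exact hw x t hdet' hτ

/-- The transformation keeps A_{2N-1} and adds A_{2N-1}' to A_{2N-2}, which changes P by
-3A_{2N-1}'' = Q_x. -/
lemma InputData.potP_eq_deriv_potQ (hN : 1 ≤ N) (h : InputData η E E')
    (hF : InputData η F F') (ha : Aligned .zero η F)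
    (hc : ∀ i x t, coupling η F F' i x t * partner η i = pt η i * coupling η E E' i x t)
    {x t : ℝ} (hdet : (bigM (poles η) E E' x t).det ≠ 0) :
    potP (poles η) E E' x t = deriv (fun y => potQ (poles η) E E' y t) x := by
  have hw := hF.logDerivCoeff_zero hN ha
  have hw' := hF.logDerivCoeff_derivative (E := E) (E' := E') hN h.pos ha hc
  have hiff : ∀ y, (bigM (poles η) E E' y t).det ≠ 0 → (bigM (poles η) F F' y t).det ≠ 0 :=
    fun y hy => (hF.det_ne_zero_iff hN hw y t).2 ((h.det_ne_zero_iff hN hw' y t).1 hy)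
  have h1 : ∀ m, jet η E E' m (N * 2 - 1) x t = jet η F F' m (N * 2 - 1) x t := by
    intro m
    refine jet_congr ?_
    filter_upwards [eventually_det_ne_zero hdet] with y hy
    rw [hF.coeff_bigPhi_derivative hN h.pos ha hc hy (hiff y hy),
      show N * 2 - 1 + 1 = N * 2 by omega, jet_top, zero_add]
    simp [jet]
  have h2 : jet η E E' 1 (N * 2 - 2) x t
      = jet η F F' 2 (N * 2 - 1) x t + jet η F F' 1 (N * 2 - 2) x t := by
    rw [jet_congr (f := fun y => jet η F F' 1 (N * 2 - 1) y t + jet η F F' 0 (N * 2 - 2) y t),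
      iteratedDeriv_one]
    · exact ((hasDerivAt_jet (hiff x hdet) 1 _).add (hasDerivAt_jet (hiff x hdet) 0 _)).deriv
    · filter_upwards [eventually_det_ne_zero hdet] with y hy
      rw [hF.coeff_bigPhi_derivative hN h.pos ha hc hy (hiff y hy),
        show N * 2 - 2 + 1 = N * 2 - 1 by omega]
  have h3 : deriv (fun y => potQ (poles η) E E' y t) x = -3 * jet η E E' 2 (N * 2 - 1) x t := by
    simp only [potQ_eq hN]
    exact ((hasDerivAt_jet hdet 1 _).const_mul _).deriv
  have h4 := hF.potP_eq_zero hN ha (hiff x hdet)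
  rw [potP_eq hN] at h4
  rw [potP_eq hN, h3, h1, h1, h1, h2]
  linear_combination h4

end Derivative

end DetSquare

/-! ### The Sawada–Kotera equation -/

section MixedPartials

lemma hasDerivAt_clm_apply {G : ℝ → ℝ × ℝ →L[ℝ] ℂ} {G' : ℝ × ℝ →L[ℝ] ℂ} {t : ℝ}
    (h : HasDerivAt G G' t) (v : ℝ × ℝ) : HasDerivAt (fun s => G s v) (G' v) t :=
  (ContinuousLinearMap.apply ℝ ℂ v).hasFDerivAt.comp_hasDerivAt t h

/-- Symmetry of the second derivative, written with iterated one-variable derivatives; it lets Q_t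
be computed from the evolution of A_{2N-1}. -/
lemma deriv_deriv_comm {f : ℝ × ℝ → ℂ} {x t : ℝ} (hf : ContDiffAt ℝ 2 f (x, t)) :
    deriv (fun s => deriv (fun y => f (y, s)) x) t
      = deriv (fun y => deriv (fun s => f (y, s)) t) x := by
  have hd : ∀ᶠ v in 𝓝 (x, t), DifferentiableAt ℝ f v :=
    (hf.eventually (by simp)).mono fun v hv => hv.differentiableAt (by norm_num)
  have hf1 : DifferentiableAt ℝ (fderiv ℝ f) (x, t) :=
    (hf.fderiv_right (m := 1) (by norm_num)).differentiableAt (by norm_num)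
  have line1 : ∀ y s : ℝ, HasDerivAt (fun y : ℝ => (y, s)) ((1 : ℝ), (0 : ℝ)) y := fun y s =>
    (hasDerivAt_id y).prodMk (hasDerivAt_const y s)
  have line2 : ∀ y s : ℝ, HasDerivAt (fun s : ℝ => (y, s)) ((0 : ℝ), (1 : ℝ)) s := fun y s =>
    (hasDerivAt_const s y).prodMk (hasDerivAt_id s)
  have h1 : (fun s => deriv (fun y => f (y, s)) x) =ᶠ[𝓝 t] fun s => fderiv ℝ f (x, s) (1, 0) := by
    filter_upwards [(line2 x t).continuousAt.eventually hd] with s hs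
    exact (hs.hasFDerivAt.comp_hasDerivAt x (line1 x s)).deriv
  have h2 : (fun y => deriv (fun s => f (y, s)) t) =ᶠ[𝓝 x] fun y => fderiv ℝ f (y, t) (0, 1) := by
    filter_upwards [(line1 x t).continuousAt.eventually hd] with y hy
    exact (hy.hasFDerivAt.comp_hasDerivAt t (line2 y t)).deriv
  have h3 := hasDerivAt_clm_apply (hf1.hasFDerivAt.comp_hasDerivAt t (line2 x t)) (1, 0)
  have h4 := hasDerivAt_clm_apply (hf1.hasFDerivAt.comp_hasDerivAt x (line1 x t)) (0, 1)
  have hs := hf.isSymmSndFDerivAt (by simp)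
  rw [h1.deriv_eq, h2.deriv_eq]
  exact (h3.deriv.trans (hs.eq _ _)).trans h4.deriv.symm

lemma iteratedDeriv_ofReal (f : ℝ → ℝ) (m : ℕ) (x : ℝ) :
    iteratedDeriv m (fun y => ((f y : ℝ) : ℂ)) x = ((iteratedDeriv m f x : ℝ) : ℂ) := by
  induction m generalizing x with
  | zero => simp
  | succ m ih =>
    rw [iteratedDeriv_succ, iteratedDeriv_succ, funext ih, deriv_ofReal]

end MixedPartials

section SawadaKotera

variable {N : ℕ} {η : Fin N → ℝ} {E E' : Fin N → ℂ}

variable (η E E') in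
/-- The `m`-th `x`-derivative of the coefficient of `κ^{2N-5+k}`. -/
def expCoeff (m k : ℕ) (x t : ℝ) : ℂ := (X ^ 5 * phiJet η E E' m x t).coeff (N * 2 + k)

lemma expCoeff_gt (m : ℕ) {k : ℕ} (hk : 5 < k) (x t : ℝ) : expCoeff η E E' m k x t = 0 := by
  unfold expCoeff
  rw [Polynomial.coeff_X_pow_mul', if_pos (by omega), coeff_phiJet, jet_gt (by omega)]

lemma expCoeff_top (m : ℕ) (x t : ℝ) : expCoeff η E E' (m + 1) 5 x t = 0 := by
  unfold expCoeff
  rw [Polynomial.coeff_X_pow_mul, coeff_phiJet, jet_top]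

lemma expCoeff_zero_top (x t : ℝ) : expCoeff η E E' 0 5 x t = 1 := by
  unfold expCoeff
  rw [Polynomial.coeff_X_pow_mul, coeff_phiJet, jet_zero_top]

lemma expCoeff_four (hN : 1 ≤ N) (m : ℕ) (x t : ℝ) :
    expCoeff η E E' m 4 x t = jet η E E' m (N * 2 - 1) x t := by
  unfold expCoeff
  rw [show N * 2 + 4 = (N * 2 - 1) + 5 by omega, Polynomial.coeff_X_pow_mul, coeff_phiJet]

lemma hasDerivAt_expCoeff {x t : ℝ} (hdet : (bigM (poles η) E E' x t).det ≠ 0) (m k : ℕ) :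
    HasDerivAt (fun y => expCoeff η E E' m k y t) (expCoeff η E E' (m + 1) k x t) x := by
  unfold expCoeff
  simp only [Polynomial.coeff_X_pow_mul', coeff_phiJet]
  split_ifs
  · exact hasDerivAt_jet hdet m _
  · exact hasDerivAt_const _ _

lemma coeff_shift (Ψ : ℂ[X]) (n d : ℕ) :
    (X ^ 5 * (X ^ n * Ψ)).coeff (d + n) = (X ^ 5 * Ψ).coeff d := by
  rw [← mul_assoc, mul_comm (X ^ 5), mul_assoc, Polynomial.coeff_X_pow_mul]

/-- The recurrence relations between the coefficients when `P = 0`. -/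
lemma InputData.recurrence (hN : 1 ≤ N) (h : InputData η E E') (ha : Aligned .zero η E)
    {x t : ℝ} (hdet : (bigM (poles η) E E' x t).det ≠ 0) (k : ℕ) :
    3 * expCoeff η E E' 1 k x t + 3 * expCoeff η E E' 2 (k + 1) x t + expCoeff η E E' 3 (k + 2) x t
      + -3 * expCoeff η E E' 1 4 x t * (expCoeff η E E' 1 (k + 2) x t
        + expCoeff η E E' 0 (k + 1) x t) = 0 := by
  have h1 := third_order hN hdet
  rw [h.potP_eq_zero hN ha hdet, potQ_eq hN, ← expCoeff_four hN] at h1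
  have h2 : C 3 * (X ^ 5 * (X ^ 2 * phiJet η E E' 1 x t))
      + C 3 * (X ^ 5 * (X ^ 1 * phiJet η E E' 2 x t)) + X ^ 5 * phiJet η E E' 3 x t
      + C (-3 * expCoeff η E E' 1 4 x t) * (X ^ 5 * phiJet η E E' 1 x t
        + X ^ 5 * (X ^ 1 * phiJet η E E' 0 x t)) = 0 := by
    rw [map_zero] at h1
    linear_combination X ^ 5 * h1
  have h3 := congrArg (fun Ψ => Ψ.coeff (N * 2 + k + 2)) h2
  simp only [Polynomial.coeff_add, Polynomial.coeff_C_mul, Polynomial.coeff_zero] at h3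
  rw [coeff_shift, show N * 2 + k + 2 = (N * 2 + (k + 1)) + 1 by ring, coeff_shift, coeff_shift]
    at h3
  exact h3

/-- The recurrence holds on a neighbourhood of x, so it may be differentiated. Its successive
derivatives are needed to eliminate the lower coefficients from the time evolution. -/
lemma InputData.recurrence_deriv (hN : 1 ≤ N) (h : InputData η E E') (ha : Aligned .zero η E)
    {x t : ℝ} (hdet : (bigM (poles η) E E' x t).det ≠ 0) (k : ℕ) :
    3 * expCoeff η E E' 2 k x t + 3 * expCoeff η E E' 3 (k + 1) x t + expCoeff η E E' 4 (k + 2) x t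
      + (-3 * expCoeff η E E' 2 4 x t * (expCoeff η E E' 1 (k + 2) x t
        + expCoeff η E E' 0 (k + 1) x t)
      + -3 * expCoeff η E E' 1 4 x t * (expCoeff η E E' 2 (k + 2) x t
        + expCoeff η E E' 1 (k + 1) x t)) = 0 := by
  have D := fun m k => hasDerivAt_expCoeff hdet m k
  have h1 := ((((D 1 k).const_mul 3).add ((D 2 (k + 1)).const_mul 3)).add (D 3 (k + 2))).add
    (((D 1 4).const_mul (-3)).mul ((D 1 (k + 2)).add (D 0 (k + 1))))
  refine h1.unique ((hasDerivAt_const x (0 : ℂ)).congr_of_eventuallyEq ?_)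
  filter_upwards [eventually_det_ne_zero hdet] with y hy using h.recurrence hN ha hy k

lemma InputData.recurrence_deriv_two (hN : 1 ≤ N) (h : InputData η E E')
    (ha : Aligned .zero η E) {x t : ℝ} (hdet : (bigM (poles η) E E' x t).det ≠ 0) (k : ℕ) :
    3 * expCoeff η E E' 3 k x t + 3 * expCoeff η E E' 4 (k + 1) x t + expCoeff η E E' 5 (k + 2) x t
      + ((-3 * expCoeff η E E' 3 4 x t * (expCoeff η E E' 1 (k + 2) x t
        + expCoeff η E E' 0 (k + 1) x t)
      + -3 * expCoeff η E E' 2 4 x t * (expCoeff η E E' 2 (k + 2) x t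
        + expCoeff η E E' 1 (k + 1) x t))
      + (-3 * expCoeff η E E' 2 4 x t * (expCoeff η E E' 2 (k + 2) x t
        + expCoeff η E E' 1 (k + 1) x t)
      + -3 * expCoeff η E E' 1 4 x t * (expCoeff η E E' 3 (k + 2) x t
        + expCoeff η E E' 2 (k + 1) x t))) = 0 := by
  have D := fun m k => hasDerivAt_expCoeff hdet m k
  have h1 := ((((D 2 k).const_mul 3).add ((D 3 (k + 1)).const_mul 3)).add (D 4 (k + 2))).add
    ((((D 2 4).const_mul (-3)).mul ((D 1 (k + 2)).add (D 0 (k + 1)))).add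
      (((D 1 4).const_mul (-3)).mul ((D 2 (k + 2)).add (D 1 (k + 1)))))
  refine h1.unique ((hasDerivAt_const x (0 : ℂ)).congr_of_eventuallyEq ?_)
  filter_upwards [eventually_det_ne_zero hdet] with y hy using h.recurrence_deriv hN ha hy k

lemma InputData.recurrence_deriv_three (hN : 1 ≤ N) (h : InputData η E E')
    (ha : Aligned .zero η E) {x t : ℝ} (hdet : (bigM (poles η) E E' x t).det ≠ 0) :
    3 * expCoeff η E E' 4 3 x t + 3 * expCoeff η E E' 5 4 x t
      + (-3 * expCoeff η E E' 4 4 x t * expCoeff η E E' 0 4 x t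
      + 3 * (-3 * expCoeff η E E' 3 4 x t * expCoeff η E E' 1 4 x t)
      + 3 * (-3 * expCoeff η E E' 2 4 x t * expCoeff η E E' 2 4 x t)
      + -3 * expCoeff η E E' 1 4 x t * expCoeff η E E' 3 4 x t) = 0 := by
  have D := fun m k => hasDerivAt_expCoeff hdet m k
  have h1 := (((D 3 3).const_mul 3).add ((D 4 4).const_mul 3)).add
    (((((D 3 4).const_mul (-3)).mul (D 0 4)).add
      ((((D 2 4).const_mul (-3)).mul (D 1 4)).const_mul 2)).add
      (((D 1 4).const_mul (-3)).mul (D 2 4)))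
  have h2 := h1.unique ((hasDerivAt_const x (0 : ℂ)).congr_of_eventuallyEq (by
    filter_upwards [eventually_det_ne_zero hdet] with y hy
    have h3 := h.recurrence_deriv_two hN ha hy 3
    simp only [Nat.reduceAdd, expCoeff_top] at h3
    simp only [Pi.add_apply, Pi.mul_apply]
    linear_combination h3))
  linear_combination h2

variable (η E E') in
/-- The `t`-derivative of the monic polynomial. -/
def phiTime (x t : ℝ) : ℂ[X] := ∑ l ∈ Finset.range (N * 2),
  C (deriv (fun s => coefA (poles η) E E' l x s) t) * X ^ l

lemma coeff_phiTime {l : ℕ} (hl : l < N * 2) (x t : ℝ) :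
    (phiTime η E E' x t).coeff l = deriv (fun s => coefA (poles η) E E' l x s) t := by
  simp [phiTime]
  omega

lemma coeff_phiTime_ge {l : ℕ} (hl : N * 2 ≤ l) (x t : ℝ) :
    (phiTime η E E' x t).coeff l = 0 := by
  simp [phiTime]
  omega

lemma hasDerivAt_eval_bigPhi_time {x t : ℝ} (hdet : (bigM (poles η) E E' x t).det ≠ 0) (κ : ℂ) :
    HasDerivAt (fun s => (bigPhi η E E' x s).eval κ) ((phiTime η E E' x t).eval κ) t := by
  simp only [bigPhi, phiTime, Polynomial.eval_add, Polynomial.eval_finsetSum,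
    Polynomial.eval_mul, Polynomial.eval_C, Polynomial.eval_pow, Polynomial.eval_X]
  refine (HasDerivAt.fun_sum fun l _ => ?_).const_add _
  have h1 : ContDiffAt ℝ 1 (fun s => coefA (poles η) E E' l x s) t :=
    ContDiffAt.comp (g := fun v : ℝ × ℝ => coefA (poles η) E E' l v.1 v.2)
      (f := fun s : ℝ => (x, s)) t (contDiffAt_coefA l hdet)
      (contDiff_const.prodMk contDiff_id).contDiffAt
  exact (h1.differentiableAt (by norm_num)).hasDerivAt.mul_const _

/-- The time evolution of the coefficients when `P = 0`. -/
lemma InputData.time_evolution (hN : 1 ≤ N) (h : InputData η E E') (ha : Aligned .zero η E)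
    {x t : ℝ} (hdet : (bigM (poles η) E E' x t).det ≠ 0) :
    deriv (fun s => coefA (poles η) E E' (N * 2 - 1) x s) t
      = 1 / 3 * (-3 * expCoeff η E E' 5 4 x t
        + 5 * (-3 * expCoeff η E E' 1 4 x t) * (-3 * expCoeff η E E' 3 4 x t)
        + 5 / 3 * (-3 * expCoeff η E E' 1 4 x t) ^ 3) := by
  set q₀ : ℂ := -3 * expCoeff η E E' 1 4 x t with hq₀
  set q₁ : ℂ := -3 * expCoeff η E E' 2 4 x t with hq₁
  set q₂ : ℂ := -3 * expCoeff η E E' 3 4 x t with hq₂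
  have hk0 : Kills η E E' x t (phiTime η E E' x t + C 9 * X ^ 5 * bigPhi η E E' x t) :=
    Kills.hasDerivAt_time (Ψ := fun s => bigPhi η E E' x s) (hasDerivAt_eval_bigPhi_time hdet)
      ((eventually_det_ne_zero_time hdet).mono fun _ h => kills_bigPhi h)
  -- The bracket is 9∂⁵ + 15Q∂³ + 15Q_x∂² + (10Q_xx + 5Q²)∂ reduced modulo ∂³ + Q∂ = κ³, where q₀,
  -- q₁, q₂ stand for Q, Q_x, Q_xx. It involves only ∂_x + κ and κ³, so it preserves the linear
  -- relations.
  have hk : Kills η E E' x t (phiTime η E E' x t + C 9 * X ^ 5 * bigPhi η E E' x t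
      - (C 9 * (X ^ 3 * covTwo η E E' x t) - C (3 * q₁) * covTwo η E E' x t
        + C (q₂ - q₀ ^ 2) * covOne η E E' x t
        + C (6 * q₀) * (X ^ 3 * phiJet η E E' 0 x t))) :=
    hk0.sub ((((((kills_covTwo hdet).cube_mul).const_mul _).sub
      ((kills_covTwo hdet).const_mul _)).add ((kills_covOne hdet).const_mul _)).add
      (((kills_phiJet_zero hdet).cube_mul).const_mul _))
  set T := phiTime η E E' x t + C 9 * X ^ 5 * bigPhi η E E' x t
      - (C 9 * (X ^ 3 * covTwo η E E' x t) - C (3 * q₁) * covTwo η E E' x t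
        + C (q₂ - q₀ ^ 2) * covOne η E E' x t
        + C (6 * q₀) * (X ^ 3 * phiJet η E E' 0 x t)) with hT
  -- Multiplication by X⁵ shifts the coefficients of index 2N - 4 and 2N - 5, which may be negative
  -- for small N, to natural indices.
  have hX : X ^ 5 * T = X ^ 5 * phiTime η E E' x t
      - C 18 * (X ^ 5 * (X ^ 4 * phiJet η E E' 1 x t))
      - C 9 * (X ^ 5 * (X ^ 3 * phiJet η E E' 2 x t))
      + C (3 * q₁) * (X ^ 5 * phiJet η E E' 2 x t)
      + C (3 * q₁) * (C 2 * (X ^ 5 * (X ^ 1 * phiJet η E E' 1 x t)))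
      + C (3 * q₁) * (X ^ 5 * (X ^ 2 * phiJet η E E' 0 x t))
      - C (q₂ - q₀ ^ 2) * (X ^ 5 * phiJet η E E' 1 x t)
      - C (q₂ - q₀ ^ 2) * (X ^ 5 * (X ^ 1 * phiJet η E E' 0 x t))
      - C (6 * q₀) * (X ^ 5 * (X ^ 3 * phiJet η E E' 0 x t)) := by
    rw [hT, ← phiJet_zero, covTwo, covOne, show (C 9 : ℂ[X]) = 9 from map_ofNat C 9,
      show (C 18 : ℂ[X]) = 18 from map_ofNat C 18, show (C 2 : ℂ[X]) = 2 from map_ofNat C 2]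
    ring
  have hcoeff : ∀ j, (X ^ 5 * T).coeff (N * 2 + (j + 4))
      = (X ^ 5 * phiTime η E E' x t).coeff (N * 2 + (j + 4))
      - 18 * expCoeff η E E' 1 j x t - 9 * expCoeff η E E' 2 (j + 1) x t
      + 3 * q₁ * (expCoeff η E E' 2 (j + 4) x t + 2 * expCoeff η E E' 1 (j + 3) x t
        + expCoeff η E E' 0 (j + 2) x t)
      - (q₂ - q₀ ^ 2) * (expCoeff η E E' 1 (j + 4) x t + expCoeff η E E' 0 (j + 3) x t)
      - 6 * q₀ * expCoeff η E E' 0 (j + 1) x t := by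
    intro j
    rw [hX]
    simp only [Polynomial.coeff_add, Polynomial.coeff_sub, Polynomial.coeff_C_mul]
    have e4 : ∀ m, (X ^ 5 * (X ^ 4 * phiJet η E E' m x t)).coeff (N * 2 + (j + 4))
        = expCoeff η E E' m j x t := fun m => coeff_shift _ 4 (N * 2 + j)
    have e3 : ∀ m, (X ^ 5 * (X ^ 3 * phiJet η E E' m x t)).coeff (N * 2 + (j + 4))
        = expCoeff η E E' m (j + 1) x t := fun m => coeff_shift _ 3 (N * 2 + (j + 1))
    have e2 : ∀ m, (X ^ 5 * (X ^ 2 * phiJet η E E' m x t)).coeff (N * 2 + (j + 4))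
        = expCoeff η E E' m (j + 2) x t := fun m => coeff_shift _ 2 (N * 2 + (j + 2))
    have e1 : ∀ m, (X ^ 5 * (X ^ 1 * phiJet η E E' m x t)).coeff (N * 2 + (j + 4))
        = expCoeff η E E' m (j + 3) x t := fun m => coeff_shift _ 1 (N * 2 + (j + 3))
    have e0 : ∀ m, (X ^ 5 * phiJet η E E' m x t).coeff (N * 2 + (j + 4))
        = expCoeff η E E' m (j + 4) x t := fun m => rfl
    simp only [e4, e3, e2, e1, e0]
    ring
  have top0 := expCoeff_zero_top (η := η) (E := E) (E' := E') x t
  have top := fun m => expCoeff_top (η := η) (E := E) (E' := E') m x t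
  have r3 := h.recurrence hN ha hdet 3
  have r2 := h.recurrence hN ha hdet 2
  have r1 := h.recurrence hN ha hdet 1
  have r0 := h.recurrence hN ha hdet 0
  have r3' := h.recurrence_deriv hN ha hdet 3
  have r2' := h.recurrence_deriv hN ha hdet 2
  have r1' := h.recurrence_deriv hN ha hdet 1
  have r3'' := h.recurrence_deriv_two hN ha hdet 3
  have r2'' := h.recurrence_deriv_two hN ha hdet 2
  have r3''' := h.recurrence_deriv_three hN ha hdet
  simp only [Nat.reduceAdd, zero_add, top 0, top 1, top 2, top 3, top 4, ← hq₀, ← hq₁,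
    ← hq₂, add_zero] at r3 r2 r1 r0 r3' r2' r1' r3'' r2'' r3'''
  have c41 : expCoeff η E E' 1 4 x t = -1 / 3 * q₀ := by rw [hq₀]; ring
  have c42 : expCoeff η E E' 2 4 x t = -1 / 3 * q₁ := by rw [hq₁]; ring
  have c43 : expCoeff η E E' 3 4 x t = -1 / 3 * q₂ := by rw [hq₂]; ring
  -- The solved recurrences `pmk` express the m-th derivative of the coefficient of κ^{2N-5+k} by
  -- coefficients of larger index, until only derivatives of A_{2N-1} and undifferentiated
  -- coefficients remain.
  have p13 : expCoeff η E E' 1 3 x t = -expCoeff η E E' 2 4 x t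
      - q₀ * expCoeff η E E' 0 4 x t / 3 := by linear_combination r3 / 3
  have p12 : expCoeff η E E' 1 2 x t = -expCoeff η E E' 2 3 x t - expCoeff η E E' 3 4 x t / 3
      - q₀ * (expCoeff η E E' 1 4 x t + expCoeff η E E' 0 3 x t) / 3 := by
    linear_combination r2 / 3
  have p11 : expCoeff η E E' 1 1 x t = -expCoeff η E E' 2 2 x t - expCoeff η E E' 3 3 x t / 3
      - q₀ * (expCoeff η E E' 1 3 x t + expCoeff η E E' 0 2 x t) / 3 := by
    linear_combination r1 / 3
  have p10 : expCoeff η E E' 1 0 x t = -expCoeff η E E' 2 1 x t - expCoeff η E E' 3 2 x t / 3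
      - q₀ * (expCoeff η E E' 1 2 x t + expCoeff η E E' 0 1 x t) / 3 := by
    linear_combination r0 / 3
  have p23 : expCoeff η E E' 2 3 x t = -expCoeff η E E' 3 4 x t
      - (q₁ * expCoeff η E E' 0 4 x t + q₀ * expCoeff η E E' 1 4 x t) / 3 := by
    linear_combination r3' / 3
  have p22 : expCoeff η E E' 2 2 x t = -expCoeff η E E' 3 3 x t - expCoeff η E E' 4 4 x t / 3
      - (q₁ * (expCoeff η E E' 1 4 x t + expCoeff η E E' 0 3 x t)
        + q₀ * (expCoeff η E E' 2 4 x t + expCoeff η E E' 1 3 x t)) / 3 := by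
    linear_combination r2' / 3
  have p21 : expCoeff η E E' 2 1 x t = -expCoeff η E E' 3 2 x t - expCoeff η E E' 4 3 x t / 3
      - (q₁ * (expCoeff η E E' 1 3 x t + expCoeff η E E' 0 2 x t)
        + q₀ * (expCoeff η E E' 2 3 x t + expCoeff η E E' 1 2 x t)) / 3 := by
    linear_combination r1' / 3
  have p33 : expCoeff η E E' 3 3 x t = -expCoeff η E E' 4 4 x t
      - (q₂ * expCoeff η E E' 0 4 x t + 2 * q₁ * expCoeff η E E' 1 4 x t
        + q₀ * expCoeff η E E' 2 4 x t) / 3 := by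
    linear_combination r3'' / 3
  have p32 : expCoeff η E E' 3 2 x t = -expCoeff η E E' 4 3 x t - expCoeff η E E' 5 4 x t / 3
      - (q₂ * (expCoeff η E E' 1 4 x t + expCoeff η E E' 0 3 x t)
        + 2 * q₁ * (expCoeff η E E' 2 4 x t + expCoeff η E E' 1 3 x t)
        + q₀ * (expCoeff η E E' 3 4 x t + expCoeff η E E' 2 3 x t)) / 3 := by
    linear_combination r2'' / 3
  have p43 : expCoeff η E E' 4 3 x t = -expCoeff η E E' 5 4 x t
      - (-3 * expCoeff η E E' 4 4 x t * expCoeff η E E' 0 4 x t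
        + 3 * q₂ * expCoeff η E E' 1 4 x t + 3 * q₁ * expCoeff η E E' 2 4 x t
        + q₀ * expCoeff η E E' 3 4 x t) / 3 := by
    linear_combination r3''' / 3
  -- Only the degrees 2N to 2N + 3 need the recurrences or the known top coefficients; beyond them
  -- every contribution is zero.
  have hzero : T = 0 := by
    refine hk.eq_zero hdet fun l hl => ?_
    obtain ⟨j, rfl⟩ : ∃ j, l = N * 2 + j := ⟨l - N * 2, by omega⟩
    have h1 := hcoeff (j + 1)
    have e5 : ∀ Ψ : ℂ[X], (X ^ 5 * Ψ).coeff (N * 2 + (j + 1 + 4)) = Ψ.coeff (N * 2 + j) :=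
      fun Ψ => Polynomial.coeff_X_pow_mul Ψ 5 (N * 2 + j)
    rw [e5, e5, coeff_phiTime_ge (by omega)] at h1
    rw [h1]
    rcases Nat.lt_or_ge 3 j with hj | hj
    · rcases eq_or_lt_of_le (Nat.succ_le_of_lt hj) with rfl | hj
      · simp only [Nat.succ_eq_add_one, Nat.reduceAdd, top]
        simp [expCoeff_gt _ (show 5 < 6 by omega), expCoeff_gt _ (show 5 < 7 by omega),
          expCoeff_gt _ (show 5 < 8 by omega), expCoeff_gt _ (show 5 < 9 by omega)]
      · simp [expCoeff_gt _ (show 5 < j + 1 by omega), expCoeff_gt _ (show 5 < j + 1 + 1 by omega),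
          expCoeff_gt _ (show 5 < j + 1 + 2 by omega), expCoeff_gt _ (show 5 < j + 1 + 3 by omega),
          expCoeff_gt _ (show 5 < j + 1 + 4 by omega)]
    · have g6 := fun m => expCoeff_gt (η := η) (E := E) (E' := E') m (show 5 < 6 by omega) x t
      have g7 := fun m => expCoeff_gt (η := η) (E := E) (E' := E') m (show 5 < 7 by omega) x t
      have g8 := fun m => expCoeff_gt (η := η) (E := E) (E' := E') m (show 5 < 8 by omega) x t
      interval_cases j
      · simp only [Nat.reduceAdd, zero_add, top]
        simp only [p11, p13, p22, p33, c41, c42]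
        ring
      · simp only [Nat.reduceAdd, top0, top, g6]
        simp only [p12, p23, c41, c43]
        ring
      · simp only [Nat.reduceAdd, top0, g6, g7]
        simp only [p13, c42]
        ring
      · simp only [Nat.reduceAdd, top0, top, g6, g7, g8]
        simp only [c41]
        ring
  -- The index 0 is the coefficient of κ^{2N-1} in T = 0, the one that contains the t-derivative of
  -- A_{2N-1}.
  have h1 := hcoeff 0
  have h2 : (X ^ 5 * phiTime η E E' x t).coeff (N * 2 + (0 + 4))
      = deriv (fun s => coefA (poles η) E E' (N * 2 - 1) x s) t := by
    rw [show N * 2 + (0 + 4) = (N * 2 - 1) + 5 by omega, Polynomial.coeff_X_pow_mul,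
      coeff_phiTime (by omega)]
  rw [hzero, h2, mul_zero, Polynomial.coeff_zero] at h1
  simp only [zero_add, p10, p12, p13, p21, p23, p32, p43, c41, c42, c43] at h1
  linear_combination -h1

lemma contDiffAt_sixLogDeriv {w : Fin N → ℝ} {x t : ℝ} (hτ : hirotaTau η w x t ≠ 0)
    {n : WithTop ℕ∞} :
    ContDiffAt ℝ n (fun p : ℝ × ℝ => sixLogDeriv (hirotaTau η w) p.1 p.2) (x, t) := by
  have hev : (fun p : ℝ × ℝ => sixLogDeriv (hirotaTau η w) p.1 p.2) =ᶠ[𝓝 (x, t)] fun p =>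
      6 * ((tauJet η w 2 p.1 p.2 * hirotaTau η w p.1 p.2
        - tauJet η w 1 p.1 p.2 * tauJet η w 1 p.1 p.2) / hirotaTau η w p.1 p.2 ^ 2) := by
    filter_upwards [((contDiff_hirotaTau η w (n := 0)).continuous.continuousAt).eventually_ne hτ]
      with p hp
    unfold sixLogDeriv
    simp only [(hasDerivAt_hirotaTau η w _ _).deriv]
    rw [((hasDerivAt_tauJet η w 1 p.1 p.2).fun_div (hasDerivAt_hirotaTau η w p.1 p.2) hp).deriv]
  refine ContDiffAt.congr_of_eventuallyEq ?_ hev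
  have h0 := (contDiff_hirotaTau η w (n := n)).contDiffAt (x := (x, t))
  have h1 := (contDiff_tauJet η w (n := n) 1).contDiffAt (x := (x, t))
  have h2 := (contDiff_tauJet η w (n := n) 2).contDiffAt (x := (x, t))
  exact contDiffAt_const.mul (((h2.mul h0).sub (h1.mul h1)).div (h0.pow 2) (pow_ne_zero 2 hτ))

/-- Since Q = -3A_{2N-1}', the x-derivative of `InputData.time_evolution` times -3 is Q_t = -(Q_xxxx
+ 5QQ_xx + (5/3)Q³)_x, the stated equation. -/
lemma InputData.solvesSawadaKotera (hN : 1 ≤ N) (h : InputData η E E')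
    (ha : Aligned .zero η E) {x t : ℝ} (hτ : hirotaTau η (weight .zero η E) x t ≠ 0) :
    SolvesSawadaKotera (sixLogDeriv (hirotaTau η (weight .zero η E))) x t := by
  refine ⟨contDiffAt_sixLogDeriv hτ, ?_⟩
  have hw := h.logDerivCoeff_zero hN ha
  have hiff := h.det_ne_zero_iff hN hw
  have hdet := (hiff x t).2 hτ
  set q := sixLogDeriv (hirotaTau η (weight .zero η E)) with hq
  have hQ : ∀ y s, (bigM (poles η) E E' y s).det ≠ 0 →
      ((q y s : ℝ) : ℂ) = -3 * jet η E E' 1 (N * 2 - 1) y s := fun y s hy => by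
    rw [hq, ← h.potQ_eq_sixLogDeriv hN hw ((hiff y s).1 hy), potQ_eq hN]
  have hx : ∀ m, ((iteratedDeriv m (fun y => q y t) x : ℝ) : ℂ)
      = -3 * expCoeff η E E' (m + 1) 4 x t := by
    intro m
    have hev : ∀ m, iteratedDeriv m (fun y => ((q y t : ℝ) : ℂ)) =ᶠ[𝓝 x]
        fun y => -3 * expCoeff η E E' (m + 1) 4 y t := by
      intro m
      induction m with
      | zero =>
        filter_upwards [eventually_det_ne_zero hdet] with y hy
        rw [iteratedDeriv_zero, expCoeff_four hN, hQ y t hy]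
      | succ m ih =>
        rw [iteratedDeriv_succ]
        filter_upwards [eventually_det_ne_zero hdet, ih.eventuallyEq_nhds] with y hy hi
        rw [hi.deriv_eq]
        exact ((hasDerivAt_expCoeff hy (m + 1) 4).const_mul (-3)).deriv
    rw [← iteratedDeriv_ofReal, (hev m).self_of_nhds]
  have ht : ((deriv (fun s => q x s) t : ℝ) : ℂ)
      = -3 * deriv (fun y => deriv (fun s => coefA (poles η) E E' (N * 2 - 1) y s) t) x := by
    rw [← deriv_ofReal]
    have hev : (fun s => ((q x s : ℝ) : ℂ)) =ᶠ[𝓝 t] fun s =>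
        -3 * deriv (fun y => coefA (poles η) E E' (N * 2 - 1) y s) x := by
      filter_upwards [eventually_det_ne_zero_time hdet] with s hs
      rw [hQ x s hs, jet_eq_of_lt (by omega), iteratedDeriv_one]
    rw [hev.deriv_eq, deriv_const_mul_field]
    congr 1
    exact deriv_deriv_comm (f := fun v : ℝ × ℝ => coefA (poles η) E E' (N * 2 - 1) v.1 v.2)
      (contDiffAt_coefA _ hdet)
  have D := fun m => (hasDerivAt_expCoeff hdet m 4).const_mul (-3 : ℂ)
  have hd : deriv (fun y => deriv (fun s => coefA (poles η) E E' (N * 2 - 1) y s) t) x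
      = 1 / 3 * (-3 * expCoeff η E E' 6 4 x t
        + (5 * (-3 * expCoeff η E E' 2 4 x t) * (-3 * expCoeff η E E' 3 4 x t)
          + 5 * (-3 * expCoeff η E E' 1 4 x t) * (-3 * expCoeff η E E' 4 4 x t))
        + 5 / 3 * (3 * (-3 * expCoeff η E E' 1 4 x t) ^ 2 * (-3 * expCoeff η E E' 2 4 x t))) := by
    have hev : (fun y => deriv (fun s => coefA (poles η) E E' (N * 2 - 1) y s) t) =ᶠ[𝓝 x]
        fun y => 1 / 3 * (-3 * expCoeff η E E' 5 4 y t
        + 5 * (-3 * expCoeff η E E' 1 4 y t) * (-3 * expCoeff η E E' 3 4 y t)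
        + 5 / 3 * (-3 * expCoeff η E E' 1 4 y t) ^ 3) := by
      filter_upwards [eventually_det_ne_zero hdet] with y hy using h.time_evolution hN ha hy
    rw [hev.deriv_eq]
    refine (((((D 5).add (((D 1).const_mul 5).mul (D 3))).add
      (((D 1).pow 3).const_mul (5 / 3))).const_mul (1 / 3)).congr_deriv ?_).deriv
    push_cast
    ring
  have hx0 := hx 0
  rw [iteratedDeriv_zero] at hx0
  have hx1 := hx 1
  rw [iteratedDeriv_one] at hx1
  have key : ((deriv (fun s => q x s) t + iteratedDeriv 5 (fun y => q y t) x
      + 5 * deriv (fun y => q y t) x * iteratedDeriv 2 (fun y => q y t) x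
      + 5 * q x t * iteratedDeriv 3 (fun y => q y t) x
      + 5 * q x t ^ 2 * deriv (fun y => q y t) x : ℝ) : ℂ) = 0 := by
    push_cast
    rw [ht, hd, hx 5, hx 2, hx 3, hx0, hx1]
    ring
  exact_mod_cast key

end SawadaKotera

/-! ### Interpolation at the squares of the poles -/

section Interpolation

lemma exists_eval_sq_of_even {f : ℂ[X]} (h : f.comp (-X) = f) :
    ∃ S : ℂ[X], (∀ κ, f.eval κ = S.eval (κ ^ 2)) ∧ ∀ l, S.coeff l = f.coeff (l * 2) := by
  have h1 : ∀ l, f.coeff l * (-1) ^ l = f.coeff l := by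
    intro l
    conv_rhs => rw [← h, show (-X : ℂ[X]) = C (-1) * X by simp]
    rw [Polynomial.comp_C_mul_X_coeff]
  have h2 : Polynomial.expand ℂ 2 (Polynomial.contract 2 f) = f := by
    ext l
    rw [Polynomial.coeff_expand (by norm_num)]
    split_ifs with hl
    · rw [Polynomial.coeff_contract (by norm_num), Nat.div_mul_cancel hl]
    · have h3 := h1 l
      rw [Odd.neg_one_pow (Nat.not_even_iff_odd.1 fun he => hl he.two_dvd)] at h3
      linear_combination h3 / 2
  refine ⟨Polynomial.contract 2 f, fun κ => ?_, fun l => Polynomial.coeff_contract (by norm_num) _ _⟩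
  rw [← Polynomial.expand_eval, h2]

lemma coeff_mul_near_top {f g : ℂ[X]} {n : ℕ} (hf : ∀ l, n + 2 < l → f.coeff l = 0)
    (hg : ∀ l, n + 2 < l → g.coeff l = 0) : (f * g).coeff (2 * n + 2)
      = f.coeff (n + 2) * g.coeff n + f.coeff (n + 1) * g.coeff (n + 1)
        + f.coeff n * g.coeff (n + 2) := by
  rw [Polynomial.coeff_mul, ← Finset.sum_subset (s₁ := {(n + 2, n), (n + 1, n + 1), (n, n + 2)})]
  · rw [Finset.sum_insert (by simp), Finset.sum_insert (by simp), Finset.sum_singleton]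
    ring
  · intro i hi
    simp only [Finset.mem_insert, Finset.mem_singleton] at hi
    rw [Finset.HasAntidiagonal.mem_antidiagonal]
    rcases hi with rfl | rfl | rfl <;> simp <;> ring
  · rintro ⟨i, j⟩ hi hn
    simp only [Finset.mem_insert, Finset.mem_singleton, Prod.mk.injEq, not_or] at hn
    rw [Finset.HasAntidiagonal.mem_antidiagonal] at hi
    simp only at hi ⊢
    rcases lt_or_ge (n + 2) i with h | h
    · rw [hf _ h, zero_mul]
    · rw [hg _ (by omega), mul_zero]

/-- Lagrange interpolation of the square variable for `f(κ) f(-κ)`. -/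
lemma lagrange_even {ι : Type*} [Fintype ι] [DecidableEq ι] {p : ι → ℂ}
    (hp : Function.Injective fun i => p i ^ 2) (h0 : ∀ i, p i ≠ 0) {f : ℂ[X]} {n : ℕ}
    (hn : Even n) (hcard : Fintype.card ι = n + 2) (hf : ∀ l, n + 2 < l → f.coeff l = 0)
    (h1 : f.coeff (n + 2) = 1) :
    (∑ i, f.eval (p i) * f.eval (-p i) / ∏ l ∈ Finset.univ.erase i, (p i ^ 2 - p l ^ 2)
      = 2 * f.coeff n - f.coeff (n + 1) ^ 2 + ∑ i, p i ^ 2) ∧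
    (∑ i, f.eval (p i) * f.eval (-p i)
        / (p i ^ 2 * ∏ l ∈ Finset.univ.erase i, (p i ^ 2 - p l ^ 2))
      = 1 - f.coeff 0 ^ 2 / ∏ i, -p i ^ 2) := by
  have hc : ∀ l, (f.comp (-X)).coeff l = f.coeff l * (-1) ^ l := fun l => by
    rw [show (-X : ℂ[X]) = C (-1) * X by simp, Polynomial.comp_C_mul_X_coeff]
  have hg : ∀ l, n + 2 < l → (f.comp (-X)).coeff l = 0 := fun l hl => by
    rw [hc, hf l hl, zero_mul]
  obtain ⟨S, hS, hSc⟩ := exists_eval_sq_of_even (f := f * f.comp (-X)) (by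
    rw [Polynomial.mul_comp, Polynomial.comp_assoc]
    simp [mul_comm])
  have hdf : f.natDegree ≤ n + 2 := Polynomial.natDegree_le_iff_coeff_eq_zero.2 hf
  have hdg : (f.comp (-X)).natDegree ≤ n + 2 := Polynomial.natDegree_le_iff_coeff_eq_zero.2 hg
  have hStop : S.coeff (n + 2) = 1 := by
    rw [hSc, show (n + 2) * 2 = (n + 2) + (n + 2) by ring,
      Polynomial.coeff_mul_add_eq_of_natDegree_le hdf hdg, hc, h1]
    rw [(show Even (n + 2) by exact hn.add even_two).neg_one_pow, one_mul, one_mul]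
  have hSgt : ∀ l, n + 2 < l → S.coeff l = 0 := by
    intro l hl
    rw [hSc]
    refine Polynomial.coeff_eq_zero_of_natDegree_lt ?_
    have := Polynomial.natDegree_mul_le (p := f) (q := f.comp (-X))
    omega
  have hSnext : S.coeff (n + 1) = 2 * f.coeff n - f.coeff (n + 1) ^ 2 := by
    rw [hSc, show (n + 1) * 2 = 2 * n + 2 by ring, coeff_mul_near_top hf hg, hc, hc, hc, h1,
      hn.neg_one_pow, (show Even (n + 2) by exact hn.add even_two).neg_one_pow,
      (show Odd (n + 1) by exact hn.add_one).neg_one_pow]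
    ring
  have hS0 : S.coeff 0 = f.coeff 0 ^ 2 := by
    rw [hSc, zero_mul, Polynomial.mul_coeff_zero, hc]; ring
  -- Both S and the nodal polynomial W are monic of degree equal to the number of nodes. Their
  -- difference has the values of S at the nodes and a degree small enough for Lagrange
  -- interpolation.
  set W : ℂ[X] := ∏ i, (X - C (p i ^ 2)) with hW
  have hWm : W.Monic := Polynomial.monic_prod_of_monic _ _ fun i _ => Polynomial.monic_X_sub_C _
  have hWd : W.natDegree = n + 2 := by
    rw [hW, Polynomial.natDegree_prod_of_monic _ _ fun i _ => Polynomial.monic_X_sub_C _]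
    simp only [Polynomial.natDegree_X_sub_C, Finset.sum_const, Finset.card_univ, hcard]
    simp
  have hWtop : W.coeff (n + 2) = 1 := by rw [← hWd]; exact hWm.coeff_natDegree
  have hdeg : (S - W).degree < (Finset.univ : Finset ι).card := by
    rw [Finset.card_univ, hcard, Polynomial.degree_lt_iff_coeff_zero]
    intro l hl
    rcases hl.eq_or_lt with rfl | hl
    · rw [Polynomial.coeff_sub, hStop, hWtop, sub_self]
    · rw [Polynomial.coeff_sub, hSgt l hl, zero_sub,
        Polynomial.coeff_eq_zero_of_natDegree_lt (hWd ▸ hl), neg_zero]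
  have hval : ∀ i, (S - W).eval (p i ^ 2) = f.eval (p i) * f.eval (-p i) := by
    intro i
    have h2 := hS (p i)
    rw [Polynomial.eval_mul, Polynomial.eval_comp, Polynomial.eval_neg, Polynomial.eval_X] at h2
    have h3 : W.eval (p i ^ 2) = 0 := by
      rw [hW, Polynomial.eval_prod]
      exact Finset.prod_eq_zero (Finset.mem_univ i) (by simp)
    rw [Polynomial.eval_sub, h3, sub_zero, h2]
  have hinj : Set.InjOn (fun i => p i ^ 2) ((Finset.univ : Finset ι) : Set ι) := hp.injOn
  constructor
  -- First formula: compare the highest coefficient that an interpolant can have.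
  · have h2 := Lagrange.coeff_eq_sum hinj (P := S - W) ?_
    · simp only [hval] at h2
      rw [← h2, Finset.card_univ, hcard, Polynomial.coeff_sub, show n + 2 - 1 = n + 1 by omega,
        hSnext]
      have h3 := Polynomial.prod_X_sub_C_coeff_card_pred Finset.univ (fun i => p i ^ 2)
        (by rw [Finset.card_univ, hcard]; omega)
      rw [Finset.card_univ, hcard, show n + 2 - 1 = n + 1 by omega] at h3
      rw [hW, h3]
      ring
    · rw [Finset.card_univ, hcard] at hdeg ⊢
      exact_mod_cast hdeg
  -- Second formula: evaluate the interpolant at 0, which is not a node.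
  · have h2 := congrArg (fun Ψ => Polynomial.eval 0 Ψ) (Lagrange.eq_interpolate hinj hdeg)
    have h0' : ∀ i ∈ (Finset.univ : Finset ι), (0 : ℂ) ≠ p i ^ 2 := fun i _ =>
      (pow_ne_zero 2 (h0 i)).symm
    rw [Lagrange.eval_interpolate_not_at_node _ h0', Lagrange.eval_nodal] at h2
    simp only [zero_sub, hval, Lagrange.nodalWeight] at h2
    have hW0 : W.eval 0 = ∏ i, -p i ^ 2 := by simp [hW, Polynomial.eval_prod]
    rw [Polynomial.eval_sub, hW0, ← Polynomial.coeff_zero_eq_eval_zero, hS0] at h2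
    have hne : ∏ i, -p i ^ 2 ≠ 0 := Finset.prod_ne_zero_iff.2 fun i _ =>
      neg_ne_zero.2 (pow_ne_zero 2 (h0 i))
    have h3 : f.coeff 0 ^ 2 / ∏ i, -p i ^ 2 = 1 + ∑ i, (∏ l ∈ Finset.univ.erase i,
        (p i ^ 2 - p l ^ 2)⁻¹) * (-p i ^ 2)⁻¹ * (f.eval (p i) * f.eval (-p i)) := by
      rw [div_eq_iff hne]
      linear_combination h2
    rw [h3, sub_add_cancel_left, ← Finset.sum_neg_distrib]
    refine Finset.sum_congr rfl fun i _ => ?_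
    rw [Finset.prod_inv_distrib, div_eq_mul_inv, mul_inv, inv_neg]
    ring

end Interpolation

/-! ### The phases of the interpolation weights at the squared poles. -/

section Weights

variable {N : ℕ} {η : Fin N → ℝ}

lemma pt_sq_zero (j : Fin N) : pt η (j, 0) ^ 2 = -(z ^ 2 * (η j : ℂ) ^ 2) := by
  rw [pt_zero]; linear_combination (z ^ 2 * (η j : ℂ) ^ 2) * Complex.I_sq

lemma pt_sq_one (j : Fin N) : pt η (j, 1) ^ 2 = -(z * (η j : ℂ) ^ 2) := by
  rw [pt_one]
  linear_combination (z ^ 4 * (η j : ℂ) ^ 2) * Complex.I_sq - (z * (η j : ℂ) ^ 2) * z_cube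

lemma pt_sq_injective (hp : ∀ j, 0 < η j) (hd : Function.Injective η) :
    Function.Injective fun i => pt η i ^ 2 := by
  intro a b h
  rcases sq_eq_sq_iff_eq_or_eq_neg.1 h with h | h
  · exact pt_injective hp hd h
  · have h1 := congrArg Complex.re h
    rw [Complex.neg_re, pt_re, pt_re] at h1
    have : (0 : ℝ) < Real.sqrt 3 := by positivity
    nlinarith [mul_pos this (hp a.1), mul_pos this (hp b.1)]

lemma prod_erase_pair (f : Fin N × Fin 2 → ℂ) (j : Fin N) :
    ∏ i ∈ Finset.univ.erase (j, 0), f i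
      = f (j, 1) * ∏ l ∈ Finset.univ.erase j, f (l, 0) * f (l, 1) := by
  have h1 : ∏ i ∈ Finset.univ.erase (j, 0), f i
      = ∏ i, if i = (j, 0) then 1 else f i := by
    rw [← Finset.prod_erase Finset.univ (a := (j, (0 : Fin 2))) (by simp)]
    exact Finset.prod_congr rfl fun i hi => by rw [if_neg (Finset.ne_of_mem_erase hi)]
  rw [h1, Fintype.prod_prod_type, ← Finset.mul_prod_erase Finset.univ _ (Finset.mem_univ j)]
  congr 1
  · simp [Fin.prod_univ_two]
  · refine Finset.prod_congr rfl fun l hl => ?_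
    have := Finset.ne_of_mem_erase hl
    simp [Fin.prod_univ_two, this]

/-- The conjugate pole contributes i√3η_j², and each pair l ≠ j contributes z(η_j² - η_l²)(η_j² -
z²η_l²). Up to i times a real number this is c_j for P = Q_x, which is how the directions arise from
interpolation. -/
lemma prod_pt_sq_sub (hN : 1 ≤ N) (j : Fin N) :
    ∏ l ∈ Finset.univ.erase (j, 0), (pt η (j, 0) ^ 2 - pt η l ^ 2)
      = Complex.I * ((Real.sqrt 3 * η j ^ 2 * ∏ l ∈ Finset.univ.erase j, (η j ^ 2 - η l ^ 2) : ℝ) : ℂ)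
        * direction .derivative η j := by
  rw [prod_erase_pair]
  have h1 : ∀ l, (pt η (j, 0) ^ 2 - pt η (l, 0) ^ 2) * (pt η (j, 0) ^ 2 - pt η (l, 1) ^ 2)
      = z * (((η j : ℂ) ^ 2 - (η l : ℂ) ^ 2) * ((η j : ℂ) ^ 2 - z ^ 2 * (η l : ℂ) ^ 2)) := by
    intro l
    rw [pt_sq_zero, pt_sq_zero, pt_sq_one]
    linear_combination (((η j : ℂ) ^ 2 - (η l : ℂ) ^ 2) * z * (η j : ℂ) ^ 2) * z_cube
  have hz : z ^ (N + 2) = z ^ (N - 1) := by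
    obtain ⟨n, rfl⟩ : ∃ n, N = n + 1 := ⟨N - 1, by omega⟩
    rw [Nat.add_sub_cancel]
    linear_combination z ^ n * z_cube
  have h2 := I_mul_z_sq_sub
  simp only [h1, Finset.prod_mul_distrib, Finset.prod_const, direction,
    Finset.card_erase_of_mem (Finset.mem_univ j), Finset.card_univ, Fintype.card_fin, hz]
  rw [pt_sq_zero, pt_sq_one]
  push_cast
  rw [← h2]
  linear_combination (-(z ^ 2 - z) * (η j : ℂ) ^ 2 * z ^ (N - 1)
    * (∏ l ∈ Finset.univ.erase j, ((η j : ℂ) ^ 2 - (η l : ℂ) ^ 2))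
    * ∏ l ∈ Finset.univ.erase j, ((η j : ℂ) ^ 2 - z ^ 2 * (η l : ℂ) ^ 2)) * Complex.I_sq

variable (η) in
/-- The denominators of the interpolation formula belonging to a reduction. -/
def nodeWeight (c : Reduction) (i : Fin N × Fin 2) : ℂ :=
  (match c with
    | .zero => pt η i ^ 2
    | .derivative => 1) * ∏ l ∈ Finset.univ.erase i, (pt η i ^ 2 - pt η l ^ 2)

/-- For P = 0 the extra factor p² = -z²η_j² turns z c_j into a real multiple of c_j, since z³ = 1.
-/
lemma exists_nodeWeight_eq (hN : 1 ≤ N) (hp : ∀ j, 0 < η j) (hd : Function.Injective η)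
    (c : Reduction) (j : Fin N) : ∃ ρ : ℝ, ρ ≠ 0 ∧
      nodeWeight η c (j, 0) = Complex.I * ρ * direction c η j := by
  have h1 : Real.sqrt 3 * η j ^ 2 * ∏ l ∈ Finset.univ.erase j, (η j ^ 2 - η l ^ 2) ≠ 0 := by
    have := hp j
    refine mul_ne_zero (by positivity) (Finset.prod_ne_zero_iff.2 fun l hl h => ?_)
    have h2 := hp l
    exact Finset.ne_of_mem_erase hl (hd ((pow_left_inj₀ h2.le (hp j).le two_ne_zero).1
      (sub_eq_zero.1 h).symm))
  cases c with
  | zero =>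
    refine ⟨_, mul_ne_zero (neg_ne_zero.2 (pow_ne_zero 2 (hp j).ne')) h1, ?_⟩
    simp only [nodeWeight]
    rw [prod_pt_sq_sub hN, pt_sq_zero, direction_derivative]
    push_cast
    linear_combination (-(η j : ℂ) ^ 2 * Complex.I * ((Real.sqrt 3 : ℝ) * (η j : ℂ) ^ 2
      * ∏ l ∈ Finset.univ.erase j, ((η j : ℂ) ^ 2 - (η l : ℂ) ^ 2)) * direction .zero η j) * z_cube
  | derivative =>
    refine ⟨_, h1, ?_⟩
    simp only [nodeWeight]
    rw [prod_pt_sq_sub hN, one_mul]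

lemma conj_nodeWeight (c : Reduction) (i : Fin N × Fin 2) :
    starRingEnd ℂ (nodeWeight η c i) = nodeWeight η c (i.1, i.2.rev) := by
  unfold nodeWeight
  rw [map_mul, map_prod]
  have h1 : ∀ l : Fin N × Fin 2, starRingEnd ℂ (pt η i ^ 2 - pt η l ^ 2)
      = pt η (i.1, i.2.rev) ^ 2 - pt η (l.1, l.2.rev) ^ 2 := fun l => by
    rw [map_sub, map_pow, map_pow, conj_pt, conj_pt]
  congr 1
  · cases c <;> simp [conj_pt]
  · simp only [h1]
    refine Finset.prod_bij' (fun l _ => (l.1, l.2.rev)) (fun l _ => (l.1, l.2.rev)) ?_ ?_ ?_ ?_ ?_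
    · rintro ⟨l, b⟩ h
      simp only [Finset.mem_erase, Finset.mem_univ, and_true, ne_eq, Prod.mk.injEq,
        Fin.rev_inj] at h ⊢
      simpa [Prod.ext_iff] using h
    · rintro ⟨l, b⟩ h
      obtain ⟨j, b'⟩ := i
      simp only [Finset.mem_erase, Finset.mem_univ, and_true, ne_eq, Prod.mk.injEq] at h ⊢
      rintro ⟨rfl, h2⟩
      exact h ⟨rfl, by rw [← h2, Fin.rev_rev]⟩
    · rintro ⟨l, b⟩ _; simp
    · rintro ⟨l, b⟩ _; simp
    · rintro ⟨l, b⟩ _; rfl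

end Weights

/-! ### Decay at `-∞` -/

section Decay

/-- Integration of the bound from -∞: the mean value inequality on [y, x], followed by y → -∞. -/
lemma norm_le_of_deriv_exp_le {f f' : ℝ → ℂ} {a D x₁ : ℝ} (ha : 0 < a)
    (hf : ∀ x ≤ x₁, HasDerivAt f (f' x) x) (hb : ∀ x ≤ x₁, ‖f' x‖ ≤ D * Real.exp (a * x))
    (hlim : Tendsto f atBot (𝓝 0)) {x : ℝ} (hx : x ≤ x₁) : ‖f x‖ ≤ D / a * Real.exp (a * x) := by
  have hD : 0 ≤ D := by
    have h1 := (norm_nonneg _).trans (hb x hx)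
    exact nonneg_of_mul_nonneg_left h1 (Real.exp_pos _)
  have h1 : Tendsto (fun y => ‖f x - f y‖) atBot (𝓝 ‖f x - 0‖) :=
    (tendsto_const_nhds.sub hlim).norm
  rw [sub_zero] at h1
  refine le_of_tendsto h1 ?_
  filter_upwards [eventually_le_atBot x] with y hy
  have h2 := image_norm_le_of_norm_deriv_right_le_deriv_boundary (a := y) (b := x)
    (f := fun s => f s - f y) (f' := f')
    (B := fun s => D / a * Real.exp (a * s) - D / a * Real.exp (a * y))
    (B' := fun s => D * Real.exp (a * s))
    (fun s hs => ((hf s (hs.2.trans hx)).sub_const _).continuousAt.continuousWithinAt)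
    (fun s hs => ((hf s (hs.2.le.trans hx)).sub_const _).hasDerivWithinAt)
    (by simp)
    (fun s => by
      have h3 : HasDerivAt (fun s : ℝ => Real.exp (a * s)) (Real.exp (a * s) * (a * 1)) s :=
        ((hasDerivAt_id s).const_mul a).exp
      refine ((h3.const_mul (D / a)).sub_const _).congr_deriv ?_
      field_simp)
    (fun s hs => hb s (hs.2.le.trans hx)) (Set.right_mem_Icc.2 hy)
  have h4 : 0 ≤ D / a * Real.exp (a * y) := by positivity
  linarith

/-- A solution of `u'' = -q u` with `q` exponentially small at `-∞` vanishes if `u` and `u'`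
tend to zero. -/
lemma eventually_eq_zero_of_second_order {u v q : ℝ → ℂ} {a : ℝ} (ha : 0 < a)
    (hu : ∀ᶠ x in atBot, HasDerivAt u (v x) x)
    (hv : ∀ᶠ x in atBot, HasDerivAt v (-(q x * u x)) x)
    (hq : q =O[atBot] fun x => Real.exp (a * x))
    (hu0 : Tendsto u atBot (𝓝 0)) (hv0 : Tendsto v atBot (𝓝 0)) :
    ∀ᶠ x in atBot, u x = 0 := by
  obtain ⟨K, hK, hq⟩ := hq.exists_pos
  have hexp : Tendsto (fun x : ℝ => K / a / a * Real.exp (a * x)) atBot (𝓝 0) := by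
    have := (Real.tendsto_exp_atBot.comp (tendsto_id.const_mul_atBot ha)).const_mul (K / a / a)
    simpa using this
  have hsmall : ∀ᶠ x in atBot, K / a / a * Real.exp (a * x) ≤ 1 / 2 :=
    (hexp.eventually_lt_const (by norm_num : (0 : ℝ) < 1 / 2)).mono fun _ => le_of_lt
  have hone : ∀ᶠ x in atBot, ‖u x‖ ≤ 1 := by
    have h1 := hu0.norm
    rw [norm_zero] at h1
    exact (h1.eventually_lt_const one_pos).mono fun _ => le_of_lt
  obtain ⟨x₁, hx₁⟩ := eventually_atBot.1
    (hu.and (hv.and (hq.bound.and (hsmall.and hone))))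
  -- Two integrations multiply the bound on u by K a⁻² e^{ax} ≤ 1/2, so iteration forces u = 0.
  have key : ∀ n : ℕ, ∀ x ≤ x₁, ‖u x‖ ≤ (1 / 2) ^ n := by
    intro n
    induction n with
    | zero => intro x hx; simpa using (hx₁ x hx).2.2.2.2
    | succ n ih =>
      intro x hx
      have hv1 : ∀ y ≤ x₁, ‖v y‖ ≤ K * (1 / 2) ^ n / a * Real.exp (a * y) := fun y hy =>
        norm_le_of_deriv_exp_le ha (f := v) (f' := fun y => -(q y * u y))
          (fun y hy => (hx₁ y hy).2.1) (fun y hy => by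
            have h1 := (hx₁ y hy).2.2.1
            rw [Real.norm_of_nonneg (Real.exp_pos _).le] at h1
            rw [norm_neg, norm_mul]
            calc ‖q y‖ * ‖u y‖ ≤ K * Real.exp (a * y) * (1 / 2) ^ n :=
                  mul_le_mul h1 (ih y hy) (norm_nonneg _) (by positivity)
              _ = K * (1 / 2) ^ n * Real.exp (a * y) := by ring) hv0 hy
      have h2 := norm_le_of_deriv_exp_le ha (fun y hy => (hx₁ y hy).1) hv1 hu0 hx
      have h3 := (hx₁ x hx).2.2.2.1
      calc ‖u x‖ ≤ K * (1 / 2) ^ n / a / a * Real.exp (a * x) := h2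
        _ = K / a / a * Real.exp (a * x) * (1 / 2) ^ n := by ring
        _ ≤ 1 / 2 * (1 / 2) ^ n := by gcongr
        _ = (1 / 2) ^ (n + 1) := by ring
  filter_upwards [eventually_le_atBot x₁] with x hx
  have h1 : Tendsto (fun n : ℕ => ((1 : ℝ) / 2) ^ n) atTop (𝓝 0) :=
    tendsto_pow_atTop_nhds_zero_of_lt_one (by norm_num) (by norm_num)
  exact norm_le_zero_iff.1 (ge_of_tendsto' h1 fun n => key n x hx)

lemma eventually_const_of_hasDerivAt_zero {f : ℝ → ℂ}
    (h : ∀ᶠ x in atBot, HasDerivAt f 0 x) : ∃ K, ∀ᶠ x in atBot, f x = K := by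
  obtain ⟨x₀, hx₀⟩ := eventually_atBot.1 h
  obtain ⟨K, hK⟩ := IsOpen.exists_is_const_of_deriv_eq_zero (isOpen_Iio (a := x₀))
    isPreconnected_Iio
    (fun y hy => (hx₀ y (le_of_lt hy)).differentiableAt.differentiableWithinAt)
    (fun y hy => (hx₀ y (le_of_lt hy)).deriv)
  exact ⟨K, (eventually_lt_atBot x₀).mono hK⟩

lemma wave_time_zero (a x : ℝ) : wave a x 0 = Real.exp (Real.sqrt 3 * a * x) := by
  simp [wave]

/-- Waves with different exponents are linearly independent at `-∞`. -/
lemma eq_zero_of_sum_wave {N : ℕ} {η : Fin N → ℝ} (hd : Function.Injective η) {d : Fin N → ℝ}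
    {h : Fin N → ℝ → ℂ} {H : Fin N → ℂ} (hh : ∀ j, Tendsto (h j) atBot (𝓝 (H j)))
    (hH : ∀ j, H j ≠ 0)
    (hsum : ∀ᶠ x in atBot, ∑ j, (d j : ℂ) * ((wave (η j) x 0 : ℝ) : ℂ) * h j x = 0) (j : Fin N) :
    d j = 0 := by
  by_contra hj
  -- At -∞ the wave with the smallest η among those with nonzero coefficient dominates; dividing by
  -- it isolates its coefficient in the limit.
  obtain ⟨m, hm, hmin⟩ := Finset.exists_min_image (Finset.univ.filter fun j => d j ≠ 0) η
    ⟨j, by simpa using hj⟩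
  rw [Finset.mem_filter] at hm
  have h1 : Tendsto (fun x => ∑ j, (d j : ℂ) * ((Real.exp (Real.sqrt 3 * (η j - η m) * x) : ℝ) : ℂ)
      * h j x) atBot (𝓝 (∑ j, if j = m then (d m : ℂ) * H m else 0)) := by
    refine tendsto_finsetSum _ fun j _ => ?_
    split_ifs with hjm
    · subst hjm
      simpa using (hh j).const_mul (d j : ℂ)
    · by_cases hdj : d j = 0
      · simp [hdj]
      · have h2 : 0 < η j - η m := by
          have h3 := hmin j (by simpa using hdj)
          exact sub_pos.2 (lt_of_le_of_ne h3 fun he => hjm (hd he).symm)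
        have h3 : Tendsto (fun x => Real.exp (Real.sqrt 3 * (η j - η m) * x)) atBot (𝓝 0) :=
          Real.tendsto_exp_atBot.comp (tendsto_id.const_mul_atBot (by positivity))
        have h4 := (((Complex.continuous_ofReal.tendsto 0).comp h3).const_mul (d j : ℂ)).mul (hh j)
        simpa using h4
  have h2 : (fun x => ∑ j, (d j : ℂ) * ((Real.exp (Real.sqrt 3 * (η j - η m) * x) : ℝ) : ℂ)
      * h j x) =ᶠ[atBot] fun _ => 0 := by
    filter_upwards [hsum] with x hx
    have h3 : ∀ j, ((Real.exp (Real.sqrt 3 * (η j - η m) * x) : ℝ) : ℂ)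
        = ((wave (η j) x 0 : ℝ) : ℂ) * ((Real.exp (-(Real.sqrt 3 * η m * x)) : ℝ) : ℂ) := by
      intro j
      rw [wave_time_zero, ← Complex.ofReal_mul, ← Real.exp_add]
      ring_nf
    have h4 := congrArg (fun c => ((Real.exp (-(Real.sqrt 3 * η m * x)) : ℝ) : ℂ) * c) hx
    simp only [mul_zero, Finset.mul_sum] at h4
    rw [← h4]
    refine Finset.sum_congr rfl fun j _ => ?_
    rw [h3]; ring
  have h3 := tendsto_nhds_unique (h1.congr' h2) tendsto_const_nhds
  rw [Finset.sum_ite_eq' Finset.univ m, if_pos (Finset.mem_univ _)] at h3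
  exact mul_ne_zero (by exact_mod_cast hm.2) (hH m) h3

end Decay

/-! ### Necessity of the alignment -/

section Necessity

variable {N : ℕ} {η : Fin N → ℝ} {E E' : Fin N → ℂ}

lemma bigGamma_neg_pt (i : Fin N × Fin 2) : bigGamma (poles η) (-pt η i) = 0 := by
  rw [bigGamma_neg_eq]
  exact Finset.prod_eq_zero (Finset.mem_univ i) (sub_self _)

lemma tendsto_eval_bigPhi_atBot (hp : ∀ j, 0 < η j) (hd : Function.Injective η) (t : ℝ) (κ : ℂ) :
    Tendsto (fun x => (bigPhi η E E' x t).eval κ) atBot (𝓝 (bigGamma (poles η) (-κ))) := by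
  simp only [eval_bigPhi]
  exact tendsto_monicPoly_atBot hp hd t κ

/-- The relations replace Φ(p) by -γχ times Φ at minus the conjugate pole. Both members of the pair
then contain the same product of values, and since γ and the weights occur in conjugate pairs their
coefficients add to twice a real part. -/
lemma InputData.node_pair (h : InputData η E E') {c : Reduction} {j : Fin N} {x : ℝ}
    (hdet : (bigM (poles η) E E' x 0).det ≠ 0) :
    (bigPhi η E E' x 0).eval (pt η (j, 0)) * (bigPhi η E E' x 0).eval (-pt η (j, 0))
        / nodeWeight η c (j, 0)
      + (bigPhi η E E' x 0).eval (pt η (j, 1)) * (bigPhi η E E' x 0).eval (-pt η (j, 1))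
        / nodeWeight η c (j, 1)
      = ((-(2 * (gam (poles η) E j / nodeWeight η c (j, 0)).re) : ℝ) : ℂ)
        * ((wave (η j) x 0 : ℝ) : ℂ) * ((bigPhi η E E' x 0).eval (-pt η (j, 0))
          * (bigPhi η E E' x 0).eval (-pt η (j, 1))) := by
  have k0 := kills_bigPhi hdet (j, 0)
  have k1 := kills_bigPhi hdet (j, 1)
  have hw : nodeWeight η c (j, 1) = starRingEnd ℂ (nodeWeight η c (j, 0)) :=
    (conj_nodeWeight c (j, 0)).symm
  rw [partner_eq] at k0 k1
  simp only [Fin.rev_zero, Fin.reduceLast, show (1 : Fin 2).rev = 0 from rfl, coupling,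
    gamma_zero, h.gamma_one] at k0 k1
  have h2 := Complex.add_conj (gam (poles η) E j / nodeWeight η c (j, 0))
  rw [map_div₀, ← hw] at h2
  rw [eq_neg_of_add_eq_zero_left k0, eq_neg_of_add_eq_zero_left k1, Complex.ofReal_neg, ← h2]
  ring

/-- The constant is 0, because Φ(p) tends to Γ(-p) = 0 at -∞. By `eq_zero_of_sum_wave` each
Re(γ/weight) vanishes, and as the weight is i times a nonzero real times c_j, this says that γ/c_j
is real. -/
lemma InputData.aligned_of_const (hN : 1 ≤ N) (h : InputData η E E') (c : Reduction) {K : ℂ}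
    (hK : ∀ᶠ x in atBot, ∑ i, (bigPhi η E E' x 0).eval (pt η i)
      * (bigPhi η E E' x 0).eval (-pt η i) / nodeWeight η c i = K) : Aligned c η E := by
  have hlim := tendsto_eval_bigPhi_atBot (E := E) (E' := E') h.pos h.distinct 0
  have h0 : K = 0 := by
    have h1 : Tendsto (fun x => ∑ i, (bigPhi η E E' x 0).eval (pt η i)
        * (bigPhi η E E' x 0).eval (-pt η i) / nodeWeight η c i) atBot
        (𝓝 (∑ i : Fin N × Fin 2, bigGamma (poles η) (-pt η i) * bigGamma (poles η) (- -pt η i)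
          / nodeWeight η c i)) :=
      tendsto_finsetSum _ fun i _ => ((hlim _).mul (hlim _)).div_const _
    simp only [bigGamma_neg_pt, zero_mul, zero_div, Finset.sum_const_zero] at h1
    exact tendsto_nhds_unique (tendsto_const_nhds.congr' (hK.mono fun _ hx => hx.symm)) h1
  have hsum := eq_zero_of_sum_wave h.distinct
    (d := fun j => -(2 * (gam (poles η) E j / nodeWeight η c (j, 0)).re))
    (h := fun j x => (bigPhi η E E' x 0).eval (-pt η (j, 0))
      * (bigPhi η E E' x 0).eval (-pt η (j, 1)))
    (fun j => (hlim (-pt η (j, 0))).mul (hlim (-pt η (j, 1))))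
    (fun j => by
      rw [neg_neg, neg_neg]
      exact mul_ne_zero (bigGamma_pt_ne h.pos _) (bigGamma_pt_ne h.pos _)) (by
      filter_upwards [hK, eventually_det_atBot (E := E) (E' := E') h.pos h.distinct 0] with x hx hdet
      rw [Fintype.sum_prod_type, h0] at hx
      rw [← hx]
      refine Finset.sum_congr rfl fun j _ => ?_
      rw [Fin.sum_univ_two, h.node_pair hdet])
  rw [aligned_iff_im_div h.pos]
  intro j
  obtain ⟨ρ, hρ, hw⟩ := exists_nodeWeight_eq hN h.pos h.distinct c j
  have h1 := hsum j
  have h2 : gam (poles η) E j / nodeWeight η c (j, 0)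
      = -Complex.I * (gam (poles η) E j / direction c η j) * ((ρ⁻¹ : ℝ) : ℂ) := by
    have h3 := direction_ne_zero h.pos c j
    have h4 : (ρ : ℂ) ≠ 0 := by exact_mod_cast hρ
    rw [hw]
    push_cast
    field_simp
    rw [Complex.I_sq]; ring
  rw [h2, Complex.re_mul_ofReal] at h1
  simpa [hρ] using h1

lemma lagrange_bigPhi (hN : 1 ≤ N) (hp : ∀ j, 0 < η j) (hd : Function.Injective η) (x t : ℝ) :
    (∑ i, (bigPhi η E E' x t).eval (pt η i) * (bigPhi η E E' x t).eval (-pt η i)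
        / nodeWeight η .derivative i
      = 2 * jet η E E' 0 (N * 2 - 2) x t - jet η E E' 0 (N * 2 - 1) x t ^ 2
        + ∑ i, pt η i ^ 2) ∧
    (∑ i, (bigPhi η E E' x t).eval (pt η i) * (bigPhi η E E' x t).eval (-pt η i)
        / nodeWeight η .zero i
      = 1 - jet η E E' 0 0 x t ^ 2 / ∏ i, -pt η i ^ 2) := by
  obtain ⟨n, rfl⟩ : ∃ n, N = n + 1 := ⟨N - 1, by omega⟩
  have h1 := lagrange_even (pt_sq_injective hp hd) (pt_ne_zero hp) (f := bigPhi η E E' x t)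
    (n := n * 2) (even_two.mul_left n) (by simp; ring)
    (fun l hl => coeff_bigPhi_gt x t (by omega))
    (by rw [show n * 2 + 2 = (n + 1) * 2 by ring]; exact coeff_bigPhi_top x t)
  simpa [jet, nodeWeight, show (n + 1) * 2 - 2 = n * 2 by omega,
    show (n + 1) * 2 - 1 = n * 2 + 1 by omega] using h1

/-- P - Q_x is 3(A_{2N-1}A_{2N-1}' - A_{2N-2}'), a multiple of the derivative of 2A_{2N-2} -
A_{2N-1}², which is the x-dependent part of the first interpolation formula. -/
lemma InputData.aligned_of_holds_derivative (hN : 1 ≤ N) (h : InputData η E E')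
    (hr : Holds .derivative (poles η) E E') : Aligned .derivative η E := by
  have hdet := eventually_det_atBot (E := E) (E' := E') h.pos h.distinct 0
  obtain ⟨K, hK⟩ := eventually_const_of_hasDerivAt_zero (f := fun x =>
      2 * jet η E E' 0 (N * 2 - 2) x 0 - jet η E E' 0 (N * 2 - 1) x 0 ^ 2) (by
    filter_upwards [hdet] with x hx
    have h1 := hr x 0 hx
    have h2 : deriv (fun y => potQ (poles η) E E' y 0) x = -3 * jet η E E' 2 (N * 2 - 1) x 0 := by
      simp only [potQ_eq hN]
      exact ((hasDerivAt_jet hx 1 _).const_mul _).deriv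
    rw [h2, potP_eq hN] at h1
    refine (((hasDerivAt_jet hx 0 (N * 2 - 2)).const_mul 2).sub
      ((hasDerivAt_jet hx 0 (N * 2 - 1)).pow 2)).congr_deriv ?_
    push_cast
    linear_combination (-2 / 3 : ℂ) * h1)
  refine h.aligned_of_const hN .derivative (K := K + ∑ i, pt η i ^ 2) (hK.mono fun x hx => ?_)
  rw [(lagrange_bigPhi hN h.pos h.distinct x 0).1, hx]

/-! #### Decay of the coefficients -/

lemma isBigO_coupling {a : ℝ} (ha : ∀ j, a ≤ Real.sqrt 3 * η j) (i : Fin N × Fin 2) :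
    (fun x => coupling η E E' i x 0) =O[atBot] fun x => Real.exp (a * x) := by
  refine Asymptotics.IsBigO.of_bound ‖gamma η E E' i‖ ?_
  filter_upwards [eventually_le_atBot 0] with x hx
  rw [coupling, norm_mul, Complex.norm_real, wave_time_zero,
    Real.norm_of_nonneg (Real.exp_pos _).le, Real.norm_of_nonneg (Real.exp_pos _).le]
  refine mul_le_mul_of_nonneg_left (Real.exp_le_exp.2 ?_) (norm_nonneg _)
  nlinarith [ha i.1]

/-- M⁻¹ converges at -∞, so the coefficients of a polynomial of degree below 2N are controlled by
its defects in the linear relations. -/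
lemma isBigO_coeff (hp : ∀ j, 0 < η j) (hd : Function.Injective η) {Ψ : ℝ → ℂ[X]} {g : ℝ → ℝ}
    (hΨ : ∀ x l, N * 2 ≤ l → (Ψ x).coeff l = 0)
    (hg : ∀ i, (fun x => (Ψ x).eval (pt η i)
      + coupling η E E' i x 0 * (Ψ x).eval (partner η i)) =O[atBot] g) (l : ℕ) :
    (fun x => (Ψ x).coeff l) =O[atBot] g := by
  rcases lt_or_ge l (N * 2) with hl | hl
  · set c : Fin (N * 2) := Fin.rev ⟨l, hl⟩ with hc
    have h1 : (fun x => ∑ i, (bigM (poles η) E E' x 0)⁻¹ c i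
        * ((Ψ x).eval (pt η (rowIdx i))
          + coupling η E E' (rowIdx i) x 0 * (Ψ x).eval (partner η (rowIdx i))))
        =ᶠ[atBot] fun x => (Ψ x).coeff l := by
      filter_upwards [eventually_det_atBot (E := E) (E' := E') hp hd 0] with x hx
      have h2 : (Ψ x).coeff l = (fun c : Fin (N * 2) => (Ψ x).coeff (c.rev : ℕ)) c := by
        simp [hc]
      rw [h2, ← Matrix.one_mulVec (fun c : Fin (N * 2) => (Ψ x).coeff (c.rev : ℕ)),
        ← Matrix.nonsing_inv_mul _ hx.isUnit, ← Matrix.mulVec_mulVec]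
      exact Finset.sum_congr rfl fun i _ => by rw [bigM_mulVec (hΨ x)]
    refine Asymptotics.IsBigO.congr' (Asymptotics.IsBigO.fun_sum fun i _ => ?_) h1 EventuallyEq.rfl
    have h3 := tendsto_pi_nhds.1 (tendsto_pi_nhds.1 (tendsto_inv_apply
      (tendsto_bigM_atBot (E := E) (E' := E') hp 0) (detLimit_ne_zero hp hd)) c) i
    simpa using (h3.isBigO_one ℝ).mul (hg (rowIdx i))
  · simp only [hΨ _ l hl]
    exact Asymptotics.isBigO_zero _ _

lemma isBigO_eval_phiJet {m : ℕ} {g : ℝ → ℝ}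
    (h : ∀ l, (fun x => jet η E E' m l x 0) =O[atBot] g) (κ : ℂ) :
    (fun x => (phiJet η E E' m x 0).eval κ) =O[atBot] g := by
  simp only [eval_phiJet]
  refine Asymptotics.IsBigO.fun_sum fun l _ => ?_
  simpa [mul_comm] using (h l).const_mul_left (κ ^ l)

/-- By the relations for Φ and (∂_x + κ)Φ, the defect of Φ_x is a coupling times a bounded value of
Φ, hence exponentially small. The relation for (∂_x + κ)²Φ gives the same for Φ_xx. -/
lemma isBigO_jet (hp : ∀ j, 0 < η j) (hd : Function.Injective η) {a : ℝ} (ha0 : 0 < a)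
    (ha : ∀ j, a ≤ Real.sqrt 3 * η j) :
    (∀ l, (fun x => jet η E E' 1 l x 0) =O[atBot] fun x => Real.exp (a * x)) ∧
    (∀ l, (fun x => jet η E E' 2 l x 0) =O[atBot] fun x => Real.exp (a * x)) := by
  have hzero : ∀ m x l, N * 2 ≤ l → (phiJet η E E' (m + 1) x 0).coeff l = 0 := by
    intro m x l hl
    rw [coeff_phiJet]
    rcases hl.eq_or_lt with rfl | hl
    · exact jet_top m x 0
    · exact jet_gt hl x 0
  have hdet := eventually_det_atBot (E := E) (E' := E') hp hd 0
  have hJ0 : ∀ κ, (fun x => (phiJet η E E' 0 x 0).eval κ) =O[atBot] fun _ => (1 : ℝ) := by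
    intro κ
    simp only [phiJet_zero]
    exact (tendsto_eval_bigPhi_atBot hp hd 0 κ).isBigO_one ℝ
  have h1 : ∀ l, (fun x => jet η E E' 1 l x 0) =O[atBot] fun x => Real.exp (a * x) := by
    intro l
    have h2 := isBigO_coeff (E := E) (E' := E') hp hd (Ψ := fun x => phiJet η E E' 1 x 0)
      (g := fun x => Real.exp (a * x)) (hzero 0) (fun i => ?_) l
    · simpa only [coeff_phiJet] using h2
    · have h3 := (isBigO_coupling (E := E) (E' := E') ha i).mul
        ((hJ0 (partner η i)).const_mul_left (-(partner η i - pt η i)))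
      simp only [mul_one] at h3
      refine h3.congr' ?_ EventuallyEq.rfl
      filter_upwards [hdet] with x hx
      have k0 := kills_phiJet_zero hx i
      have k1 := kills_covOne hx i
      simp only [covOne, Polynomial.eval_add, Polynomial.eval_mul, Polynomial.eval_X] at k1
      linear_combination pt η i * k0 - k1
  refine ⟨h1, fun l => ?_⟩
  have hexp : (fun x => Real.exp (a * x)) =O[atBot] fun _ => (1 : ℝ) :=
    (Real.tendsto_exp_atBot.comp (tendsto_id.const_mul_atBot ha0)).isBigO_one ℝ
  have hJ1 : ∀ κ, (fun x => (phiJet η E E' 1 x 0).eval κ) =O[atBot] fun _ => (1 : ℝ) :=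
    fun κ => (isBigO_eval_phiJet h1 κ).trans hexp
  have h2 := isBigO_coeff (E := E) (E' := E') hp hd (Ψ := fun x => phiJet η E E' 2 x 0)
    (g := fun x => Real.exp (a * x)) (hzero 1) (fun i => ?_) l
  · simpa only [coeff_phiJet] using h2
  · have h3 := (isBigO_coupling (E := E) (E' := E') ha i).mul
      (((hJ1 (partner η i)).const_mul_left (2 * (pt η i - partner η i))).add
        ((hJ0 (partner η i)).const_mul_left
          (-(partner η i - pt η i) ^ 2)))
    simp only [mul_one] at h3
    refine h3.congr' ?_ EventuallyEq.rfl
    filter_upwards [hdet] with x hx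
    have k0 := kills_phiJet_zero hx i
    have k1 := kills_covOne hx i
    have k2 := kills_covTwo hx i
    simp only [covTwo, covOne, Polynomial.eval_add, Polynomial.eval_mul, Polynomial.eval_X] at k1 k2
    linear_combination 2 * pt η i * k1 - k2 - pt η i ^ 2 * k0

/-- With P = 0 the constant coefficient satisfies A_0''' = -Q A_0'. Since Q, A_0' and A_0'' are
exponentially small at -∞, A_0' vanishes there, and the second interpolation formula becomes
constant. -/
lemma InputData.aligned_of_holds_zero (hN : 1 ≤ N) (h : InputData η E E')
    (hr : Holds .zero (poles η) E E') : Aligned .zero η E := by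
  have hdet := eventually_det_atBot (E := E) (E' := E') h.pos h.distinct 0
  have : Nonempty (Fin N) := ⟨⟨0, hN⟩⟩
  -- The smallest η gives the slowest decay, a rate valid for all couplings.
  obtain ⟨m, hm⟩ := Finite.exists_min η
  have ha0 : 0 < Real.sqrt 3 * η m := by have := h.pos m; positivity
  obtain ⟨h1, h2⟩ := isBigO_jet (E := E) (E' := E') h.pos h.distinct ha0
    fun j => mul_le_mul_of_nonneg_left (hm j) (Real.sqrt_nonneg 3)
  have hexp : Tendsto (fun x : ℝ => Real.exp (Real.sqrt 3 * η m * x)) atBot (𝓝 0) :=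
    Real.tendsto_exp_atBot.comp (tendsto_id.const_mul_atBot ha0)
  have h3 := eventually_eq_zero_of_second_order ha0 (u := fun x => jet η E E' 1 0 x 0)
    (v := fun x => jet η E E' 2 0 x 0) (q := fun x => potQ (poles η) E E' x 0)
    (hdet.mono fun x hx => hasDerivAt_jet hx 1 0)
    (by
      filter_upwards [hdet] with x hx
      refine (hasDerivAt_jet hx 2 0).congr_deriv ?_
      have h3 := congrArg (fun Ψ => Ψ.coeff 0) (third_order hN hx)
      rw [hr x 0 hx] at h3
      simp [mul_assoc, coeff_phiJet] at h3
      linear_combination h3)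
    (by
      simp only [potQ_eq hN]
      exact (h1 _).const_mul_left _)
    ((h1 0).trans_tendsto hexp) ((h2 0).trans_tendsto hexp)
  obtain ⟨K, hK⟩ := eventually_const_of_hasDerivAt_zero (f := fun x => jet η E E' 0 0 x 0) (by
    filter_upwards [hdet, h3] with x hx hx'
    exact (hasDerivAt_jet hx 0 0).congr_deriv hx')
  refine h.aligned_of_const hN .zero (K := 1 - K ^ 2 / ∏ i, -pt η i ^ 2) (hK.mono fun x hx => ?_)
  rw [(lagrange_bigPhi hN h.pos h.distinct x 0).2, hx]

/-- The reductions hold exactly for aligned dependency constants. -/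
lemma InputData.holds_iff_aligned (hN : 1 ≤ N) (h : InputData η E E') (c : Reduction) :
    Holds c (poles η) E E' ↔ Aligned c η E := by
  cases c with
  | zero => exact ⟨h.aligned_of_holds_zero hN, fun ha x t hdet => h.potP_eq_zero hN ha hdet⟩
  | derivative =>
    refine ⟨h.aligned_of_holds_derivative hN, fun ha x t hdet => ?_⟩
    obtain ⟨F, F', hF, _, hiff, hc⟩ := h.exists_zero
    exact h.potP_eq_deriv_potQ hN hF (hiff.2 ha) hc hdet

end Necessity

/-! ### The soliton solutions of both reductions -/

section Solitons

variable {N : ℕ} {η : Fin N → ℝ} {E E' : Fin N → ℂ}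

lemma InputData.logDerivCoeff (hN : 1 ≤ N) (h : InputData η E E') {c : Reduction}
    (ha : Aligned c η E) : LogDerivCoeff E E' η (weight c η E) := by
  cases c with
  | zero => exact h.logDerivCoeff_zero hN ha
  | derivative =>
    obtain ⟨F, F', hF, hw, hiff, hc⟩ := h.exists_zero
    rw [← hw]
    exact hF.logDerivCoeff_derivative hN h.pos (hiff.2 ha) hc

lemma InputData.solvesSawadaKotera_weight (hN : 1 ≤ N) (h : InputData η E E') {c : Reduction}
    (ha : Aligned c η E) {x t : ℝ} (hτ : hirotaTau η (weight c η E) x t ≠ 0) :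
    SolvesSawadaKotera (sixLogDeriv (hirotaTau η (weight c η E))) x t := by
  cases c with
  | zero => exact h.solvesSawadaKotera hN ha hτ
  | derivative =>
    obtain ⟨F, F', hF, hw, hiff, -⟩ := h.exists_zero
    rw [← hw] at hτ ⊢
    exact hF.solvesSawadaKotera hN (hiff.2 ha) hτ

lemma InputData.hirotaTau_eq_sqrt (hN : 1 ≤ N) (h : InputData η E E') {c : Reduction}
    (ha : Aligned c η E) (hw : ∀ j, 0 < weight c η E j) (x t : ℝ) :
    hirotaTau η (weight c η E) x t
      = Real.sqrt ((bigM (poles η) E E' x t).det / detLimit η).re := by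
  rw [h.det_eq hN (h.logDerivCoeff hN ha), mul_div_cancel_left₀ _ (detLimit_ne_zero h.pos h.distinct),
    ← Complex.ofReal_pow, Complex.ofReal_re,
    Real.sqrt_sq (hirotaTau_pos η _ h.distinct h.pos hw x t).le]

lemma Aligned.re_div_eq (hp : ∀ j, 0 < η j) {c : Reduction} (ha : Aligned c η E) {j : Fin N}
    (hre : (direction c η j).re ≠ 0) :
    (gam (poles η) E j / direction c η j).re = (gam (poles η) E j).re / (direction c η j).re := by
  have h1 := congrArg Complex.re (ha.gam_eq hp j)
  rw [Complex.re_ofReal_mul] at h1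
  rw [h1, mul_div_cancel_right₀ _ hre]

end Solitons

/-! ### Real and imaginary parts for the explicit cases. -/

lemma z_sq_re : (z ^ 2).re = -1 / 2 := by rw [← conj_z, Complex.conj_re, z_re]

lemma z_sq_im : (z ^ 2).im = -(Real.sqrt 3 / 2) := by rw [← conj_z, Complex.conj_im, z_im]

lemma re_add_I_mul (r s : ℝ) : ((r : ℂ) + Complex.I * s).re = r := by simp

lemma im_add_I_mul (r s : ℝ) : ((r : ℂ) + Complex.I * s).im = s := by simp

/-! ### One soliton -/

section One

variable {η : Fin 1 → ℝ} {E E' : Fin 1 → ℂ}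

lemma direction_one_zero : direction .zero η 0 = z ^ 2 := by simp [direction]

lemma direction_one_derivative : direction .derivative η 0 = 1 := by
  simp [direction, z_cube]

lemma weight_one (c : Reduction) :
    weight c η E 0 = (gam (poles η) E 0 / direction c η 0).re := by
  simp [weight]

lemma hirotaTau_one (w : Fin 1 → ℝ) (x t : ℝ) :
    hirotaTau η w x t = 1 + w 0 * wave (η 0) x t := by
  have h : (Finset.univ : Finset (Finset (Fin 1))) = {∅, {0}} := by decide
  unfold hirotaTau
  rw [h, Finset.sum_pair (by decide)]
  simp [show ({0} : Finset (Fin 1)).filter (fun l => 0 < l) = ∅ by decide]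

lemma sixLogDeriv_one (w : Fin 1 → ℝ) {x t : ℝ} (hτ : 1 + w 0 * wave (η 0) x t ≠ 0) :
    sixLogDeriv (hirotaTau η w) x t
      = 18 * w 0 * η 0 ^ 2 * wave (η 0) x t / (1 + w 0 * wave (η 0) x t) ^ 2 := by
  have hd : ∀ y, HasDerivAt (fun u => 1 + w 0 * wave (η 0) u t)
      (w 0 * (Real.sqrt 3 * η 0 * wave (η 0) y t)) y := fun y =>
    ((hasDerivAt_wave (η 0) y t).const_mul _).const_add _
  unfold sixLogDeriv
  simp only [hirotaTau_one, (hd _).deriv]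
  have h1 := ((((hasDerivAt_wave (η 0) x t).const_mul (Real.sqrt 3 * η 0)).const_mul (w 0)).fun_div
    (hd x) hτ).deriv
  have h3 : Real.sqrt 3 ^ 2 = 3 := Real.sq_sqrt (by norm_num)
  have h4 : w 0 * (Real.sqrt 3 * η 0 * (Real.sqrt 3 * η 0 * wave (η 0) x t))
      * (1 + w 0 * wave (η 0) x t) - w 0 * (Real.sqrt 3 * η 0 * wave (η 0) x t)
        * (w 0 * (Real.sqrt 3 * η 0 * wave (η 0) x t))
      = 3 * w 0 * η 0 ^ 2 * wave (η 0) x t := by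
    linear_combination (w 0 * η 0 ^ 2 * wave (η 0) x t) * h3
  rw [h1, h4]
  ring

lemma aligned_one_zero {r s : ℝ} (hg : gam (poles η) E 0 = r + Complex.I * s) :
    Aligned .zero η E ↔ s = Real.sqrt 3 * r := by
  unfold Aligned
  rw [Fin.forall_fin_one, hg, direction_one_zero, z_sq_re, z_sq_im, re_add_I_mul, im_add_I_mul]
  constructor <;> intro h <;> linarith

lemma aligned_one_derivative {r s : ℝ} (hg : gam (poles η) E 0 = r + Complex.I * s) :
    Aligned .derivative η E ↔ s = 0 := by
  unfold Aligned
  rw [Fin.forall_fin_one, hg, direction_one_derivative, re_add_I_mul, im_add_I_mul]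
  simp

lemma InputData.weight_one_zero (h : InputData η E E') {r s : ℝ}
    (hg : gam (poles η) E 0 = r + Complex.I * s) (ha : Aligned .zero η E) :
    weight .zero η E 0 = -(2 * r) := by
  rw [weight_one, ha.re_div_eq h.pos] <;> rw [direction_one_zero, z_sq_re]
  · rw [hg, re_add_I_mul]; ring
  · norm_num

lemma weight_one_derivative {r s : ℝ} (hg : gam (poles η) E 0 = r + Complex.I * s) :
    weight .derivative η E 0 = r := by
  rw [weight_one, direction_one_derivative, div_one, hg, re_add_I_mul]

lemma InputData.one_soliton (h : InputData η E E') {c : Reduction} (ha : Aligned c η E) {v : ℝ}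
    (hv : weight c η E 0 = v) (x t : ℝ) :
    hirotaTau η (weight c η E) x t = 1 + v * wave (η 0) x t ∧
    (1 + v * wave (η 0) x t ≠ 0 → potQ (poles η) E E' x t
      = ((18 * v * η 0 ^ 2 * wave (η 0) x t / (1 + v * wave (η 0) x t) ^ 2 : ℝ) : ℂ)) ∧
    (0 < v → (bigM (poles η) E E' x t).det ≠ 0) := by
  have hw := h.logDerivCoeff le_rfl ha
  have h1 := hirotaTau_one (η := η) (weight c η E) x t
  rw [hv] at h1
  refine ⟨h1, fun hτ => ?_, fun hpos => ?_⟩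
  · rw [h.potQ_eq_sixLogDeriv le_rfl hw (h1 ▸ hτ), sixLogDeriv_one _ (hv ▸ hτ), hv]
  · rw [h.det_ne_zero_iff le_rfl hw, h1]
    have : 0 < wave (η 0) x t := Real.exp_pos _
    positivity

end One

/-! ### Two solitons -/

section Two

variable {η : Fin 2 → ℝ} {E E' : Fin 2 → ℂ}

lemma prod_erase_two_zero (f : Fin 2 → ℂ) : ∏ l ∈ Finset.univ.erase 0, f l = f 1 := by
  rw [show (Finset.univ.erase 0 : Finset (Fin 2)) = {1} by decide, Finset.prod_singleton]

lemma prod_erase_two_one (f : Fin 2 → ℂ) : ∏ l ∈ Finset.univ.erase 1, f l = f 0 := by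
  rw [show (Finset.univ.erase 1 : Finset (Fin 2)) = {0} by decide, Finset.prod_singleton]

lemma re_sub_z_sq (a b : ℝ) : ((a : ℂ) ^ 2 - z ^ 2 * (b : ℂ) ^ 2).re = (2 * a ^ 2 + b ^ 2) / 2 := by
  rw [← Complex.ofReal_pow, ← Complex.ofReal_pow, Complex.sub_re, Complex.re_mul_ofReal, z_sq_re,
    Complex.ofReal_re]
  ring

lemma im_sub_z_sq (a b : ℝ) :
    ((a : ℂ) ^ 2 - z ^ 2 * (b : ℂ) ^ 2).im = Real.sqrt 3 * b ^ 2 / 2 := by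
  rw [← Complex.ofReal_pow, ← Complex.ofReal_pow, Complex.sub_im, Complex.im_mul_ofReal, z_sq_im,
    Complex.ofReal_im]
  ring

lemma re_z_mul_sub (a b : ℝ) :
    (z * ((a : ℂ) ^ 2 - z ^ 2 * (b : ℂ) ^ 2)).re = -((a ^ 2 + 2 * b ^ 2) / 2) := by
  rw [Complex.mul_re, re_sub_z_sq, im_sub_z_sq, z_re, z_im]
  have h3 : Real.sqrt 3 ^ 2 = 3 := Real.sq_sqrt (by norm_num)
  linear_combination (-b ^ 2 / 4) * h3

lemma im_z_mul_sub (a b : ℝ) :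
    (z * ((a : ℂ) ^ 2 - z ^ 2 * (b : ℂ) ^ 2)).im = Real.sqrt 3 * a ^ 2 / 2 := by
  rw [Complex.mul_im, re_sub_z_sq, im_sub_z_sq, z_re, z_im]
  ring

lemma direction_two_zero (c : Reduction) : direction c η 0
    = (match c with | .zero => 1 | .derivative => z) * ((η 0 : ℂ) ^ 2 - z ^ 2 * (η 1 : ℂ) ^ 2) := by
  unfold direction
  rw [prod_erase_two_zero]
  congr 1
  cases c
  · exact z_cube
  · linear_combination z * z_cube

lemma direction_two_one (c : Reduction) : direction c η 1
    = (match c with | .zero => 1 | .derivative => z) * ((η 1 : ℂ) ^ 2 - z ^ 2 * (η 0 : ℂ) ^ 2) := by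
  unfold direction
  rw [prod_erase_two_one]
  congr 1
  cases c
  · exact z_cube
  · linear_combination z * z_cube

lemma weight_two_zero (c : Reduction) : weight c η E 0 = (gam (poles η) E 0 / direction c η 0).re
    * ((η 0 + η 1) * (η 0 ^ 3 - η 1 ^ 3) / (η 0 - η 1) ^ 2) := by
  unfold weight
  rw [show (Finset.univ.erase 0 : Finset (Fin 2)) = {1} by decide, Finset.prod_singleton]

lemma weight_two_one (c : Reduction) : weight c η E 1 = (gam (poles η) E 1 / direction c η 1).re
    * ((η 1 + η 0) * (η 1 ^ 3 - η 0 ^ 3) / (η 1 - η 0) ^ 2) := by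
  unfold weight
  rw [show (Finset.univ.erase 1 : Finset (Fin 2)) = {0} by decide, Finset.prod_singleton]

lemma hirotaTau_two (w : Fin 2 → ℝ) (x t : ℝ) :
    hirotaTau η w x t = 1 + w 0 * wave (η 0) x t + w 1 * wave (η 1) x t
      + w 0 * w 1 * interaction (η 0) (η 1) * (wave (η 0) x t * wave (η 1) x t) := by
  have h : (Finset.univ : Finset (Finset (Fin 2))) = {∅, {0}, {1}, {0, 1}} := by decide
  unfold hirotaTau
  rw [h, Finset.sum_insert (by decide), Finset.sum_insert (by decide), Finset.sum_pair (by decide),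
    Finset.prod_pair (by decide), Finset.prod_pair (by decide)]
  simp only [Finset.prod_empty, Finset.prod_singleton,
    show ({0} : Finset (Fin 2)).filter (fun l => 0 < l) = ∅ by decide,
    show ({1} : Finset (Fin 2)).filter (fun l => 1 < l) = ∅ by decide,
    show ({0, 1} : Finset (Fin 2)).filter (fun l => 0 < l) = {1} by decide,
    show ({0, 1} : Finset (Fin 2)).filter (fun l => 1 < l) = ∅ by decide]
  ring

lemma InputData.aligned_two_zero (h : InputData η E E') {r s : Fin 2 → ℝ}
    (hg : ∀ j, gam (poles η) E j = r j + Complex.I * s j) : Aligned .zero η E ↔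
    s 0 = Real.sqrt 3 * η 1 ^ 2 / (2 * η 0 ^ 2 + η 1 ^ 2) * r 0 ∧
    s 1 = Real.sqrt 3 * η 0 ^ 2 / (η 0 ^ 2 + 2 * η 1 ^ 2) * r 1 := by
  have h0 := h.pos 0
  have h1 := h.pos 1
  unfold Aligned
  rw [Fin.forall_fin_two, hg, hg, direction_two_zero, direction_two_one]
  simp only [one_mul]
  rw [re_sub_z_sq, im_sub_z_sq, re_sub_z_sq, im_sub_z_sq, re_add_I_mul, im_add_I_mul,
    re_add_I_mul, im_add_I_mul, div_mul_eq_mul_div, div_mul_eq_mul_div,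
    eq_div_iff (by positivity), eq_div_iff (by positivity)]
  constructor <;> rintro ⟨h2, h3⟩ <;> constructor <;> linarith

lemma InputData.aligned_two_derivative (h : InputData η E E') {r s : Fin 2 → ℝ}
    (hg : ∀ j, gam (poles η) E j = r j + Complex.I * s j) : Aligned .derivative η E ↔
    s 0 = -(Real.sqrt 3 * η 0 ^ 2 / (η 0 ^ 2 + 2 * η 1 ^ 2)) * r 0 ∧
    s 1 = -(Real.sqrt 3 * η 1 ^ 2 / (2 * η 0 ^ 2 + η 1 ^ 2)) * r 1 := by
  have h0 := h.pos 0
  have h1 := h.pos 1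
  unfold Aligned
  rw [Fin.forall_fin_two, hg, hg, direction_two_zero, direction_two_one]
  simp only
  rw [re_z_mul_sub, im_z_mul_sub, re_z_mul_sub, im_z_mul_sub, re_add_I_mul, im_add_I_mul,
    re_add_I_mul, im_add_I_mul]
  simp only [← neg_div]
  rw [div_mul_eq_mul_div, div_mul_eq_mul_div, eq_div_iff (by positivity), eq_div_iff (by positivity)]
  constructor <;> rintro ⟨h2, h3⟩ <;> constructor <;> linarith

/-- All powers of a - b and a + b cancel, leaving (a² + ab + b²)(a² - ab + b²) = (a⁶ - b⁶)/(a² -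
b²); the sign comes from exchanging a and b in one weight. -/
lemma interaction_weights {a b : ℝ} (ha : 0 < a) (hb : 0 < b) (hab : a ≠ b) (u v : ℝ) :
    u * ((a + b) * (a ^ 3 - b ^ 3) / (a - b) ^ 2) * (v * ((b + a) * (b ^ 3 - a ^ 3) / (b - a) ^ 2))
        * interaction a b
      = -(u * v * (a ^ 6 - b ^ 6) / (a ^ 2 - b ^ 2)) := by
  have h1 : a - b ≠ 0 := sub_ne_zero.2 hab
  have h2 : a + b ≠ 0 := by positivity
  have h3 : a ^ 2 + a * b + b ^ 2 ≠ 0 := by positivity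
  have h4 : a ^ 2 - b ^ 2 = (a - b) * (a + b) := by ring
  unfold interaction
  rw [← neg_sub a b, neg_sq, h4]
  field_simp
  ring

lemma InputData.two_soliton (h : InputData η E E') {c : Reduction} (ha : Aligned c η E)
    {r s : Fin 2 → ℝ} (hg : ∀ j, gam (poles η) E j = r j + Complex.I * s j) {u v : ℝ}
    (hu0 : (direction c η 0).re ≠ 0) (hv0 : (direction c η 1).re ≠ 0)
    (hu : r 0 / (direction c η 0).re = u) (hv : r 1 / (direction c η 1).re = v) (x t : ℝ) :
    hirotaTau η (weight c η E) x t
      = 1 + u * ((η 0 + η 1) * (η 0 ^ 3 - η 1 ^ 3) / (η 0 - η 1) ^ 2) * wave (η 0) x t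
        - v * ((η 0 + η 1) * (η 0 ^ 3 - η 1 ^ 3) / (η 0 - η 1) ^ 2) * wave (η 1) x t
        - u * v * (η 0 ^ 6 - η 1 ^ 6) / (η 0 ^ 2 - η 1 ^ 2)
          * (wave (η 0) x t * wave (η 1) x t) := by
  have hne : η 0 ≠ η 1 := fun he => by simpa using h.distinct he
  have h1 := interaction_weights (h.pos 0) (h.pos 1) hne u v
  rw [hirotaTau_two, weight_two_zero, weight_two_one, ha.re_div_eq h.pos hu0,
    ha.re_div_eq h.pos hv0, hg, hg, re_add_I_mul, re_add_I_mul, hu, hv, h1]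
  have h2 : (η 1 + η 0) * (η 1 ^ 3 - η 0 ^ 3) / (η 1 - η 0) ^ 2
      = -((η 0 + η 1) * (η 0 ^ 3 - η 1 ^ 3) / (η 0 - η 1) ^ 2) := by
    rw [← neg_sub (η 0) (η 1), neg_sq]; ring
  rw [h2]
  ring

lemma InputData.two_soliton_zero (h : InputData η E E') (ha : Aligned .zero η E)
    {r s : Fin 2 → ℝ} (hg : ∀ j, gam (poles η) E j = r j + Complex.I * s j) {a b : ℝ}
    (hb : a = η 0) (hb' : b = η 1) (x t : ℝ) :
    hirotaTau η (weight .zero η E) x t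
      = 1 + 2 * r 0 * (a + b) * (a ^ 3 - b ^ 3)
            / ((a - b) ^ 2 * (2 * a ^ 2 + b ^ 2)) * wave a x t
          - 2 * r 1 * (a + b) * (a ^ 3 - b ^ 3)
            / ((a - b) ^ 2 * (a ^ 2 + 2 * b ^ 2)) * wave b x t
          - 4 * r 0 * r 1 * (a ^ 6 - b ^ 6)
            / ((a ^ 2 - b ^ 2) * (2 * a ^ 2 + b ^ 2) * (a ^ 2 + 2 * b ^ 2))
              * (wave a x t * wave b x t) := by
  have h0 := h.pos 0
  have h1 := h.pos 1
  have e0 : (direction .zero η 0).re = (2 * η 0 ^ 2 + η 1 ^ 2) / 2 := by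
    rw [direction_two_zero]; simp only [one_mul]; exact re_sub_z_sq _ _
  have e1 : (direction .zero η 1).re = (η 0 ^ 2 + 2 * η 1 ^ 2) / 2 := by
    rw [direction_two_one]; simp only [one_mul]; rw [re_sub_z_sq]; ring
  rw [h.two_soliton ha hg (u := 2 * r 0 / (2 * η 0 ^ 2 + η 1 ^ 2))
    (v := 2 * r 1 / (η 0 ^ 2 + 2 * η 1 ^ 2)) (by rw [e0]; positivity) (by rw [e1]; positivity)
    (by rw [e0, div_div_eq_mul_div, mul_comm]) (by rw [e1, div_div_eq_mul_div, mul_comm]),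
    hb, hb']
  simp only [div_eq_mul_inv, mul_inv]
  ring

lemma InputData.two_soliton_derivative (h : InputData η E E') (ha : Aligned .derivative η E)
    {r s : Fin 2 → ℝ} (hg : ∀ j, gam (poles η) E j = r j + Complex.I * s j) {a b : ℝ}
    (hb : a = η 0) (hb' : b = η 1) (x t : ℝ) :
    hirotaTau η (weight .derivative η E) x t
      = 1 - 2 * r 0 * (a + b) * (a ^ 3 - b ^ 3)
            / ((a - b) ^ 2 * (a ^ 2 + 2 * b ^ 2)) * wave a x t
          + 2 * r 1 * (a + b) * (a ^ 3 - b ^ 3)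
            / ((a - b) ^ 2 * (2 * a ^ 2 + b ^ 2)) * wave b x t
          - 4 * r 0 * r 1 * (a ^ 6 - b ^ 6)
            / ((a ^ 2 - b ^ 2) * (2 * a ^ 2 + b ^ 2) * (a ^ 2 + 2 * b ^ 2))
              * (wave a x t * wave b x t) := by
  have h0 := h.pos 0
  have h1 := h.pos 1
  have e0 : (direction .derivative η 0).re = -((η 0 ^ 2 + 2 * η 1 ^ 2) / 2) := by
    rw [direction_two_zero]; exact re_z_mul_sub _ _
  have e1 : (direction .derivative η 1).re = -((2 * η 0 ^ 2 + η 1 ^ 2) / 2) := by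
    rw [direction_two_one]; simp only; rw [re_z_mul_sub]; ring
  rw [h.two_soliton ha hg (u := -(2 * r 0 / (η 0 ^ 2 + 2 * η 1 ^ 2)))
    (v := -(2 * r 1 / (2 * η 0 ^ 2 + η 1 ^ 2)))
    (by rw [e0]; exact neg_ne_zero.2 (by positivity))
    (by rw [e1]; exact neg_ne_zero.2 (by positivity))
    (by rw [e0, div_neg, div_div_eq_mul_div, mul_comm])
    (by rw [e1, div_neg, div_div_eq_mul_div, mul_comm]), hb, hb']
  simp only [div_eq_mul_inv, mul_inv]
  ring

end Two

end

end SKSoliton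

/-! ### Assembly of the theorem. -/

open SKSoliton in
theorem mainTheorem2 :
    -- general `N`
    (∀ (N : ℕ), 1 ≤ N → ∀ (η : Fin N → ℝ) (E E' : Fin N → ℂ), InputData η E E' →
      -- the transmission coefficient
      (∀ κ : ℂ, transmission (poles η) κ = ∏ j,
        ((κ + Complex.I * z * η j) / (κ - Complex.I * z * η j)
          * ((κ - Complex.I * z ^ 2 * η j) / (κ + Complex.I * z ^ 2 * η j)))) ∧
      -- the potentials are real, and realize the scattering data
      (∀ x t : ℝ, (bigM (poles η) E E' x t).det ≠ 0 →
        (potQ (poles η) E E' x t).im = 0 ∧ (potP (poles η) E E' x t).im = 0 ∧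
        (∀ κ : ℂ,
          SolvesThirdOrder (fun y => potQ (poles η) E E' y t) (fun y => potP (poles η) E E' y t) κ
            (fun y => jostF (poles η) E E' κ y t) x ∧
          SolvesThirdOrder (fun y => potQ (poles η) E E' y t) (fun y => potP (poles η) E E' y t) κ
            (fun y => jostG (poles η) E E' κ y t) x) ∧
        (∀ j, jostF (poles η) E E' (poles η j) x t
            = E j * Complex.exp (9 * (z ^ 2 - 1) * poles η j ^ 5 * t)
              * jostG (poles η) E E' (z * poles η j) x t ∧
          jostF (poles η) E E' (starRingEnd ℂ (poles η j)) x t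
            = E' j * Complex.exp (9 * (z - 1) * starRingEnd ℂ (poles η j) ^ 5 * t)
              * jostG (poles η) E E' (z ^ 2 * starRingEnd ℂ (poles η j)) x t)) ∧
      (∀ (t : ℝ) (κ : ℂ),
        (bigGamma (poles η) κ ≠ 0 →
          Tendsto (fun x : ℝ => Complex.exp (-(κ * x)) * jostF (poles η) E E' κ x t)
            atTop (𝓝 1) ∧
          Tendsto (fun x : ℝ => Complex.exp (-(κ * x)) * jostF (poles η) E E' κ x t)
            atBot (𝓝 (transmission (poles η) κ)⁻¹)) ∧
        (bigGamma (poles η) (-κ) ≠ 0 →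
          Tendsto (fun x : ℝ => Complex.exp (-(κ * x)) * jostG (poles η) E E' κ x t)
            atBot (𝓝 1))) ∧
      -- the limit of `det M`, the two reductions and the soliton solutions
      ∃ L : ℂ, L ≠ 0 ∧
        (∀ t : ℝ, Tendsto (fun x : ℝ => (bigM (poles η) E E' x t).det) atBot (𝓝 L)) ∧
        ∀ c : Reduction,
          (Holds c (poles η) E E' ↔ ∀ j,
            (gam (poles η) E j).im * (direction c η j).re
              = (gam (poles η) E j).re * (direction c η j).im) ∧
          (Holds c (poles η) E E' →
            (∀ j, weight c η E j ≠ 0) ∧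
            (∀ x t : ℝ,
              (bigM (poles η) E E' x t).det / L
                = ((hirotaTau η (weight c η E) x t : ℝ) : ℂ) ^ 2) ∧
            (∀ x t : ℝ, hirotaTau η (weight c η E) x t ≠ 0 →
              potQ (poles η) E E' x t
                = ((sixLogDeriv (hirotaTau η (weight c η E)) x t : ℝ) : ℂ) ∧
              SolvesSawadaKotera (sixLogDeriv (hirotaTau η (weight c η E))) x t) ∧
            ((∀ j, 0 < weight c η E j) → ∀ x t : ℝ,
              0 < hirotaTau η (weight c η E) x t ∧
              hirotaTau η (weight c η E) x t
                = Real.sqrt ((bigM (poles η) E E' x t).det / L).re))) ∧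
    -- `N = 1`
    (∀ (η : Fin 1 → ℝ) (E E' : Fin 1 → ℂ), InputData η E E' →
      ∀ r s : ℝ, gam (poles η) E 0 = r + Complex.I * s →
        (Holds .zero (poles η) E E' ↔ s = Real.sqrt 3 * r) ∧
        (s = Real.sqrt 3 * r → ∀ x t : ℝ,
          hirotaTau η (weight .zero η E) x t = 1 - 2 * r * wave (η 0) x t ∧
          (1 - 2 * r * wave (η 0) x t ≠ 0 → potQ (poles η) E E' x t
            = ((-(36 * r * η 0 ^ 2 * wave (η 0) x t
                / (1 - 2 * r * wave (η 0) x t) ^ 2) : ℝ) : ℂ)) ∧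
          (r < 0 → (bigM (poles η) E E' x t).det ≠ 0)) ∧
        (Holds .derivative (poles η) E E' ↔ s = 0) ∧
        (s = 0 → ∀ x t : ℝ,
          hirotaTau η (weight .derivative η E) x t = 1 + r * wave (η 0) x t ∧
          (1 + r * wave (η 0) x t ≠ 0 → potQ (poles η) E E' x t
            = ((18 * r * η 0 ^ 2 * wave (η 0) x t
                / (1 + r * wave (η 0) x t) ^ 2 : ℝ) : ℂ)) ∧
          (0 < r → (bigM (poles η) E E' x t).det ≠ 0))) ∧
    -- `N = 2`
    (∀ (η : Fin 2 → ℝ) (E E' : Fin 2 → ℂ), InputData η E E' →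
      ∀ r s : Fin 2 → ℝ, (∀ j, gam (poles η) E j = r j + Complex.I * s j) →
      ∀ a b : ℝ, a = η 0 → b = η 1 →
        (Holds .zero (poles η) E E' ↔
          s 0 = Real.sqrt 3 * b ^ 2 / (2 * a ^ 2 + b ^ 2) * r 0 ∧
          s 1 = Real.sqrt 3 * a ^ 2 / (a ^ 2 + 2 * b ^ 2) * r 1) ∧
        (Holds .zero (poles η) E E' → ∀ x t : ℝ,
          hirotaTau η (weight .zero η E) x t
            = 1 + 2 * r 0 * (a + b) * (a ^ 3 - b ^ 3)
                  / ((a - b) ^ 2 * (2 * a ^ 2 + b ^ 2)) * wave a x t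
                - 2 * r 1 * (a + b) * (a ^ 3 - b ^ 3)
                  / ((a - b) ^ 2 * (a ^ 2 + 2 * b ^ 2)) * wave b x t
                - 4 * r 0 * r 1 * (a ^ 6 - b ^ 6)
                  / ((a ^ 2 - b ^ 2) * (2 * a ^ 2 + b ^ 2) * (a ^ 2 + 2 * b ^ 2))
                    * (wave a x t * wave b x t)) ∧
        (Holds .derivative (poles η) E E' ↔
          s 0 = -(Real.sqrt 3 * a ^ 2 / (a ^ 2 + 2 * b ^ 2)) * r 0 ∧
          s 1 = -(Real.sqrt 3 * b ^ 2 / (2 * a ^ 2 + b ^ 2)) * r 1) ∧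
        (Holds .derivative (poles η) E E' → ∀ x t : ℝ,
          hirotaTau η (weight .derivative η E) x t
            = 1 - 2 * r 0 * (a + b) * (a ^ 3 - b ^ 3)
                  / ((a - b) ^ 2 * (a ^ 2 + 2 * b ^ 2)) * wave a x t
                + 2 * r 1 * (a + b) * (a ^ 3 - b ^ 3)
                  / ((a - b) ^ 2 * (2 * a ^ 2 + b ^ 2)) * wave b x t
                - 4 * r 0 * r 1 * (a ^ 6 - b ^ 6)
                  / ((a ^ 2 - b ^ 2) * (2 * a ^ 2 + b ^ 2) * (a ^ 2 + 2 * b ^ 2))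
                    * (wave a x t * wave b x t))) := by
  refine ⟨fun N hN η E E' h => ?_, fun η E E' h r s hg => ?_, fun η E E' h r s hg a b ha hb => ?_⟩
  · refine ⟨transmission_eq, fun x t hdet => ?_, h.jost_limits, detLimit η,
      detLimit_ne_zero h.pos h.distinct, tendsto_det_atBot h.pos, fun c => ?_⟩
    · exact ⟨h.potQ_im x t, h.potP_im x t,
        fun κ => ⟨solvesThirdOrder_exp hN hdet κ _, solvesThirdOrder_exp hN hdet κ _⟩,
        fun j => ⟨jost_relation h.pos hdet j, jost_relation_conj h.pos hdet j⟩⟩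
    · refine ⟨h.holds_iff_aligned hN c, fun hr => ?_⟩
      have ha := (h.holds_iff_aligned hN c).1 hr
      have hw := h.logDerivCoeff hN ha
      refine ⟨ha.weight_ne_zero h, fun x t => ?_, fun x t hτ => ?_, fun hpos x t => ?_⟩
      · rw [h.det_eq hN hw, mul_div_cancel_left₀ _ (detLimit_ne_zero h.pos h.distinct)]
      · exact ⟨h.potQ_eq_sixLogDeriv hN hw hτ, h.solvesSawadaKotera_weight hN ha hτ⟩
      · exact ⟨hirotaTau_pos η _ h.distinct h.pos hpos x t, h.hirotaTau_eq_sqrt hN ha hpos x t⟩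
  · refine ⟨(h.holds_iff_aligned le_rfl _).trans (aligned_one_zero hg), fun hs x t => ?_,
      (h.holds_iff_aligned le_rfl _).trans (aligned_one_derivative hg), fun hs x t => ?_⟩
    · have ha := (aligned_one_zero hg).2 hs
      obtain ⟨h1, h2, h3⟩ := h.one_soliton ha (h.weight_one_zero hg ha) x t
      have e : 1 + -(2 * r) * wave (η 0) x t = 1 - 2 * r * wave (η 0) x t := by ring
      rw [e] at h1 h2
      refine ⟨h1, fun hτ => ?_, fun hr => h3 (by linarith)⟩
      rw [h2 hτ]
      congr 1
      ring
    · exact h.one_soliton ((aligned_one_derivative hg).2 hs) (weight_one_derivative hg) x t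
  · have hz := h.holds_iff_aligned one_le_two .zero
    have hd := h.holds_iff_aligned one_le_two .derivative
    refine ⟨hz.trans ?_, fun hr => h.two_soliton_zero (hz.1 hr) hg ha hb, hd.trans ?_,
      fun hr => h.two_soliton_derivative (hd.1 hr) hg ha hb⟩
    · rw [ha, hb]; exact h.aligned_two_zero hg
    · rw [ha, hb]; exact h.aligned_two_derivative hg
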